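/- **Definitions.** A \emph{string C-group of rank $r$} is a group $\Gamma=\langle\rho_0,\dots,\rho_{r-1}\rangle$ generated by pairwise distinct involutions such that $(\rho_i\rho_j)^2=1$ whenever $|i-j|>1$, and such that $\langle\rho_j\mid j\in J\rangle\cap\langle\rho_k\mid k\in K\rangle=\langle\rho_j\mid j\in J\cap K\rangle$ for all $J,K\subseteq\{0,\dots,r-1\}$. Its maximal parabolic subgroups are $\Gamma_j=\langle\rho_i\mid i\ne j\rangle$, and its dual is obtained by reversing the order of the generators. If $\Gamma$ is a permutation group on $n$ points, its CPR graph $\mathcal G$ is the edge-labelled multigraph on these $n$ points with a single $i$-edge $\{a,b\}$ whenever $\rho_i$ maps $a$ to $b\neq a$. **Proposition.** Let $n\ge 1$ and let $\Gamma=\langle\rho_0,\dots,\rho_{r-1}\rangle$ be a string C-group of rank $r$ that is a transitive permutation group on $n$ points and all of whose maximal parabolic subgroups $\Gamma_j$ ($0\le j\le r-1$) are intransitive. Suppose that $r\ge n-4$, and that $n\ge 3+2l$ if $r=n-l$ with $1\le l\le 4$. Then the CPR graph of $\Gamma$ or that of its dual is isomorphic, as an edge-labelled graph, to one of the following graphs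 on $n$ vertices with labels $0,\dots,r-1$, for some integer $i\ge 0$ with $r-i\ge 4$ where a parameter $i$ occurs. Here $[x_1,x_2,\dots,x_m]$ denotes the path on $m+1$ vertices whose consecutive edges have labels $x_1,\dots,x_m$; an entry $\{x,y\}$ stands for a double edge with labels $x$ and $y$. The symbol $a\to b$ (for $a\le b$) abbreviates the increasing sequence $a,a+1,\dots,b$. In the non-path graphs, $p_0,p_1,\dots$ denote the vertices of the given path in order, $u,v,w$ denote further vertices, and $xy:k$ means an additional $k$-edge between $x$ and $y$. * $r=n-1$: $[0\to r-1]$. * $r=n-2$: $[1,\,0\to r-1]$. * $r=n-3$: (A) $[0\to r-1]$ with $p_0u:2,\ p_1v:2,\ uv:0$; (G) as (A), with also $p_0u:1$; (K) $[1,\,0\to r-1,\,r-2]$; (L1) $[0,1,\,0\to r-1]$; (L2) $[2,1,\,0\to r-1]$; (L3) $[\{0,2\},1,\,0\to r-1]$; (M1) $[0\to i+1,\,i+2,\,i+1\to r-1]$; (M2) $[0\to i+1,\,\{i,i+2\},\,i+1\to r-1]$. * $r=n-4$: (B) $[0\to r-1]$ with $p_0u:3,\ p_1v:3,\ p_2w:3,\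 uv:0,\ vw:1$; (C) $[0\to r-1]$ with $p_0u:2,\ p_1v:2,\ uv:0,\ uw:1$; (D) $[1,\,0\to r-1]$ with $p_1u:2,\ p_2v:2,\ uv:0$; (E) $[0\to r-1,\,r-2]$ with $p_0u:2,\ p_1v:2,\ uv:0$; (H1) as (B), with also $p_0u:1$; (H2) as (B), with also $p_0u:2$ and $p_1v:2$; (I) as (E), with also $p_0u:1$; (N1) $[0,1,\,0\to r-1,\,r-2]$; (N2) $[2,1,\,0\to r-1,\,r-2]$; (N3) $[\{0,2\},1,\,0\to r-1,\,r-2]$; (O1) $[0\to i+1,\,i+2,\,i+1\to r-1,\,r-2]$; (O2) $[0\to i+1,\,\{i,i+2\},\,i+1\to r-1,\,r-2]$; (P1) $[1,0,1,\,0\to r-1]$; (P2) $[1,2,1,\,0\to r-1]$; (P3) $[1,\{0,2\},1,\,0\to r-1]$; (Q1) $[1,2,1,\,0\to r-1]$; (Q2) $[3,2,1,\,0\to r-1]$; (Q3) $[\{1,3\},2,1,\,0\to r-1]$; (R1) $[1,0,1,2,3,\,2\to r-1]$; (R2) $[1,0,1,2,\{1,3\},\,2\to r-1]$; (S1) $[1,0,1,2,\,1\to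 r-1]$; (S2) $[1,0,1,\{0,2\},\,1\to r-1]$; (T1) $[1,0,1,2,3,4,\,3\to r-1]$; (T2) $[1,0,1,2,3,\{2,4\},\,3\to r-1]$; (U1) $[1,0,1,2,3,\,2\to r-1]$; (U2) $[1,0,1,2,\{1,3\},\,2\to r-1]$; (V1) $[1,\,0\to i+1,\,i+2,\,i+1\to r-1]$; (V2) $[1,\,0\to i+1,\,\{i,i+2\},\,i+1\to r-1]$. (The list has 38 entries; as in the original, a few of them coincide, for example (P2) and (Q1).) -/

import Mathlib

/-- `ρ 0, …, ρ (r-1)` are the distinguished generators of a string group generated by involutions: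
pairwise distinct involutions such that generators with non-consecutive indices commute. -/
structure IsSggi {G : Type*} [Group G] {r : ℕ} (ρ : Fin r → G) : Prop where
  injective : Function.Injective ρ
  involution : ∀ i, orderOf (ρ i) = 2
  commuting : ∀ i j : Fin r, 1 < |((i : ℕ) : ℤ) - ((j : ℕ) : ℤ)| → (ρ i * ρ j) ^ 2 = 1

/-- The (standard parabolic) subgroup generated by the `ρ j` with `j ∈ J`. -/
def parabolic {G : Type*} [Group G] {r : ℕ} (ρ : Fin r → G) (J : Set (Fin r)) : Subgroup G :=
  Subgroup.closure (ρ '' J)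

/-- A string C-group: a string group generated by involutions with the intersection property. -/
structure IsStringCGroup {G : Type*} [Group G] {r : ℕ} (ρ : Fin r → G) : Prop extends
    IsSggi ρ where
  intersection : ∀ J K : Set (Fin r), parabolic ρ J ⊓ parabolic ρ K = parabolic ρ (J ∩ K)

/-- The maximal parabolic subgroup `Γ_j`, generated by all `ρ i` with `i ≠ j`. -/
def maximalParabolic {G : Type*} [Group G] {r : ℕ} (ρ : Fin r → G) (j : Fin r) : Subgroup G :=
  parabolic ρ {i | i ≠ j}

/-- The dual: the same generators in reversed order. -/
def dualGenerators {G : Type*} {r : ℕ} (ρ : Fin r → G) : Fin r → G :=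
  fun i => ρ i.rev

/-- An `r`-edge-labelled multigraph on `V` with at most one edge of each label between two vertices:
for each label, the simple graph formed by the edges with that label. -/
abbrev LabelledGraph (r : ℕ) (V : Type*) : Type _ :=
  Fin r → SimpleGraph V

/-- A bijection of the vertices which preserves the edges together with their labels. -/
def LabelledGraph.Isomorphic {r : ℕ} {V W : Type*} (G : LabelledGraph r V)
    (H : LabelledGraph r W) : Prop :=
  ∃ e : V ≃ W, ∀ (i : Fin r) (a b : V), (G i).Adj a b ↔ (H i).Adj (e a) (e b)

/-- The permutation representation graph: there is an `i`-edge `{a, b}` whenever `ρ i` maps `a` to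
`b` and `a ≠ b` (the CPR graph, when `ρ` generates a string C-group). -/
def permutationGraph {r : ℕ} {V : Type*} (ρ : Fin r → Equiv.Perm V) : LabelledGraph r V :=
  fun i => SimpleGraph.fromRel fun a b => ρ i a = b

/-- The labelled graph on `{0, …, n-1}` whose edges are given by a list of triples
`(label, endpoint, endpoint)`. -/
def graphOfEdges (r n : ℕ) (E : List (ℕ × ℕ × ℕ)) : LabelledGraph r (Fin n) :=
  fun i => SimpleGraph.fromRel fun a b => ((i : ℕ), (a : ℕ), (b : ℕ)) ∈ E

/-- The edges of the path on the vertices `0, 1, 2, …` in which the vertices `k` and `k + 1` are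
joined by one edge for each label in the `k`-th entry of the given list. -/
def pathEdges (L : List (List ℕ)) : List (ℕ × ℕ × ℕ) :=
  L.zipIdx.flatMap fun p => p.1.map fun label => (label, p.2, p.2 + 1)

/-- The path with single edges labelled `a, a + 1, …, b - 1`. -/
def run (a b : ℕ) : List (List ℕ) :=
  (List.Ico a b).map fun label => [label]

/-- The names of the 38 families of graphs. -/
inductive Family : Type
  | simplex | truncated
  | A | G | K | L1 | L2 | L3 | M1 | M2
  | B | C | D | E | H1 | H2 | I | N1 | N2 | N3 | O1 | O2 | P1 | P2 | P3
  | Q1 | Q2 | Q3 | R1 | R2 | S1 | S2 | T1 | T2 | U1 | U2 | V1 | V2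

/-- The difference between the number of vertices and the number of labels. -/
def Family.corank : Family → ℕ
  | .simplex => 1
  | .truncated => 2
  | .A | .G | .K | .L1 | .L2 | .L3 | .M1 | .M2 => 3
  | _ => 4

/-- The edges of the member of a family with labels `0, …, r - 1` and parameter `i` (which is used
only in the families `M1, M2, O1, O2, V1, V2`). In the families that are not paths, the vertices
outside the long path are numbered after the vertices of that path. -/
def Family.edges (r i : ℕ) : Family → List (ℕ × ℕ × ℕ)
  | .simplex => pathEdges (run 0 r)
  | .truncated => pathEdges ([[1]] ++ run 0 r)
  | .A => pathEdges (run 0 r) ++ [(2, 0, r + 1), (2, 1, r + 2), (0, r + 1, r + 2)]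
  | .G => pathEdges (run 0 r) ++
      [(1, 0, r + 1), (2, 0, r + 1), (2, 1, r + 2), (0, r + 1, r + 2)]
  | .K => pathEdges ([[1]] ++ run 0 r ++ [[r - 2]])
  | .L1 => pathEdges ([[0], [1]] ++ run 0 r)
  | .L2 => pathEdges ([[2], [1]] ++ run 0 r)
  | .L3 => pathEdges ([[0, 2], [1]] ++ run 0 r)
  | .M1 => pathEdges (run 0 (i + 2) ++ [[i + 2]] ++ run (i + 1) r)
  | .M2 => pathEdges (run 0 (i + 2) ++ [[i, i + 2]] ++ run (i + 1) r)
  | .B => pathEdges (run 0 r) ++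
      [(3, 0, r + 1), (3, 1, r + 2), (3, 2, r + 3), (0, r + 1, r + 2), (1, r + 2, r + 3)]
  | .C => pathEdges (run 0 r) ++
      [(2, 0, r + 1), (2, 1, r + 2), (0, r + 1, r + 2), (1, r + 1, r + 3)]
  | .D => pathEdges ([[1]] ++ run 0 r) ++ [(2, 1, r + 2), (2, 2, r + 3), (0, r + 2, r + 3)]
  | .E => pathEdges (run 0 r ++ [[r - 2]]) ++
      [(2, 0, r + 2), (2, 1, r + 3), (0, r + 2, r + 3)]
  | .H1 => pathEdges (run 0 r) ++
      [(1, 0, r + 1), (3, 0, r + 1), (3, 1, r + 2), (3, 2, r + 3),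
        (0, r + 1, r + 2), (1, r + 2, r + 3)]
  | .H2 => pathEdges (run 0 r) ++
      [(2, 0, r + 1), (3, 0, r + 1), (2, 1, r + 2), (3, 1, r + 2), (3, 2, r + 3),
        (0, r + 1, r + 2), (1, r + 2, r + 3)]
  | .I => pathEdges (run 0 r ++ [[r - 2]]) ++
      [(1, 0, r + 2), (2, 0, r + 2), (2, 1, r + 3), (0, r + 2, r + 3)]
  | .N1 => pathEdges ([[0], [1]] ++ run 0 r ++ [[r - 2]])
  | .N2 => pathEdges ([[2], [1]] ++ run 0 r ++ [[r - 2]])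
  | .N3 => pathEdges ([[0, 2], [1]] ++ run 0 r ++ [[r - 2]])
  | .O1 => pathEdges (run 0 (i + 2) ++ [[i + 2]] ++ run (i + 1) r ++ [[r - 2]])
  | .O2 => pathEdges (run 0 (i + 2) ++ [[i, i + 2]] ++ run (i + 1) r ++ [[r - 2]])
  | .P1 => pathEdges ([[1], [0], [1]] ++ run 0 r)
  | .P2 => pathEdges ([[1], [2], [1]] ++ run 0 r)
  | .P3 => pathEdges ([[1], [0, 2], [1]] ++ run 0 r)
  | .Q1 => pathEdges ([[1], [2], [1]] ++ run 0 r)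
  | .Q2 => pathEdges ([[3], [2], [1]] ++ run 0 r)
  | .Q3 => pathEdges ([[1, 3], [2], [1]] ++ run 0 r)
  | .R1 => pathEdges ([[1], [0], [1], [2], [3]] ++ run 2 r)
  | .R2 => pathEdges ([[1], [0], [1], [2], [1, 3]] ++ run 2 r)
  | .S1 => pathEdges ([[1], [0], [1], [2]] ++ run 1 r)
  | .S2 => pathEdges ([[1], [0], [1], [0, 2]] ++ run 1 r)
  | .T1 => pathEdges ([[1], [0], [1], [2], [3], [4]] ++ run 3 r)
  | .T2 => pathEdges ([[1], [0], [1], [2], [3], [2, 4]] ++ run 3 r)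
  | .U1 => pathEdges ([[1], [0], [1], [2], [3]] ++ run 2 r)
  | .U2 => pathEdges ([[1], [0], [1], [2], [1, 3]] ++ run 2 r)
  | .V1 => pathEdges ([[1]] ++ run 0 (i + 2) ++ [[i + 2]] ++ run (i + 1) r)
  | .V2 => pathEdges ([[1]] ++ run 0 (i + 2) ++ [[i, i + 2]] ++ run (i + 1) r)

/-- The member of a family with labels `0, …, r - 1`, on `n` vertices, and with parameter `i`. -/
def Family.graph (F : Family) (r n i : ℕ) : LabelledGraph r (Fin n) :=
  graphOfEdges r n (F.edges r i)

/-!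
A string group generated by involutions `ρ 0, …, ρ (r - 1)` is studied through its permutation graph,
as a family of involutions `f k` of the set of vertices such that `f j` and `f k` commute if `j` and
`k` are not consecutive. If the group is transitive and the maximal parabolic subgroup without `ρ k` is
not, then some edge with label `k` is a *fracture edge*: it joins two different components of the
graph without the label `k` (`IsSggi.isStringGraph`). This combinatorial structure, `IsStringGraph`,
determines the graph up to duality if there are at most `r + 4` vertices, with three exceptions which
are excluded by the intersection property.

*Counting.* Adding the labels in increasing order, each label decreases the number of components, and
it does so by at least two if its fracture edges do not all join the same two components. As there
are only `r + 1 + w` vertices with `w ≤ 3`, the latter happens for at most `w` labels (`good_bound`).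
On the other hand, if all fracture edges of a label with several such edges join the same two
components, seen from the smaller as well as from the larger labels, then every vertex has a partner
from which many labels do not separate it, and there are too many vertices (`card_of_not_good`).
Hence there is a label `i` with a single fracture edge (`exists_split`). Its removal leaves two
components; one of them contains fracture edges with all labels below `i`, the other one those with
all labels above `i`, and one of the two has at most one vertex more than this requires. Such a
component is a path, possibly with one pendant edge (`Side.leftEnd`).

*Graphs whose last label is a pendant edge.* These are classified by induction on the number of
vertices (`listed_of_rightTrivial`); the result is an explicit list (`Core.listed`) of small graphs to
which the path with increasing labels is attached. If there is a vertex which is incident only to one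
label, and this label has several fracture edges, then it can be removed, and the possible places
where it is attached are checked (`Core.leaf_mem_listed`). Otherwise the graph is cut at the largest
label `i < s` with a single fracture edge, where `s` is the last label. The number of labels between `i`
and `s` is at most `w`, which leaves few possibilities for the second side (`Cut.right_one'`,
`Cut.right_two'`, `Cut.right_three`). If the labels above `i` do not act on the first side, then the
induction applies to it (`Cut.listed_of_pure`). If they do, then every vertex of the first side has a
partner, which forces `i ≤ 2` and leads to the squares and ladders (`Cut.left_one`, `Cut.left_two`) and
two exceptional paths (`Cut.left_zero`).

*General graphs.* Therefore the last label of the graph or of its dual is a pendant edge, or it becomes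
one after the removal of another pendant edge (`exists_leftEnd`). Thus the graph or its dual is a
listed one, possibly with an additional edge labelled `r - 2` at the end of the path
(`described_or_dual`).

*The intersection property.* In three of the listed graphs, some word in `ρ 0, ρ 1, ρ 2` acts like a
word in `ρ 1, ρ 2, ρ 3` or in `ρ 2, ρ 3`, but it does not preserve a relation which is preserved by the
common generators of the two parabolic subgroups (`not_isStringCGroup`). The remaining graphs are
compared with the families one by one. The paths of type `M2` with the least possible number of
labels belong to a family only after passing to the dual (`revPath_M2`).
-/

/-! ### Families of commuting involutions and fracture edges -/

/-- `Link f J u v`: the vertices `u` and `v` are joined by a path all of whose labels are in `J`. -/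
def Link {V : Type*} (f : ℕ → V → V) (J : Set ℕ) : V → V → Prop :=
  Relation.ReflTransGen fun a b => ∃ k ∈ J, f k a = b

/-- `Fr f k v`: the edge with label `k` at `v` is a fracture edge, that is, it joins two different
components of the graph without the label `k`. -/
def Fr {V : Type*} (f : ℕ → V → V) (k : ℕ) (v : V) : Prop :=
  ¬ Link f {k}ᶜ v (f k v)

/-- Involutions `f 0, …, f (r - 1)` such that those with non-consecutive labels commute. The family
is extended to all labels by the identity. -/
structure IsStringAction {V : Type*} (f : ℕ → V → V) (r : ℕ) : Prop where
  invol : ∀ k v, f k (f k v) = v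
  triv : ∀ k v, r ≤ k → f k v = v
  comm : ∀ j k v, j + 2 ≤ k → f j (f k v) = f k (f j v)

/-- A connected string action all of whose labels have a fracture edge. -/
structure IsStringGraph {V : Type*} (f : ℕ → V → V) (r : ℕ) : Prop extends
    IsStringAction f r where
  conn : ∀ u v, Link f Set.univ u v
  fract : ∀ k < r, ∃ v, Fr f k v

/-- The label `i` has exactly one fracture edge, which starts in `a`. -/
def Split {V : Type*} (f : ℕ → V → V) (i : ℕ) (a : V) : Prop :=
  Fr f i a ∧ ∀ v, Fr f i v → v = a ∨ v = f i a

/-- The label `i` has at least two fracture edges. -/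
def NonSplit {V : Type*} (f : ℕ → V → V) (i : ℕ) : Prop :=
  ∃ u v, Fr f i u ∧ Fr f i v ∧ v ≠ u ∧ v ≠ f i u

/-- The fracture edges with label `k` do not all join the same two components of the graph that is
formed by the labels less than `k`. -/
def Good {V : Type*} (f : ℕ → V → V) (k : ℕ) : Prop :=
  ∃ u v, Fr f k u ∧ Fr f k v ∧
    ¬ (Link f (Set.Iio k) u v ∧ Link f (Set.Iio k) (f k u) (f k v)) ∧
    ¬ (Link f (Set.Iio k) u (f k v) ∧ Link f (Set.Iio k) (f k u) v)

section Link

variable {V : Type*} {f : ℕ → V → V} {r : ℕ} {J K : Set ℕ} {u v w : V} {i j k : ℕ}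

lemma Link.refl : Link f J u u := Relation.ReflTransGen.refl

lemma Link.step (hk : k ∈ J) : Link f J u (f k u) := Relation.ReflTransGen.single ⟨k, hk, rfl⟩

lemma Link.trans (h : Link f J u v) (h' : Link f J v w) : Link f J u w :=
  Relation.ReflTransGen.trans h h'

lemma Link.mono (hJ : J ⊆ K) (h : Link f J u v) : Link f K u v := by
  induction h with
  | refl => exact Link.refl
  | tail _ h2 ih => obtain ⟨k, hk, rfl⟩ := h2; exact ih.trans (Link.step (hJ hk))

lemma Link.closed {P : V → Prop} (h : Link f J u v) (hP : ∀ p, P p → ∀ k ∈ J, P (f k p))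
    (hu : P u) : P v := by
  induction h with
  | refl => exact hu
  | tail _ h2 ih => obtain ⟨k, hk, rfl⟩ := h2; exact hP _ ih k hk

namespace IsStringAction

lemma symm (hf : IsStringAction f r) (h : Link f J u v) : Link f J v u := by
  refine h.closed (P := fun p => Link f J p u) (fun p hp k hk => ?_) Link.refl
  have h1 : Link f J (f k p) (f k (f k p)) := Link.step hk
  rw [hf.invol] at h1
  exact h1.trans hp

lemma comm' (hf : IsStringAction f r) (h : j + 2 ≤ k ∨ k + 2 ≤ j ∨ j = k) :
    f j (f k v) = f k (f j v) := by
  rcases h with h | h | h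
  · exact hf.comm _ _ _ h
  · exact (hf.comm _ _ _ h).symm
  · rw [h]

lemma eq_iff (hf : IsStringAction f r) : f k u = v ↔ u = f k v :=
  ⟨fun h => by rw [← h, hf.invol], fun h => by rw [h, hf.invol]⟩

lemma inj (hf : IsStringAction f r) (h : f k u = f k v) : u = v := by
  rw [← hf.invol k u, h, hf.invol]

lemma link_map (hf : IsStringAction f r) (hJ : ∀ k ∈ J, j + 2 ≤ k ∨ k + 2 ≤ j ∨ j = k)
    (h : Link f J u v) : Link f J (f j u) (f j v) := by
  refine h.closed (P := fun p => Link f J (f j u) (f j p)) (fun p hp k hk => ?_) Link.refl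
  rw [hf.comm' (hJ k hk)]
  exact hp.trans (Link.step hk)

/-- A vertex fixed by `f j` forces `f j` to fix all vertices which are reached by labels commuting
with `j`. -/
lemma fixed_of_link (hf : IsStringAction f r)
    (hJ : ∀ k ∈ J, j + 2 ≤ k ∨ k + 2 ≤ j ∨ j = k) (h : Link f J u v) (hu : f j u = u) :
    f j v = v := by
  refine h.closed (P := fun p => f j p = p) (fun p hp k hk => ?_) hu
  rw [hf.comm' (hJ k hk), hp]

/-- A path without the label `i` can be rearranged: first the labels below `i`, then those above. -/
lemma factor (hf : IsStringAction f r) (h : Link f {i}ᶜ u v) :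
    ∃ p, Link f (Set.Iio i) u p ∧ Link f (Set.Ioi i) p v := by
  refine h.closed (P := fun v => ∃ p, Link f (Set.Iio i) u p ∧ Link f (Set.Ioi i) p v) ?_
    ⟨u, Link.refl, Link.refl⟩
  rintro q ⟨p, h1, h2⟩ k hk
  rcases lt_or_gt_of_ne (show k ≠ i from hk) with h | h
  · refine ⟨f k p, h1.trans (Link.step h), hf.link_map (fun l hl => ?_) h2⟩
    have : i < l := hl
    omega
  · exact ⟨p, h1, h2.trans (Link.step h)⟩

lemma factor' (hf : IsStringAction f r) (h : Link f {i}ᶜ u v) :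
    ∃ p, Link f (Set.Ioi i) u p ∧ Link f (Set.Iio i) p v := by
  obtain ⟨p, h1, h2⟩ := hf.factor (hf.symm h)
  exact ⟨p, hf.symm h2, hf.symm h1⟩

end IsStringAction

lemma Link.lt_compl (h : k ≤ i) (hl : Link f (Set.Iio k) u v) : Link f {i}ᶜ u v :=
  hl.mono fun l hl => by
    have : l < k := hl
    exact fun e => by have : l = i := e; omega

lemma Link.gt_compl (h : i ≤ k) (hl : Link f (Set.Ioi k) u v) : Link f {i}ᶜ u v :=
  hl.mono fun l hl => by
    have : k < l := hl
    exact fun e => by have : l = i := e; omega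

lemma Link.step_ne (h : k ≠ i) : Link f {i}ᶜ u (f k u) := Link.step h

lemma Fr.ne (h : Fr f k v) : f k v ≠ v := fun e => h (by rw [e]; exact Link.refl)

/-- A fracture edge has no second label. -/
lemma Fr.ne_label (h : Fr f k v) (hj : j ≠ k) : f j v ≠ f k v :=
  fun e => h (by rw [← e]; exact Link.step_ne hj)

lemma Fr.lt (hf : IsStringAction f r) (h : Fr f k v) : k < r := by
  by_contra hk
  exact h.ne (hf.triv k v (by omega))

lemma Fr.symm (hf : IsStringAction f r) (h : Fr f k v) : Fr f k (f k v) := fun h' => by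
  rw [hf.invol] at h'
  exact h (hf.symm h')

lemma Fr.map (hf : IsStringAction f r) (h : Fr f k v) (hj : j + 2 ≤ k ∨ k + 2 ≤ j) :
    Fr f k (f j v) := fun h' => by
  have h1 : Link f {k}ᶜ v (f j v) := Link.step_ne (by omega)
  have h2 : Link f {k}ᶜ (f k v) (f j (f k v)) := Link.step_ne (by omega)
  rw [hf.comm' (by omega : j + 2 ≤ k ∨ k + 2 ≤ j ∨ j = k)] at h2
  exact h (h1.trans (h'.trans (hf.symm h2)))

lemma Split.ne (h : Split f i u) : f i u ≠ u := h.1.ne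

lemma Split.symm (hf : IsStringAction f r) (h : Split f i u) : Split f i (f i u) :=
  ⟨h.1.symm hf, fun v hv => by rw [hf.invol]; exact (h.2 v hv).symm⟩

lemma Split.not_nonSplit (hf : IsStringAction f r) (h : Split f i u) : ¬ NonSplit f i := by
  rintro ⟨p, q, hp, hq, h1, h2⟩
  rcases h.2 p hp with rfl | rfl <;> rcases h.2 q hq with rfl | rfl
  · exact h1 rfl
  · exact h2 rfl
  · exact h2 (hf.invol _ _).symm
  · exact h1 rfl

lemma IsStringGraph.split_or_nonSplit (hf : IsStringGraph f r) (hi : i < r) :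
    (∃ a, Split f i a) ∨ NonSplit f i := by
  obtain ⟨a, ha⟩ := hf.fract i hi
  by_cases h : ∀ v, Fr f i v → v = a ∨ v = f i a
  · exact Or.inl ⟨a, ha, h⟩
  · push Not at h
    obtain ⟨v, hv, h1, h2⟩ := h
    exact Or.inr ⟨a, v, ha, hv, h1, h2⟩

/-- The ends of a single fracture edge with label `i` are fixed by all labels commuting with `i`. -/
lemma Split.fixed (hf : IsStringAction f r) (h : Split f i u) (hj : j + 2 ≤ i ∨ i + 2 ≤ j) :
    f j u = u := by
  rcases h.2 _ (h.1.map hf hj) with h' | h'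
  · exact h'
  · exact absurd h' (h.1.ne_label (by omega))

/-- A single fracture edge leaves exactly two components. -/
lemma Split.cover (hf : IsStringGraph f r) (h : Split f i u) (v : V) :
    Link f {i}ᶜ u v ∨ Link f {i}ᶜ (f i u) v := by
  have hs := hf.toIsStringAction
  refine (hf.conn u v).closed (P := fun v => Link f {i}ᶜ u v ∨ Link f {i}ᶜ (f i u) v) ?_
    (Or.inl Link.refl)
  intro p hp k _
  rcases eq_or_ne k i with rfl | hk
  · by_cases hF : Fr f k p
    · rcases h.2 p hF with rfl | rfl
      · exact Or.inr Link.refl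
      · rw [hs.invol]; exact Or.inl Link.refl
    · have := not_not.mp hF
      exact hp.imp (·.trans this) (·.trans this)
  · exact hp.imp (·.trans (Link.step_ne hk)) (·.trans (Link.step_ne hk))

end Link

/-! ### Counting vertices by means of fracture edges -/

section Counting

variable {V : Type*} {f : ℕ → V → V} {r : ℕ}

/-- A set which contains fracture edges with `|M|` different labels contains `|M| + 1` vertices that
are pairwise separated by these labels. -/
lemma exists_separated (hf : IsStringAction f r) {O : Set V} (hO : O.Nonempty) (M : Finset ℕ)
    (hM : ∀ m ∈ M, ∃ v ∈ O, f m v ∈ O ∧ Fr f m v) :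
    ∃ T : Finset V, ↑T ⊆ O ∧ M.card + 1 ≤ T.card ∧
      ∀ p ∈ T, ∀ q ∈ T, p ≠ q → ∃ m ∈ M, ¬ Link f {m}ᶜ p q := by
  classical
  induction M using Finset.induction_on with
  | empty =>
    obtain ⟨v, hv⟩ := hO
    exact ⟨{v}, by simpa using hv, by simp, by simp +contextual⟩
  | insert m M hm ih =>
    obtain ⟨T, hT, hc, hsep⟩ := ih fun k hk => hM k (Finset.mem_insert_of_mem hk)
    obtain ⟨v, hv, hv', hF⟩ := hM m (Finset.mem_insert_self _ _)
    have hvv : ∀ k ∈ M, Link f {k}ᶜ v (f m v) := fun k hk =>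
      Link.step_ne fun e => hm (e ▸ hk)
    -- it suffices to find a large set without a vertex that is inseparable from `v`
    have key : ∀ S : Finset V, S ⊆ T → M.card ≤ S.card →
        (∀ t ∈ S, ∃ k ∈ M, ¬ Link f {k}ᶜ t v) →
        ∃ T : Finset V, ↑T ⊆ O ∧ (insert m M).card + 1 ≤ T.card ∧
          ∀ p ∈ T, ∀ q ∈ T, p ≠ q → ∃ k ∈ insert m M, ¬ Link f {k}ᶜ p q := by
      intro S hST hS hsv
      have hsv' : ∀ t ∈ S, ∃ k ∈ M, ¬ Link f {k}ᶜ t (f m v) := fun t ht => by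
        obtain ⟨k, hk, h⟩ := hsv t ht
        exact ⟨k, hk, fun h' => h (h'.trans (hf.symm (hvv k hk)))⟩
      have h1 : v ∉ S := fun h => by
        obtain ⟨k, _, h'⟩ := hsv v h; exact h' Link.refl
      have h2 : f m v ∉ S := fun h => by
        obtain ⟨k, _, h'⟩ := hsv' _ h; exact h' Link.refl
      refine ⟨insert v (insert (f m v) S), ?_, ?_, ?_⟩
      · intro p hp
        simp only [Finset.coe_insert, Set.mem_insert_iff, Finset.mem_coe] at hp
        rcases hp with rfl | rfl | hp
        exacts [hv, hv', hT (hST hp)]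
      · rw [Finset.card_insert_of_notMem hm, Finset.card_insert_of_notMem,
          Finset.card_insert_of_notMem h2]
        · omega
        · simp [h1, hF.ne.symm]
      · have wk : ∀ {p q}, (∃ k ∈ M, ¬ Link f {k}ᶜ p q) →
            ∃ k ∈ insert m M, ¬ Link f {k}ᶜ p q := fun ⟨k, hk, h⟩ =>
          ⟨k, Finset.mem_insert_of_mem hk, h⟩
        have sy : ∀ {p q}, (∃ k ∈ M, ¬ Link f {k}ᶜ p q) → ∃ k ∈ M, ¬ Link f {k}ᶜ q p :=
          fun ⟨k, hk, h⟩ => ⟨k, hk, fun h' => h (hf.symm h')⟩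
        intro p hp q hq hpq
        simp only [Finset.mem_insert] at hp hq
        rcases hp with rfl | rfl | hp <;> rcases hq with rfl | rfl | hq
        · exact absurd rfl hpq
        · exact ⟨m, Finset.mem_insert_self _ _, hF⟩
        · exact wk (sy (hsv q hq))
        · exact ⟨m, Finset.mem_insert_self _ _, fun h => hF (hf.symm h)⟩
        · exact absurd rfl hpq
        · exact wk (sy (hsv' q hq))
        · exact wk (hsv p hp)
        · exact wk (hsv' p hp)
        · exact wk (hsep p (hST hp) q (hST hq) hpq)
    by_cases ht : ∃ t ∈ T, ∀ k ∈ M, Link f {k}ᶜ t v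
    · obtain ⟨t, htT, htv⟩ := ht
      refine key (T.erase t) (Finset.erase_subset _ _) ?_ fun p hp => ?_
      · rw [Finset.card_erase_of_mem htT]; omega
      · obtain ⟨hpt, hpT⟩ := Finset.mem_erase.mp hp
        obtain ⟨k, hk, h⟩ := hsep p hpT t htT hpt
        exact ⟨k, hk, fun h' => h (h'.trans (hf.symm (htv k hk)))⟩
    · push Not at ht
      exact key T subset_rfl (by omega) ht

lemma card_add_one_le {A B : Type*} [Finite A] {g : A → B} (hg : Function.Surjective g) {x y : A}
    (hxy : x ≠ y) (h : g x = g y) : Nat.card B + 1 ≤ Nat.card A := by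
  classical
  have : Fintype A := Fintype.ofFinite A
  have : Fintype B := Fintype.ofSurjective g hg
  rw [Nat.card_eq_fintype_card, Nat.card_eq_fintype_card]
  have h1 : (Finset.univ : Finset B) ⊆ (Finset.univ.erase x).image g := by
    intro b _
    obtain ⟨a, rfl⟩ := hg b
    by_cases ha : a = x
    · exact Finset.mem_image.mpr ⟨y, by simp [hxy.symm], by rw [ha, h]⟩
    · exact Finset.mem_image.mpr ⟨a, by simp [ha], rfl⟩
  have h2 := (Finset.card_le_card h1).trans Finset.card_image_le
  rw [Finset.card_erase_of_mem (Finset.mem_univ _), Finset.card_univ, Finset.card_univ] at h2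
  have : 0 < Fintype.card A := Fintype.card_pos_iff.mpr ⟨x⟩
  omega

/-- Two different pairs of elements with equal images: the image of a surjection is smaller by at
least two. -/
lemma card_add_two_le {A B : Type*} [Finite A] {g : A → B} (hg : Function.Surjective g)
    {x y z w : A} (hxy : x ≠ y) (h : g x = g y) (hzw : z ≠ w) (h' : g z = g w)
    (h1 : ¬ (x = z ∧ y = w)) (h2 : ¬ (x = w ∧ y = z)) : Nat.card B + 2 ≤ Nat.card A := by
  classical
  -- identify first `x` with `y`
  wlog hzx : z ≠ x generalizing z w
  · push Not at hzx
    exact this hzw.symm h'.symm (fun e => h2 e) (fun e => h1 e)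
      (fun e => hzw (hzx.trans e.symm))
  have : Fintype A := Fintype.ofFinite A
  have : Fintype B := Fintype.ofSurjective g hg
  rw [Nat.card_eq_fintype_card, Nat.card_eq_fintype_card]
  have h1 : (Finset.univ : Finset B) ⊆ ((Finset.univ.erase x).erase z).image g := by
    have aux : ∀ a, a ≠ x → g a ∈ ((Finset.univ.erase x).erase z).image g := by
      intro a ha
      by_cases haz : a = z
      · subst haz
        by_cases hw : w = x
        · subst hw
          exact Finset.mem_image.mpr ⟨y, by simp; exact ⟨fun e => h2 ⟨rfl, e⟩, hxy.symm⟩,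
            by rw [h', h]⟩
        · exact Finset.mem_image.mpr ⟨w, by simp [hw, hzw.symm], by rw [h']⟩
      · exact Finset.mem_image.mpr ⟨a, by simp [ha, haz], rfl⟩
    intro b _
    obtain ⟨a, rfl⟩ := hg b
    by_cases ha : a = x
    · rw [ha, h]; exact aux y hxy.symm
    · exact aux a ha
  have h3 := (Finset.card_le_card h1).trans Finset.card_image_le
  rw [Finset.card_erase_of_mem (by simp [hzx]), Finset.card_erase_of_mem (Finset.mem_univ _),
    Finset.card_univ, Finset.card_univ] at h3
  have : 1 < Fintype.card A := Fintype.one_lt_card_iff.mpr ⟨z, x, hzx⟩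
  omega

/-- Linkedness by labels in `J`, as an equivalence relation. -/
def linkSetoid (hf : IsStringAction f r) (J : Set ℕ) : Setoid V where
  r := Link f J
  iseqv := ⟨fun _ => Link.refl, hf.symm, Link.trans⟩

/-- Adding the labels one after the other, each label with a fracture edge decreases the number of
components by at least one, and a good label decreases it by at least two. -/
lemma good_bound [Finite V] [Nonempty V] (hf : IsStringAction f r) {M N : Finset ℕ} (hMN : M ⊆ N)
    (hN : ∀ k ∈ N, ∃ v, Fr f k v) (hM : ∀ m ∈ M, Good f m) :
    N.card + 1 + M.card ≤ Nat.card V := by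
  classical
  let Q : ℕ → Type _ := fun j => Quotient (linkSetoid hf (Set.Iio j))
  have filter_succ : ∀ (P : Finset ℕ) (j : ℕ),
      (P.filter (· < j + 1)).card ≤ (P.filter (· < j)).card + if j ∈ P then 1 else 0 := by
    intro P j
    split_ifs with hj
    · refine (Finset.card_le_card (t := insert j (P.filter (· < j))) fun x hx => ?_).trans
        (Finset.card_insert_le _ _)
      simp only [Finset.mem_filter, Finset.mem_insert] at hx ⊢
      rcases Nat.lt_succ_iff_lt_or_eq.mp hx.2 with h | h
      · exact Or.inr ⟨hx.1, h⟩
      · exact Or.inl h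
    · refine Finset.card_le_card fun x hx => ?_
      simp only [Finset.mem_filter] at hx ⊢
      rcases Nat.lt_succ_iff_lt_or_eq.mp hx.2 with h | h
      · exact ⟨hx.1, h⟩
      · exact absurd (h ▸ hx.1) hj
  have key : ∀ j, Nat.card (Q j) + (N.filter (· < j)).card + (M.filter (· < j)).card ≤
      Nat.card V := by
    intro j
    induction j with
    | zero =>
      have := Nat.card_le_card_of_surjective (Quotient.mk (linkSetoid hf (Set.Iio 0)))
        Quotient.mk_surjective
      rw [Finset.filter_false_of_mem (by simp), Finset.filter_false_of_mem (by simp)]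
      simpa only [Finset.card_empty, add_zero] using this
    | succ j ih =>
      let g : Q j → Q (j + 1) := Quotient.map' id fun a b (h : Link f _ a b) =>
        h.mono fun l (hl : l < j) => show l < j + 1 by omega
      have hg : Function.Surjective g := fun q => by
        obtain ⟨a, rfl⟩ := Quotient.exists_rep q
        exact ⟨Quotient.mk _ a, rfl⟩
      have hstep : ∀ v, g (Quotient.mk _ v) = g (Quotient.mk _ (f j v)) := fun v =>
        Quotient.sound (show Link f _ _ _ from Link.step (show j < j + 1 by omega))
      have hne : ∀ v, Fr f j v → (Quotient.mk _ v : Q j) ≠ Quotient.mk _ (f j v) :=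
        fun v hv e => hv ((show Link f _ _ _ from Quotient.exact e).lt_compl le_rfl)
      have e1 := filter_succ N j
      have e2 := filter_succ M j
      by_cases hjN : j ∈ N
      · by_cases hjM : j ∈ M
        · obtain ⟨u, v, hu, hv, h1, h2⟩ := hM j hjM
          have h3 := card_add_two_le hg (hne u hu) (hstep u) (hne v hv) (hstep v)
            (fun e => h1 ⟨Quotient.exact e.1, Quotient.exact e.2⟩)
            (fun e => h2 ⟨Quotient.exact e.1, Quotient.exact e.2⟩)
          simp only [hjN, hjM, if_true] at e1 e2
          omega
        · obtain ⟨u, hu⟩ := hN j hjN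
          have h3 := card_add_one_le hg (hne u hu) (hstep u)
          simp only [hjN, hjM, if_true, if_false] at e1 e2
          omega
      · have hjM : j ∉ M := fun h => hjN (hMN h)
        have h3 := Nat.card_le_card_of_surjective g hg
        simp only [hjN, hjM, if_false] at e1 e2
        omega
  have h := key r
  have h1 : N.filter (· < r) = N := Finset.filter_true_of_mem fun m hm => by
    obtain ⟨v, hv⟩ := hN m hm
    exact hv.lt hf
  have h2 : M.filter (· < r) = M := Finset.filter_true_of_mem fun m hm => by
    obtain ⟨v, hv⟩ := hN m (hMN hm)
    exact hv.lt hf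
  have h3 : 0 < Nat.card (Q r) := by
    have : Nonempty (Q r) := ⟨Quotient.mk _ (Classical.arbitrary V)⟩
    exact Nat.card_pos
  rw [h1, h2] at h
  omega

/-- The case of `good_bound` in which all labels have a fracture edge. -/
lemma IsStringGraph.good_bound [Finite V] [Nonempty V] (hf : IsStringGraph f r) (M : Finset ℕ)
    (hM : ∀ m ∈ M, m < r ∧ Good f m) : r + 1 + M.card ≤ Nat.card V := by
  have := _root_.good_bound hf.toIsStringAction (M := M) (N := Finset.range r)
    (fun m hm => Finset.mem_range.mpr (hM m hm).1)
    (fun k hk => hf.fract k (Finset.mem_range.mp hk)) (fun m hm => (hM m hm).2)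
  rwa [Finset.card_range] at this

/-- Different vertices of a list in a set are at most as many as the elements of the set. -/
lemma length_le_ncard [Finite V] {S : Set V} {l : List V} (hl : l.Nodup) (h : ∀ x ∈ l, x ∈ S) :
    l.length ≤ S.ncard := by
  classical
  rw [← List.toFinset_card_of_nodup hl, ← Set.ncard_coe_finset]
  exact Set.ncard_le_ncard (fun x hx => h x (by simpa using hx)) (Set.toFinite _)

lemma mem_of_ncard_le [Finite V] {S : Set V} {l : List V} (hl : l.Nodup) (h : ∀ x ∈ l, x ∈ S)
    (hc : S.ncard ≤ l.length) {x : V} (hx : x ∈ S) : x ∈ l := by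
  by_contra hxl
  have := length_le_ncard (l := x :: l) (List.nodup_cons.mpr ⟨hxl, hl⟩) (by simpa using ⟨hx, h⟩)
  simp at this
  omega

end Counting

/-! ### Duals and induced subgraphs -/

section Dual

variable {V : Type*} {f : ℕ → V → V} {r : ℕ}

/-- The same involutions with the labels `0, …, r - 1` in reversed order. -/
def dual (r : ℕ) (f : ℕ → V → V) (k : ℕ) (v : V) : V :=
  if k < r then f (r - 1 - k) v else v

lemma dual_of_lt {k : ℕ} (hk : k < r) : dual r f k = f (r - 1 - k) := by
  funext v; simp [dual, hk]

lemma dual_dual (hf : IsStringAction f r) : dual r (dual r f) = f := by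
  funext k v
  by_cases hk : k < r
  · rw [dual_of_lt hk, dual_of_lt (by omega)]
    congr 1; omega
  · simp [dual, hk, hf.triv k v (by omega)]

lemma link_dual {J K : Set ℕ} {u v : V} (hJK : ∀ k < r, r - 1 - k ∈ J → k ∈ K) (hf : IsStringAction f r)
    (h : Link f J u v) : Link (dual r f) K u v := by
  refine h.closed (P := fun p => Link (dual r f) K u p) (fun p hp k hk => ?_) Link.refl
  by_cases hkr : k < r
  · have : f k p = dual r f (r - 1 - k) p := by
      rw [dual_of_lt (by omega)]; congr 1; omega
    rw [this]
    exact hp.trans (Link.step (hJK _ (by omega) (by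
      rwa [show r - 1 - (r - 1 - k) = k by omega])))
  · rw [hf.triv k p (by omega)]; exact hp

lemma IsStringAction.dual (hf : IsStringAction f r) : IsStringAction (dual r f) r where
  invol k v := by
    by_cases hk : k < r
    · rw [dual_of_lt hk, hf.invol]
    · simp [_root_.dual, hk]
  triv k v hk := by simp [_root_.dual, Nat.not_lt.mpr hk]
  comm j k v h := by
    by_cases hk : k < r
    · rw [dual_of_lt hk, dual_of_lt (show j < r by omega)]
      exact hf.comm' (by omega)
    · simp [_root_.dual, hk]

lemma fr_dual (hf : IsStringAction f r) {k : ℕ} (hk : k < r) {v : V} (h : Fr f (r - 1 - k) v) :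
    Fr (dual r f) k v := fun h' => h (by
  have h1 := link_dual (J := {k}ᶜ) (K := {r - 1 - k}ᶜ) (fun l hl hl' e => hl' (by
    have : l = r - 1 - k := e
    show r - 1 - l = k
    omega)) hf.dual h'
  rwa [dual_dual hf, dual_of_lt hk] at h1)

lemma fr_of_dual (hf : IsStringAction f r) {k : ℕ} (hk : k < r) {v : V} (h : Fr (dual r f) k v) :
    Fr f (r - 1 - k) v := by
  have := fr_dual hf.dual (k := r - 1 - k) (by omega)
    (v := v) (by rwa [show r - 1 - (r - 1 - k) = k by omega])
  rwa [dual_dual hf] at this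

lemma IsStringGraph.dual (hf : IsStringGraph f r) : IsStringGraph (dual r f) r where
  toIsStringAction := hf.toIsStringAction.dual
  conn u v := link_dual (fun _ _ _ => trivial) hf.toIsStringAction (hf.conn u v)
  fract k hk := by
    obtain ⟨v, hv⟩ := hf.fract (r - 1 - k) (by omega)
    exact ⟨v, fr_dual hf.toIsStringAction hk hv⟩

lemma Split.dual (hf : IsStringAction f r) {i : ℕ} (hi : i < r) {a : V} (h : Split f (r - 1 - i) a) :
    Split (dual r f) i a :=
  ⟨fr_dual hf hi h.1, fun v hv => by
    rw [dual_of_lt hi]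
    exact h.2 v (fr_of_dual hf hi hv)⟩

end Dual

section Sub

variable {V : Type*} {f : ℕ → V → V} {r s : ℕ}

open Classical in
/-- The graph induced on a set of vertices, with the labels less than `s`: edges which leave the set
are dropped. -/
noncomputable def sub (S : Set V) (s : ℕ) (f : ℕ → V → V) (k : ℕ) (v : S) : S :=
  if h : k < s ∧ f k v ∈ S then ⟨f k v, h.2⟩ else v

lemma sub_of_mem {S : Set V} {k : ℕ} {v : S} (hk : k < s) (h : f k v ∈ S) :
    (sub S s f k v : V) = f k v := by
  simp [sub, hk, h]

lemma sub_of_notMem {S : Set V} {k : ℕ} {v : S} (h : f k v ∉ S) : sub S s f k v = v := by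
  simp [sub, h]

/-- The conditions under which a set of vertices induces a string graph: it has a single vertex `u`
with edges that leave the set, at most one of which has a label less than `s`, and the labels from
`s` on do not act inside the set. -/
structure IsPort (f : ℕ → V → V) (S : Set V) (s : ℕ) (u : V) (m : ℕ) : Prop where
  mem : u ∈ S
  port : ∀ v ∈ S, ∀ k, f k v ∉ S → v = u
  label : ∀ k < s, f k u ∉ S → k = m
  triv : ∀ v ∈ S, ∀ k, s ≤ k → f k v ∈ S → f k v = v

lemma link_of_sub {S : Set V} {J : Set ℕ} {u v : S} (h : Link (sub S s f) J u v) :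
    Link f J (u : V) v := by
  refine h.closed (P := fun p : S => Link f J (u : V) (p : V)) (fun p hp k hk => ?_) Link.refl
  unfold sub
  split_ifs with h
  · exact hp.trans (Link.step hk)
  · exact hp

open Classical in
lemma link_sub (hf : IsStringAction f r) {S : Set V} {u : V} {m : ℕ} (hS : IsPort f S s u m)
    {J : Set ℕ} {p q : S} (h : Link f J (p : V) q) : Link (sub S s f) J p q := by
  -- retract the whole graph to `S`, sending everything outside to the port
  let π : V → S := fun v => if h : v ∈ S then ⟨v, h⟩ else ⟨u, hS.mem⟩
  have hπ : ∀ v (hv : v ∈ S), π v = ⟨v, hv⟩ := fun v hv => by simp [π, hv]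
  have hπ' : ∀ v, v ∉ S → π v = ⟨u, hS.mem⟩ := fun v hv => by simp [π, hv]
  have key : Link (sub S s f) J p (π q) := by
    refine h.closed (P := fun v => Link (sub S s f) J p (π v)) (fun v hv k hk => ?_) ?_
    · by_cases h1 : v ∈ S <;> by_cases h2 : f k v ∈ S
      · rw [hπ _ h1] at hv
        rw [hπ _ h2]
        by_cases hks : k < s
        · have : (⟨f k v, h2⟩ : S) = sub S s f k ⟨v, h1⟩ := by
            apply Subtype.ext; rw [sub_of_mem hks h2]
          rw [this]
          exact hv.trans (Link.step hk)
        · have : (⟨f k v, h2⟩ : S) = ⟨v, h1⟩ :=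
            Subtype.ext (hS.triv v h1 k (by omega) h2)
          rwa [this]
      · have := hS.port v h1 k h2
        subst this
        rw [hπ' _ h2]
        rwa [hπ _ h1] at hv
      · have := hS.port (f k v) h2 k (by rwa [hf.invol])
        rw [hπ _ h2]
        rw [hπ' _ h1] at hv
        simpa [this] using hv
      · rw [hπ' _ h2]
        rwa [hπ' _ h1] at hv
    · rw [hπ _ p.2]; exact Link.refl
  rwa [hπ _ q.2] at key

lemma fr_sub (hf : IsStringAction f r) {S : Set V} {u : V} {m : ℕ} (hS : IsPort f S s u m) {k : ℕ}
    (hk : k < s) {v : S} : Fr (sub S s f) k v ↔ f k v ∈ S ∧ Fr f k (v : V) := by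
  constructor
  · intro h
    have h1 : f k v ∈ S := by
      by_contra h1
      exact h.ne (sub_of_notMem h1)
    refine ⟨h1, fun h' => h (link_sub hf hS ?_)⟩
    rwa [sub_of_mem hk h1]
  · rintro ⟨h1, h⟩ h'
    have := link_of_sub h'
    rw [sub_of_mem hk h1] at this
    exact h this

/-- If a label leads from `S` to the outside, then it does so at the port; hence the induced maps still
commute. -/
lemma isStringAction_sub (hf : IsStringAction f r) {S : Set V} {u : V} {m : ℕ}
    (hS : IsPort f S s u m) : IsStringAction (sub S s f) s := by
  have inv : ∀ k (v : S), sub S s f k (sub S s f k v) = v := by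
    intro k v
    by_cases h : k < s ∧ f k v ∈ S
    · apply Subtype.ext
      have h1 : f k (sub S s f k v : V) = v := by rw [sub_of_mem h.1 h.2, hf.invol]
      rw [sub_of_mem h.1 (by rw [h1]; exact v.2), h1]
    · have : sub S s f k v = v := by simp only [sub, h, dite_false]
      rw [this, this]
  refine ⟨inv, fun k v hk => by simp [sub, Nat.not_lt.mpr hk], ?_⟩
  intro j k v hjk
  by_cases hk : k < s
  swap
  · have : ∀ v : S, sub S s f k v = v := fun v => by simp [sub, hk]
    rw [this, this]
  have hj : j < s := by omega
  have hne : j ≠ k := by omega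
  have hcm : ∀ x, f j (f k x) = f k (f j x) := fun x => hf.comm j k x hjk
  -- a vertex at the port cannot be moved out and stay in for two commuting labels
  have out : ∀ a b : ℕ, a < s → b < s → a ≠ b → (∀ x, f a (f b x) = f b (f a x)) →
      f a v ∉ S → f b v ∈ S ∧ sub S s f a (sub S s f b v) = sub S s f b v := by
    intro a b ha hb hab hc h1
    have hvu : (v : V) = u := hS.port v v.2 a h1
    have h2 : f b v ∈ S := by
      by_contra h2
      rw [hvu] at h1 h2
      exact hab ((hS.label a ha h1).trans (hS.label b hb h2).symm)
    refine ⟨h2, sub_of_notMem ?_⟩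
    rw [sub_of_mem hb h2]
    intro h3
    have h4 : f b (f a (f b v)) ∉ S := by rw [hc, hf.invol]; exact h1
    have h5 := hS.port _ h3 b h4
    rw [h5] at h4
    rw [hvu] at h1
    exact hab ((hS.label a ha h1).trans (hS.label b hb h4).symm)
  by_cases h1 : f j v ∈ S
  · by_cases h2 : f k v ∈ S
    · by_cases h3 : f j (f k v) ∈ S
      · apply Subtype.ext
        have e1 : f j (sub S s f k v : V) ∈ S := by rwa [sub_of_mem hk h2]
        have e2 : f k (sub S s f j v : V) ∈ S := by rwa [sub_of_mem hj h1, ← hcm]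
        rw [sub_of_mem hj e1, sub_of_mem hk e2, sub_of_mem hk h2, sub_of_mem hj h1, hcm]
      · have h4 := hS.port _ h2 j h3
        have h5 := hS.port _ h1 k (by rwa [← hcm])
        rw [h4, ← h5, hf.invol] at h3
        exact absurd v.2 h3
    · obtain ⟨h3, h4⟩ := out k j hk hj hne.symm (fun x => (hcm x).symm) h2
      rw [h4, sub_of_notMem h2]
  · obtain ⟨h3, h4⟩ := out j k hj hk hne hcm h1
    rw [h4, sub_of_notMem h1]

lemma isStringGraph_sub (hf : IsStringGraph f r) {S : Set V} {u : V} {m : ℕ}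
    (hS : IsPort f S s u m) (hfr : ∀ k < s, ∃ v ∈ S, f k v ∈ S ∧ Fr f k v) :
    IsStringGraph (sub S s f) s := by
  have hs := hf.toIsStringAction
  refine ⟨isStringAction_sub hs hS, fun p q => link_sub hs hS (hf.conn p q), fun k hk => ?_⟩
  obtain ⟨v, hv, h1, h2⟩ := hfr k hk
  exact ⟨⟨v, hv⟩, (fr_sub hs hS hk).mpr ⟨h1, h2⟩⟩

end Sub

/-! ### The existence of a label with a single fracture edge -/

section ExistsSplit

variable {V : Type*} {f : ℕ → V → V} {r : ℕ}

/-- If every vertex of a separated set has an inseparable partner, the number of vertices doubles. -/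
lemma two_mul_card_le [Finite V] (hf : IsStringAction f r) {O : Set V} {M : Finset ℕ} {T : Finset V}
    (hT : ↑T ⊆ O) (hsep : ∀ p ∈ T, ∀ q ∈ T, p ≠ q → ∃ m ∈ M, ¬ Link f {m}ᶜ p q)
    (hp : ∀ p ∈ O, ∃ q ∈ O, q ≠ p ∧ ∀ m ∈ M, Link f {m}ᶜ p q) : 2 * T.card ≤ O.ncard := by
  classical
  choose! g hgO hgne hg using hp
  have h1 : Set.InjOn g T := by
    intro p hp q hq e
    by_contra hpq
    obtain ⟨m, hm, h⟩ := hsep p hp q hq hpq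
    exact h ((hg p (hT hp) m hm).trans (by rw [e]; exact hf.symm (hg q (hT hq) m hm)))
  have h2 : Disjoint T (T.image g) := by
    rw [Finset.disjoint_left]
    intro p hp hp'
    obtain ⟨q, hq, rfl⟩ := Finset.mem_image.mp hp'
    obtain ⟨m, hm, h⟩ := hsep q hq _ hp (hgne q (hT hq)).symm
    exact h (hg q (hT hq) m hm)
  have h3 : ((T ∪ T.image g : Finset V) : Set V) ⊆ O := by
    intro p hp
    rcases Finset.mem_union.mp (Finset.mem_coe.mp hp) with hp | hp
    · exact hT hp
    · obtain ⟨q, hq, rfl⟩ := Finset.mem_image.mp hp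
      exact hgO q (hT hq)
  have h4 := Set.ncard_le_ncard h3 (Set.toFinite _)
  rw [Set.ncard_coe_finset, Finset.card_union_of_disjoint h2, Finset.card_image_of_injOn h1] at h4
  omega

/-- A component without the label `i` has at least as many vertices as the product of its separated
sets for the labels below and above `i`. -/
lemma mul_card_le [Finite V] (hf : IsStringAction f r) {i : ℕ} {a : V} {O : Set V}
    (hO : ∀ v, v ∈ O ↔ Link f {i}ᶜ a v) {M N : Finset ℕ} (hM : ∀ m ∈ M, m < i)
    (hN : ∀ m ∈ N, i < m) {S T : Finset V} (hSO : ↑S ⊆ O) (hTO : ↑T ⊆ O)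
    (hS : ∀ p ∈ S, ∀ q ∈ S, p ≠ q → ∃ m ∈ M, ¬ Link f {m}ᶜ p q)
    (hT : ∀ p ∈ T, ∀ q ∈ T, p ≠ q → ∃ m ∈ N, ¬ Link f {m}ᶜ p q) :
    S.card * T.card ≤ O.ncard := by
  classical
  have h1 : ∀ p q, p ∈ O → q ∈ O → ∃ s, Link f (Set.Ioi i) p s ∧ Link f (Set.Iio i) s q :=
    fun p q hp hq => hf.factor' ((hf.symm ((hO p).mp hp)).trans ((hO q).mp hq))
  choose! g hg1 hg2 using h1
  rw [← Finset.card_product, ← Set.ncard_coe_finset]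
  refine Set.ncard_le_ncard_of_injOn (fun x => g x.1 x.2) ?_ ?_ (Set.toFinite _)
  · rintro ⟨p, q⟩ hpq
    obtain ⟨hp, hq⟩ := Finset.mem_product.mp (Finset.mem_coe.mp hpq)
    rw [hO]
    exact ((hO p).mp (hSO hp)).trans ((hg1 p q (hSO hp) (hTO hq)).gt_compl le_rfl)
  · rintro ⟨p, q⟩ hpq ⟨p', q'⟩ hpq' (e : g p q = g p' q')
    obtain ⟨hp, hq⟩ := Finset.mem_product.mp (Finset.mem_coe.mp hpq)
    obtain ⟨hp', hq'⟩ := Finset.mem_product.mp (Finset.mem_coe.mp hpq')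
    have e1 := hg1 p q (hSO hp) (hTO hq)
    have e2 := hg2 p q (hSO hp) (hTO hq)
    have e3 := hg1 p' q' (hSO hp') (hTO hq')
    have e4 := hg2 p' q' (hSO hp') (hTO hq')
    rw [e] at e1 e2
    have hpp : p = p' := by
      by_contra hne
      obtain ⟨m, hm, h⟩ := hS p hp p' hp' hne
      exact h ((e1.trans (hf.symm e3)).gt_compl (hM m hm).le)
    have hqq : q = q' := by
      by_contra hne
      obtain ⟨m, hm, h⟩ := hT q hq q' hq' hne
      exact h (((hf.symm e2).trans e4).lt_compl (hN m hm).le)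
    rw [hpp, hqq]

/-- The variant of `Good` for the labels greater than `k`. -/
def GoodAbove (f : ℕ → V → V) (k : ℕ) : Prop :=
  ∃ u v, Fr f k u ∧ Fr f k v ∧
    ¬ (Link f (Set.Ioi k) u v ∧ Link f (Set.Ioi k) (f k u) (f k v)) ∧
    ¬ (Link f (Set.Ioi k) u (f k v) ∧ Link f (Set.Ioi k) (f k u) v)

lemma GoodAbove.dual (hf : IsStringAction f r) {k : ℕ} (hk : k < r) (h : GoodAbove f k) :
    Good (dual r f) (r - 1 - k) := by
  obtain ⟨u, v, hu, hv, h1, h2⟩ := h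
  have e : r - 1 - (r - 1 - k) = k := by omega
  have hd : _root_.dual r f (r - 1 - k) = f k := by rw [dual_of_lt (by omega), e]
  have hl : ∀ {p q}, Link (_root_.dual r f) (Set.Iio (r - 1 - k)) p q → Link f (Set.Ioi k) p q := by
    intro p q h
    have := link_dual (K := Set.Ioi k) (fun l hl (hl' : r - 1 - l < r - 1 - k) =>
      show k < l by omega) hf.dual h
    rwa [dual_dual hf] at this
  refine ⟨u, v, fr_dual hf (by omega) (by rwa [e]), fr_dual hf (by omega) (by rwa [e]), ?_, ?_⟩
  · rw [hd]; exact fun h => h1 ⟨hl h.1, hl h.2⟩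
  · rw [hd]; exact fun h => h2 ⟨hl h.1, hl h.2⟩

/-- If a label with several fracture edges is good neither from below nor from above, then every
vertex has a partner from which no label separates it, so that there are many vertices. -/
lemma card_of_not_good [Finite V] (hf : IsStringGraph f r) {k : ℕ} (hk : NonSplit f k)
    (h1 : ¬ Good f k) (h2 : ¬ GoodAbove f k) : 2 * r + 2 ≤ Nat.card V := by
  classical
  have hs := hf.toIsStringAction
  obtain ⟨u, u', hu, hu', hne, hne'⟩ := hk
  have h1' : ∀ p, Fr f k p →
      (Link f (Set.Iio k) u p ∧ Link f (Set.Iio k) (f k u) (f k p)) ∨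
      (Link f (Set.Iio k) u (f k p) ∧ Link f (Set.Iio k) (f k u) p) := fun p hp => by
    by_contra h
    push Not at h
    exact h1 ⟨u, p, hu, hp, fun e => h.1 e.1 e.2, fun e => h.2 e.1 e.2⟩
  -- choose the direction of the second edge so that it is parallel to the first one
  obtain ⟨v, hv, hvne, ha, hb⟩ : ∃ v, Fr f k v ∧ v ≠ u ∧ Link f (Set.Iio k) u v ∧
      Link f (Set.Iio k) (f k u) (f k v) := by
    rcases h1' u' hu' with h | h
    · exact ⟨u', hu', hne, h⟩
    · refine ⟨f k u', hu'.symm hs, fun e => hne' ?_, h.1, by rw [hs.invol]; exact h.2⟩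
      rw [← e, hs.invol]
  obtain ⟨hc, hd⟩ : Link f (Set.Ioi k) u v ∧ Link f (Set.Ioi k) (f k u) (f k v) := by
    by_contra h
    refine h2 ⟨u, v, hu, hv, h, fun e => hv ?_⟩
    exact (hs.symm (ha.lt_compl le_rfl)).trans (e.1.gt_compl le_rfl)
  have hcover : ∀ p, Link f {k}ᶜ u p ∨ Link f {k}ᶜ (f k u) p := by
    intro p
    refine (hf.conn u p).closed (P := fun p => Link f {k}ᶜ u p ∨ Link f {k}ᶜ (f k u) p) ?_
      (Or.inl Link.refl)
    intro q hq l _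
    rcases eq_or_ne l k with rfl | hl
    · by_cases hF : Fr f l q
      · rcases h1' q hF with h | h
        · exact Or.inr (h.2.lt_compl le_rfl)
        · exact Or.inl (h.1.lt_compl le_rfl)
      · exact hq.imp (·.trans (not_not.mp hF)) (·.trans (not_not.mp hF))
    · exact hq.imp (·.trans (Link.step_ne hl)) (·.trans (Link.step_ne hl))
  -- the bound for one of the two components
  have side : ∀ x y, y ≠ x → Link f (Set.Iio k) x y → Link f (Set.Ioi k) x y → ∀ M : Finset ℕ,
      (∀ m ∈ M, m ≠ k ∧ ∃ p, Link f {k}ᶜ x p ∧ Fr f m p) →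
      2 * (M.card + 1) ≤ {p | Link f {k}ᶜ x p}.ncard := by
    intro x y hxy hlt hgt M hM
    obtain ⟨T, hTO, hTc, hT⟩ := exists_separated hs (O := {p | Link f {k}ᶜ x p})
      ⟨x, Link.refl⟩ M (fun m hm => by
        obtain ⟨hmk, p, hp, hF⟩ := hM m hm
        exact ⟨p, hp, hp.trans (Link.step_ne hmk), hF⟩)
    have hpart : ∀ p, Link f {k}ᶜ x p →
        ∃ q, q ≠ p ∧ Link f (Set.Iio k) p q ∧ Link f (Set.Ioi k) p q := by
      intro p hp
      refine hp.closed (P := fun p => ∃ q, q ≠ p ∧ Link f (Set.Iio k) p q ∧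
        Link f (Set.Ioi k) p q) ?_ ⟨y, hxy, hlt, hgt⟩
      rintro p ⟨q, hqp, hq1, hq2⟩ l hl
      refine ⟨f l q, fun e => hqp (hs.inj e), ?_⟩
      rcases lt_or_gt_of_ne (show l ≠ k from hl) with h | h
      · have h' : l ∈ Set.Iio k := h
        refine ⟨(hs.symm (Link.step h')).trans (hq1.trans (Link.step h')), hs.link_map ?_ hq2⟩
        intro m (hm : k < m); omega
      · have h' : l ∈ Set.Ioi k := h
        refine ⟨hs.link_map ?_ hq1, (hs.symm (Link.step h')).trans (hq2.trans (Link.step h'))⟩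
        intro m (hm : m < k); omega
    have := two_mul_card_le hs hTO hT (fun p hp => by
      obtain ⟨q, hqp, hq1, hq2⟩ := hpart p hp
      refine ⟨q, Link.trans hp (hq1.lt_compl le_rfl), hqp, fun m hm => ?_⟩
      rcases lt_or_gt_of_ne (hM m hm).1 with h | h
      · exact hq2.gt_compl h.le
      · exact hq1.lt_compl h.le)
    omega
  let A := ((Finset.range r).erase k).filter fun m => ∃ p, Link f {k}ᶜ u p ∧ Fr f m p
  let B := ((Finset.range r).erase k).filter fun m => ∃ p, Link f {k}ᶜ (f k u) p ∧ Fr f m p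
  have hA := side u v hvne ha hc A fun m hm => by
    obtain ⟨h, h'⟩ := Finset.mem_filter.mp hm
    exact ⟨(Finset.mem_erase.mp h).1, h'⟩
  have hB := side (f k u) (f k v) (fun e => hvne (hs.inj e)) hb hd B fun m hm => by
    obtain ⟨h, h'⟩ := Finset.mem_filter.mp hm
    exact ⟨(Finset.mem_erase.mp h).1, h'⟩
  have hAB : (Finset.range r).erase k ⊆ A ∪ B := by
    intro m hm
    obtain ⟨hmk, hmr⟩ := Finset.mem_erase.mp hm
    obtain ⟨p, hp⟩ := hf.fract m (Finset.mem_range.mp hmr)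
    rcases hcover p with h | h
    · exact Finset.mem_union_left _ (Finset.mem_filter.mpr ⟨hm, p, h, hp⟩)
    · exact Finset.mem_union_right _ (Finset.mem_filter.mpr ⟨hm, p, h, hp⟩)
  have h3 := (Finset.card_le_card hAB).trans (Finset.card_union_le _ _)
  rw [Finset.card_erase_of_mem (Finset.mem_range.mpr (hu.lt hs)), Finset.card_range] at h3
  have h4 : Disjoint {p | Link f {k}ᶜ u p} {p | Link f {k}ᶜ (f k u) p} := by
    rw [Set.disjoint_left]
    exact fun p hp hp' => hu (Link.trans hp (hs.symm hp'))
  have h5 := Set.ncard_union_eq h4 (Set.toFinite _) (Set.toFinite _)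
  have h6 := Set.ncard_le_card ({p | Link f {k}ᶜ u p} ∪ {p | Link f {k}ᶜ (f k u) p})
  omega

/-- A label which is good neither from below nor from above would force too many vertices, and at most
`w` labels are good from either side; since `2 * w < r`, some label has a single fracture edge. -/
lemma exists_split [Finite V] [Nonempty V] (hf : IsStringGraph f r) {w : ℕ}
    (hc : Nat.card V = r + 1 + w) (hw : w ≤ 3) (hr : w + 4 ≤ r) : ∃ i < r, ∃ a, Split f i a := by
  classical
  by_contra hno
  push Not at hno
  have hns : ∀ i < r, NonSplit f i := fun i hi =>
    (hf.split_or_nonSplit hi).resolve_left fun ⟨a, ha⟩ => hno i hi a ha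
  let A := (Finset.range r).filter (Good f)
  let B := (Finset.range r).filter (Good (dual r f))
  have hA := hf.good_bound A fun m hm => by
    simpa [A] using hm
  have hB := hf.dual.good_bound B fun m hm => by
    simpa [B] using hm
  have h1 : Finset.range r ⊆ A ∪ B.image (r - 1 - ·) := by
    intro k hk
    have hk' := Finset.mem_range.mp hk
    by_cases h1 : Good f k
    · exact Finset.mem_union_left _ (Finset.mem_filter.mpr ⟨hk, h1⟩)
    · by_cases h2 : GoodAbove f k
      · refine Finset.mem_union_right _ (Finset.mem_image.mpr ⟨r - 1 - k, ?_, by omega⟩)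
        exact Finset.mem_filter.mpr ⟨Finset.mem_range.mpr (by omega),
          h2.dual hf.toIsStringAction hk'⟩
      · have := card_of_not_good hf (hns k hk') h1 h2
        omega
  have h2 := (Finset.card_le_card h1).trans (Finset.card_union_le _ _)
  have h3 := Finset.card_image_le (s := B) (f := (r - 1 - ·))
  rw [Finset.card_range] at h2
  omega

end ExistsSplit

/-! ### Graphs which consist of a core and a path -/

/-- A description of the graphs which arise from a fixed edge-labelled graph by attaching a path
with increasing labels. The vertices are numbered; `rel l x y` holds if there is an edge of the fixed
part with label `l` from `x` to `y`. The path `k₀, k₀ + 1, …, r - 1` starts in the vertex `c - 1` and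
continues through `c, c + 1, …`. The description makes sense if there are at least `rmin` labels. -/
structure Core where
  rel : ℕ → ℕ → ℕ → Prop
  c : ℕ
  k₀ : ℕ
  rmin : ℕ

namespace Core

/-- The edges of the graph with `r` labels described by a core. -/
def full (K : Core) (r l x y : ℕ) : Prop :=
  K.rel l x y ∨ (K.k₀ ≤ l ∧ l < r ∧ x + K.k₀ + 1 = l + K.c ∧ y = x + 1)

/-- The number of vertices of the graph with `r` labels described by a core. -/
def size (K : Core) (r : ℕ) : ℕ := K.c + r - K.k₀

/-- Add a new vertex, which gets the number `0`, and join it to the vertex `a` by an edge with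
label `m`. -/
def leaf (m a : ℕ) (K : Core) : Core where
  rel l x y := (l = m ∧ x = 0 ∧ y = a + 1) ∨ ∃ x' y', x = x' + 1 ∧ y = y' + 1 ∧ K.rel l x' y'
  c := K.c + 1
  k₀ := K.k₀
  rmin := max K.rmin (m + 2)

/-- The path `0, 1, …`. -/
def S : Core := ⟨fun _ _ _ => False, 1, 0, 1⟩

/-- The path `1, 0, 1, 2, …`. -/
def T : Core := S.leaf 1 0

/-- The path `0, 1, 0, 1, 2, …`. -/
def L1 : Core := T.leaf 0 0

/-- The path `2, 1, 0, 1, 2, …`. -/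
def L2 : Core := T.leaf 2 0

/-- The path `{0, 2}, 1, 0, 1, 2, …`. -/
def L3 : Core :=
  ⟨fun l x y => ((l = 0 ∨ l = 2) ∧ x = 0 ∧ y = 1) ∨ (l = 1 ∧ x = 1 ∧ y = 2), 3, 0, 3⟩

/-- The path `{1, 3}, 2, 1, 0, 1, 2, …`. -/
def Q3 : Core :=
  ⟨fun l x y => ((l = 1 ∨ l = 3) ∧ x = 0 ∧ y = 1) ∨ (l = 2 ∧ x = 1 ∧ y = 2) ∨
    (l = 1 ∧ x = 2 ∧ y = 3), 4, 0, 4⟩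

/-- The path `0, …, i + 1, i + 2, i + 1, i + 2, …`. -/
def M1 (i : ℕ) : Core :=
  ⟨fun l x y => (x < i + 2 ∧ l = x ∧ y = x + 1) ∨ (l = i + 2 ∧ x = i + 2 ∧ y = i + 3),
    i + 4, i + 1, i + 4⟩

/-- The path `0, …, i + 1, {i, i + 2}, i + 1, i + 2, …`. -/
def M2 (i : ℕ) : Core :=
  ⟨fun l x y => (x < i + 2 ∧ l = x ∧ y = x + 1) ∨
    ((l = i ∨ l = i + 2) ∧ x = i + 2 ∧ y = i + 3), i + 4, i + 1, i + 3⟩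

/-- A square with labels `0` and `2`, two vertices of which are on the path `0, 1, …`. -/
def A : Core :=
  ⟨fun l x y => (l = 2 ∧ x = 2 ∧ y = 0) ∨ (l = 2 ∧ x = 3 ∧ y = 1) ∨ (l = 0 ∧ x = 0 ∧ y = 1),
    3, 0, 4⟩

/-- The graph `A` with a second edge between two vertices. -/
def G : Core :=
  ⟨fun l x y => (l = 1 ∧ x = 2 ∧ y = 0) ∨ A.rel l x y, 3, 0, 3⟩

/-- A ladder with rungs labelled `3`, one side of which is the start of the path `0, 1, …`. -/
def B : Core :=
  ⟨fun l x y => (l = 3 ∧ x = 3 ∧ y = 0) ∨ (l = 3 ∧ x = 4 ∧ y = 1) ∨ (l = 3 ∧ x = 5 ∧ y = 2) ∨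
    (l = 0 ∧ x = 0 ∧ y = 1) ∨ (l = 1 ∧ x = 1 ∧ y = 2), 4, 0, 5⟩

/-- The ladder `B` with an additional edge labelled `1`. -/
def H1 : Core := ⟨fun l x y => (l = 1 ∧ x = 3 ∧ y = 0) ∨ B.rel l x y, 4, 0, 4⟩

/-- The ladder `B` with two additional edges labelled `2`. -/
def H2 : Core :=
  ⟨fun l x y => (l = 2 ∧ x = 3 ∧ y = 0) ∨ (l = 2 ∧ x = 4 ∧ y = 1) ∨ B.rel l x y, 4, 0, 4⟩

/-- The ladder `B` with the additional edges of both `H1` and `H2`. -/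
def X3 : Core :=
  ⟨fun l x y => (l = 1 ∧ x = 3 ∧ y = 0) ∨ H2.rel l x y, 4, 0, 4⟩

/-- The cores of the graphs with `r` labels and `r + 1 + w` vertices in which the last label
is a pendant edge. Three of them, with `w = 3`, do not come from string C-groups. -/
def listed : ℕ → Set Core
  | 0 => {S}
  | 1 => {T}
  | 2 => {L1, L2, L3, A, G} ∪ {K | ∃ i, K = M1 i ∨ K = M2 i}
  | 3 => {B, H1, H2, X3, Q3, L1.leaf 1 0, L2.leaf 1 0, L2.leaf 3 0, L3.leaf 1 0,
      A.leaf 1 0, A.leaf 1 1, A.leaf 1 2, G.leaf 1 1} ∪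
      {K | ∃ i, K = (M1 i).leaf 1 0 ∨ K = (M2 i).leaf 1 0}
  | _ => ∅

/-- The consistency conditions on the numbers in the description of a core. -/
structure WF (K : Core) : Prop where
  pos : 0 < K.c
  le : K.k₀ < K.rmin
  rel : ∀ l x y, K.rel l x y → l < K.rmin ∧ x < K.c + K.rmin - K.k₀ ∧ y < K.c + K.rmin - K.k₀ ∧
    x ≠ y

lemma WF.leaf {K : Core} (h : K.WF) {m a : ℕ} (ha : a < K.c + K.rmin - K.k₀) :
    (K.leaf m a).WF where
  pos := Nat.succ_pos _
  le := lt_of_lt_of_le h.le (le_max_left _ _)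
  rel l x y := by
    have := h.le
    rintro (⟨rfl, rfl, rfl⟩ | ⟨x', y', rfl, rfl, h'⟩)
    · simp only [Core.leaf]; omega
    · have := h.rel _ _ _ h'
      simp only [Core.leaf]; omega

lemma WF.size {K : Core} (h : K.WF) {r l x y : ℕ} (hr : K.rmin ≤ r) (hE : K.full r l x y) :
    l < r ∧ x < K.size r ∧ y < K.size r ∧ x ≠ y := by
  have := h.le
  have := h.pos
  rcases hE with hE | hE
  · have := h.rel _ _ _ hE
    simp only [Core.size]; omega
  · simp only [Core.size]; omega

lemma wf_S : S.WF := ⟨by simp [S], by simp [S], by simp [S]⟩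

lemma wf_T : T.WF := wf_S.leaf (by simp [S])

lemma wf_listed {w : ℕ} {K : Core} (hK : K ∈ listed w) : K.WF ∧ K.c = K.k₀ + 1 + w := by
  have h1 : L1.WF := wf_T.leaf (by simp [T, S, leaf])
  have h2 : L2.WF := wf_T.leaf (by simp [T, S, leaf])
  have h3 : L3.WF := ⟨by simp [L3], by simp [L3], by intro l x y; simp only [L3]; omega⟩
  have h4 : Q3.WF := ⟨by simp [Q3], by simp [Q3], by intro l x y; simp only [Q3]; omega⟩
  have h5 : A.WF := ⟨by simp [A], by simp [A], by intro l x y; simp only [A]; omega⟩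
  have h6 : G.WF := ⟨by simp [G], by simp [G], by intro l x y; simp only [G, A]; omega⟩
  have h7 : ∀ i, (M1 i).WF := fun i =>
    ⟨by simp [M1], by simp [M1], by intro l x y; simp only [M1]; omega⟩
  have h8 : ∀ i, (M2 i).WF := fun i =>
    ⟨by simp [M2], by simp [M2], by intro l x y; simp only [M2]; omega⟩
  have h9 : B.WF := ⟨by simp [B], by simp [B], by intro l x y; simp only [B]; omega⟩
  have h10 : H1.WF := ⟨by simp [H1], by simp [H1], by intro l x y; simp only [H1, B]; omega⟩
  have h11 : H2.WF := ⟨by simp [H2], by simp [H2], by intro l x y; simp only [H2, B]; omega⟩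
  have h12 : X3.WF := ⟨by simp [X3], by simp [X3], by intro l x y; simp only [X3, H2, B]; omega⟩
  match w, hK with
  | 0, hK => obtain rfl : K = S := hK; exact ⟨wf_S, rfl⟩
  | 1, hK => obtain rfl : K = T := hK; exact ⟨wf_T, rfl⟩
  | 2, hK =>
    rcases hK with (rfl | rfl | rfl | rfl | rfl) | ⟨i, rfl | rfl⟩
    exacts [⟨h1, rfl⟩, ⟨h2, rfl⟩, ⟨h3, rfl⟩, ⟨h5, rfl⟩, ⟨h6, rfl⟩, ⟨h7 i, rfl⟩, ⟨h8 i, rfl⟩]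
  | 3, hK =>
    rcases hK with (rfl | rfl | rfl | rfl | rfl | rfl | rfl | rfl | rfl | rfl | rfl | rfl | rfl) |
      ⟨i, rfl | rfl⟩
    exacts [⟨h9, rfl⟩, ⟨h10, rfl⟩, ⟨h11, rfl⟩, ⟨h12, rfl⟩, ⟨h4, rfl⟩,
      ⟨h1.leaf (by simp [L1, T, S, leaf]), rfl⟩, ⟨h2.leaf (by simp [L2, T, S, leaf]), rfl⟩,
      ⟨h2.leaf (by simp [L2, T, S, leaf]), rfl⟩, ⟨h3.leaf (by simp [L3]), rfl⟩,
      ⟨h5.leaf (by simp [A]), rfl⟩, ⟨h5.leaf (by simp [A]), rfl⟩, ⟨h5.leaf (by simp [A]), rfl⟩,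
      ⟨h6.leaf (by simp [G]), rfl⟩, ⟨(h7 i).leaf (by simp [M1]; omega), rfl⟩,
      ⟨(h8 i).leaf (by simp [M2]; omega), rfl⟩]

/-- If a vertex of a listed graph other than the last one is incident only to labels which differ by
one from `m`, then adding a pendant edge with label `m` to this vertex gives a listed graph. -/
lemma leaf_mem_listed {w : ℕ} {K : Core} (hK : K ∈ listed w) (hw : w ≤ 2) {r m a : ℕ}
    (hr : K.rmin ≤ r) (ha : a + 1 < K.size r)
    (h : ∀ l y, K.full r l a y ∨ K.full r l y a → l + 1 = m ∨ l = m + 1) :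
    K.leaf m a ∈ listed (w + 1) := by
  obtain ⟨hwf, hc⟩ := wf_listed hK
  have hle := hwf.le
  have hac : a < K.c := by
    by_contra hac
    have h1 := h (a + K.k₀ - K.c) (a - 1) (Or.inr (Or.inr (by simp only [size] at ha; omega)))
    have h2 := h (a + K.k₀ - K.c + 1) (a + 1) (Or.inl (Or.inr (by simp only [size] at ha; omega)))
    omega
  -- the first edge of the path
  have htail : a + 1 = K.c → K.k₀ + 1 = m ∨ K.k₀ = m + 1 := fun e =>
    h K.k₀ (a + 1) (Or.inl (Or.inr (by omega)))
  have hrel : ∀ l y, K.rel l a y ∨ K.rel l y a → l + 1 = m ∨ l = m + 1 := fun l y hl =>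
    h l y (hl.imp Or.inl Or.inl)
  match w, hK with
  | 0, hK =>
    obtain rfl : K = S := hK
    have : a = 0 := by simp only [S] at hac; omega
    subst this
    have := htail rfl
    have : m = 1 := by simp only [S] at this; omega
    subst this
    exact Set.mem_singleton T
  | 1, hK =>
    obtain rfl : K = T := hK
    have h0 : T.c = 2 := rfl
    have h1 : ∀ l x y, T.rel l x y ↔ (l = 1 ∧ x = 0 ∧ y = 1) := by
      intro l x y; simp [T, leaf, S]
    have h2 : T.k₀ = 0 := rfl
    simp only [h1] at hrel
    have h3 : a = 0 ∨ a = 1 := by omega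
    rcases h3 with rfl | rfl
    · have := hrel 1 1 (by simp)
      have : m = 0 ∨ m = 2 := by omega
      rcases this with rfl | rfl
      · exact Or.inl (Or.inl rfl)
      · exact Or.inl (Or.inr (Or.inl rfl))
    · have := hrel 1 0 (by simp)
      have := htail (by omega)
      omega
  | 2, hK =>
    rcases hK with (rfl | rfl | rfl | rfl | rfl) | ⟨i, rfl | rfl⟩
    · have h0 : L1.c = 3 := rfl
      have h2 : L1.k₀ = 0 := rfl
      have h1 : ∀ l x y, (l = 0 ∧ x = 0 ∧ y = 1) ∨ (l = 1 ∧ x = 1 ∧ y = 2) → L1.rel l x y := by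
        rintro l x y (⟨rfl, rfl, rfl⟩ | ⟨rfl, rfl, rfl⟩)
        · exact Or.inl ⟨rfl, rfl, rfl⟩
        · exact Or.inr ⟨0, 1, rfl, rfl, Or.inl ⟨rfl, rfl, rfl⟩⟩
      have hrel : ∀ l y, ((l = 0 ∧ a = 0 ∧ y = 1) ∨ (l = 1 ∧ a = 1 ∧ y = 2)) ∨
          ((l = 0 ∧ y = 0 ∧ a = 1) ∨ (l = 1 ∧ y = 1 ∧ a = 2)) → l + 1 = m ∨ l = m + 1 :=
        fun l y hl => hrel l y (hl.imp (h1 _ _ _) (h1 _ _ _))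
      have h3 : a = 0 ∨ a = 1 ∨ a = 2 := by omega
      rcases h3 with rfl | rfl | rfl
      · have := hrel 0 1 (by simp)
        have : m = 1 := by omega
        subst this
        simp [listed]
      · have := hrel 0 0 (by simp)
        have := hrel 1 2 (by simp)
        omega
      · have := hrel 1 1 (by simp)
        have := htail (by omega)
        omega
    · have h0 : L2.c = 3 := rfl
      have h2 : L2.k₀ = 0 := rfl
      have h1 : ∀ l x y, (l = 2 ∧ x = 0 ∧ y = 1) ∨ (l = 1 ∧ x = 1 ∧ y = 2) → L2.rel l x y := by
        rintro l x y (⟨rfl, rfl, rfl⟩ | ⟨rfl, rfl, rfl⟩)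
        · exact Or.inl ⟨rfl, rfl, rfl⟩
        · exact Or.inr ⟨0, 1, rfl, rfl, Or.inl ⟨rfl, rfl, rfl⟩⟩
      have hrel : ∀ l y, ((l = 2 ∧ a = 0 ∧ y = 1) ∨ (l = 1 ∧ a = 1 ∧ y = 2)) ∨
          ((l = 2 ∧ y = 0 ∧ a = 1) ∨ (l = 1 ∧ y = 1 ∧ a = 2)) → l + 1 = m ∨ l = m + 1 :=
        fun l y hl => hrel l y (hl.imp (h1 _ _ _) (h1 _ _ _))
      have h3 : a = 0 ∨ a = 1 ∨ a = 2 := by omega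
      rcases h3 with rfl | rfl | rfl
      · have := hrel 2 1 (by simp)
        have : m = 1 ∨ m = 3 := by omega
        rcases this with rfl | rfl <;> simp [listed]
      · have := hrel 2 0 (by simp)
        have := hrel 1 2 (by simp)
        omega
      · have := hrel 1 1 (by simp)
        have := htail (by omega)
        omega
    · have h0 : L3.c = 3 := rfl
      have h2 : L3.k₀ = 0 := rfl
      simp only [L3] at hrel
      have h3 : a = 0 ∨ a = 1 ∨ a = 2 := by omega
      rcases h3 with rfl | rfl | rfl
      · have := hrel 0 1 (by simp)
        have : m = 1 := by omega
        subst this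
        simp [listed]
      · have := hrel 0 0 (by simp)
        have := hrel 1 2 (by simp)
        omega
      · have := hrel 1 1 (by simp)
        have := htail (by omega)
        omega
    · have h0 : A.c = 3 := rfl
      have h2 : A.k₀ = 0 := rfl
      simp only [A] at hrel
      have h3 : a = 0 ∨ a = 1 ∨ a = 2 := by omega
      rcases h3 with rfl | rfl | rfl
      · have := hrel 0 1 (by simp)
        have : m = 1 := by omega
        subst this
        simp [listed]
      · have := hrel 0 0 (by simp)
        have : m = 1 := by omega
        subst this
        simp [listed]
      · have := hrel 2 0 (by simp)
        have := htail (by omega)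
        have : m = 1 := by omega
        subst this
        simp [listed]
    · have h0 : G.c = 3 := rfl
      have h2 : G.k₀ = 0 := rfl
      simp only [G, A] at hrel
      have h3 : a = 0 ∨ a = 1 ∨ a = 2 := by omega
      rcases h3 with rfl | rfl | rfl
      · have := hrel 0 1 (by simp)
        have := hrel 1 2 (by simp)
        omega
      · have := hrel 0 0 (by simp)
        have : m = 1 := by omega
        subst this
        simp [listed]
      · have := hrel 1 0 (by simp)
        have := htail (by omega)
        omega
    · have h0 : (M1 i).c = i + 4 := rfl
      have h2 : (M1 i).k₀ = i + 1 := rfl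
      simp only [M1] at hrel
      rcases Nat.eq_zero_or_pos a with rfl | ha0
      · have := hrel 0 1 (by simp)
        have : m = 1 := by omega
        subst this
        exact Or.inr ⟨i, Or.inl rfl⟩
      · by_cases ha1 : a ≤ i + 2
        · have := hrel (a - 1) (a - 1) (by omega)
          have := hrel a (a + 1) (by omega)
          omega
        · have := hrel (i + 2) (i + 2) (by omega)
          have := htail (by omega)
          omega
    · have h0 : (M2 i).c = i + 4 := rfl
      have h2 : (M2 i).k₀ = i + 1 := rfl
      simp only [M2] at hrel
      rcases Nat.eq_zero_or_pos a with rfl | ha0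
      · have := hrel 0 1 (by simp)
        have : m = 1 := by omega
        subst this
        exact Or.inr ⟨i, Or.inr rfl⟩
      · by_cases ha1 : a ≤ i + 1
        · have := hrel (a - 1) (a - 1) (by omega)
          have := hrel a (a + 1) (by omega)
          omega
        · by_cases ha2 : a = i + 2
          · have := hrel (i + 1) (i + 1) (by omega)
            have := hrel i (i + 3) (by omega)
            omega
          · have := hrel i (i + 2) (by omega)
            have := htail (by omega)
            omega

end Core

section VertexNumbering

variable {V : Type*} {f : ℕ → V → V} {r : ℕ}

/-- The numbering `v` of the vertices by `0, …, n - 1` identifies the edges of the graph with the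
relation `E`. -/
structure VertexNumbering (f : ℕ → V → V) (n : ℕ) (E : ℕ → ℕ → ℕ → Prop) (v : ℕ → V) : Prop where
  surj : ∀ p, ∃ a < n, v a = p
  adj : ∀ l a b, E l a b → f l (v a) = v b
  fix : ∀ l, ∀ a < n, (∀ b, ¬ E l a b ∧ ¬ E l b a) → f l (v a) = v a

lemma VertexNumbering.inj {n : ℕ} {E : ℕ → ℕ → ℕ → Prop} {v : ℕ → V} (h : VertexNumbering f n E v)
    (hc : Nat.card V = n) {a b : ℕ} (ha : a < n) (hb : b < n) (e : v a = v b) : a = b := by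
  have hs : Function.Surjective fun i : Fin n => v i := fun p => by
    obtain ⟨a, ha, rfl⟩ := h.surj p
    exact ⟨⟨a, ha⟩, rfl⟩
  have : Finite V := Finite.of_surjective _ hs
  have : Fintype V := Fintype.ofFinite V
  have hi : Function.Injective fun i : Fin n => v i :=
    ((Fintype.bijective_iff_surjective_and_card _).mpr
      ⟨hs, by rw [Fintype.card_fin, ← hc, Nat.card_eq_fintype_card]⟩).1
  exact congrArg Fin.val (@hi ⟨a, ha⟩ ⟨b, hb⟩ e)

/-- The vertex `b` is incident to the label `s` only, and this is the single fracture edge with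
label `s`. The case of interest is that `s` is the last label. -/
structure RightTrivial (f : ℕ → V → V) (s : ℕ) (b : V) : Prop where
  fixed : ∀ k, k ≠ s → f k b = b
  split : Split f s b

/-- The graph is described by a listed core, and `b` is the last vertex of the path. -/
def Listed (f : ℕ → V → V) (r : ℕ) (b : V) (w : ℕ) : Prop :=
  ∃ K ∈ Core.listed w, K.rmin ≤ r ∧ ∃ v, VertexNumbering f (K.size r) (K.full r) v ∧ v (K.size r - 1) = b

lemma Core.size_eq {w : ℕ} {K : Core} (hK : K ∈ Core.listed w) (hr : K.rmin ≤ r) :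
    K.size r = r + 1 + w := by
  obtain ⟨h1, h2⟩ := Core.wf_listed hK
  have := h1.le
  simp only [Core.size]; omega

/-- Attaching a pendant edge to a graph described by a core. -/
lemma VertexNumbering.leaf (hf : IsStringAction f r) {z : V} {m : ℕ} (hz : ∀ k, k ≠ m → f k z = z)
    (hm : f m z ≠ z) {K : Core} (hK : K.WF) (hr : K.rmin ≤ r) {v : ℕ → ({z}ᶜ : Set V)}
    (h : VertexNumbering (sub {z}ᶜ r f) (K.size r) (K.full r) v)
    (hc : Nat.card ({z}ᶜ : Set V) = K.size r) {a : ℕ} (ha : a < K.size r)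
    (hva : (v a : V) = f m z) :
    VertexNumbering f ((K.leaf m a).size r) ((K.leaf m a).full r)
      (fun k => if k = 0 then z else (v (k - 1) : V)) := by
  have hle := hK.le
  have hpos := hK.pos
  have hsize : (K.leaf m a).size r = K.size r + 1 := by
    simp only [Core.size, Core.leaf]; omega
  have hfull : ∀ l x y, (K.leaf m a).full r l x y ↔
      (l = m ∧ x = 0 ∧ y = a + 1) ∨ ∃ x' y', x = x' + 1 ∧ y = y' + 1 ∧ K.full r l x' y' := by
    intro l x y
    simp only [Core.full, Core.leaf]
    constructor
    · rintro ((h | ⟨x', y', rfl, rfl, h⟩) | h)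
      · exact Or.inl h
      · exact Or.inr ⟨x', y', rfl, rfl, Or.inl h⟩
      · exact Or.inr ⟨x - 1, y - 1, by omega, by omega, Or.inr (by omega)⟩
    · rintro (h | ⟨x', y', rfl, rfl, h | h⟩)
      · exact Or.inl (Or.inl h)
      · exact Or.inl (Or.inr ⟨x', y', rfl, rfl, h⟩)
      · exact Or.inr (by omega)
  refine ⟨fun p => ?_, fun l x y hE => ?_, fun l x hx hE => ?_⟩
  · by_cases hp : p = z
    · exact ⟨0, by omega, by simp [hp]⟩
    · obtain ⟨b, hb, e⟩ := h.surj ⟨p, hp⟩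
      exact ⟨b + 1, by omega, by simp [e]⟩
  · rcases (hfull l x y).mp hE with ⟨rfl, rfl, rfl⟩ | ⟨x', y', rfl, rfl, hE'⟩
    · simp [hva]
    · have hb := hK.size hr hE'
      have e := h.adj _ _ _ hE'
      have hmem : f l (v x') ∈ ({z}ᶜ : Set V) := by
        by_contra hmem
        rw [sub_of_notMem hmem] at e
        exact hb.2.2.2 (h.inj hc hb.2.1 hb.2.2.1 e)
      simp only [Nat.add_eq_zero_iff, one_ne_zero, and_false, if_false, Nat.add_sub_cancel]
      rw [← sub_of_mem hb.1 hmem, e]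
  · rcases Nat.eq_zero_or_pos x with rfl | hx0
    · simp only [if_true]
      refine hz l fun e => ?_
      exact (hE (a + 1)).1 ((hfull _ _ _).mpr (Or.inl ⟨e, rfl, rfl⟩))
    · obtain ⟨x, rfl⟩ : ∃ x', x = x' + 1 := ⟨x - 1, by omega⟩
      simp only [Nat.add_eq_zero_iff, one_ne_zero, and_false, if_false, Nat.add_sub_cancel]
      have e := h.fix l x (by omega) fun b =>
        ⟨fun hE' => (hE (b + 1)).1 ((hfull _ _ _).mpr (Or.inr ⟨_, _, rfl, rfl, hE'⟩)),
          fun hE' => (hE (b + 1)).2 ((hfull _ _ _).mpr (Or.inr ⟨_, _, rfl, rfl, hE'⟩))⟩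
      by_cases hmem : f l (v x) ∈ ({z}ᶜ : Set V)
      · by_cases hl : l < r
        · rw [← sub_of_mem hl hmem, e]
        · exact hf.triv l _ (by omega)
      · have e' : f l (v x) = z := by simpa using hmem
        have e'' : (v x : V) = f l z := (hf.eq_iff).mp e'
        by_cases hl : l = m
        · subst hl
          have := h.inj hc (by omega) ha (Subtype.ext (e''.trans hva.symm))
          subst this
          exact absurd ((hfull _ _ _).mpr (Or.inl ⟨rfl, rfl, rfl⟩)) (hE 0).2
        · rw [hz l hl] at e''
          exact absurd e'' (v x).2

/-- Extending the path of a graph described by a core. -/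
lemma VertexNumbering.extend {s : ℕ} (hf : IsStringAction f (s + 1)) {b : V} (hb : ∀ k, k ≠ s → f k b = b)
    (hs : ∀ v, v ≠ b → v ≠ f s b → f s v = v)
    {K : Core} (hK : K.WF) (hr : K.rmin ≤ s) {v : ℕ → ({b}ᶜ : Set V)}
    (h : VertexNumbering (sub {b}ᶜ s f) (K.size s) (K.full s) v) (hc : Nat.card ({b}ᶜ : Set V) = K.size s)
    (hv : (v (K.size s - 1) : V) = f s b) :
    VertexNumbering f (K.size (s + 1)) (K.full (s + 1))
      (fun k => if k < K.size s then (v k : V) else b) := by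
  have hle := hK.le
  have hpos := hK.pos
  have hsize : K.size (s + 1) = K.size s + 1 := by
    simp only [Core.size]; omega
  have hsp : 0 < K.size s := by simp only [Core.size]; omega
  have hfull : ∀ l x y, K.full (s + 1) l x y ↔
      (l = s ∧ x + 1 = K.size s ∧ y = K.size s) ∨ K.full s l x y := by
    intro l x y
    simp only [Core.full, Core.size]
    constructor
    · rintro (h | h)
      · exact Or.inr (Or.inl h)
      · by_cases hl : l = s
        · left; omega
        · right; right; omega
    · rintro (h | h | h)
      · right; omega
      · exact Or.inl h
      · right; omega
  have hmem : ∀ l ≠ s, ∀ x, f l (v x) ∈ ({b}ᶜ : Set V) := fun l hl x e => by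
    have e' : (v x : V) = f l b := (hf.eq_iff).mp e
    rw [hb l hl] at e'
    exact (v x).2 e'
  refine ⟨fun p => ?_, fun l x y hE => ?_, fun l x hx hE => ?_⟩
  · by_cases hp : p = b
    · exact ⟨K.size s, by omega, by simp [hp]⟩
    · obtain ⟨x, hx, e⟩ := h.surj ⟨p, hp⟩
      exact ⟨x, by omega, by simp [e, hx]⟩
  · rcases (hfull l x y).mp hE with ⟨rfl, hx, rfl⟩ | hE
    · have : x < K.size l := by omega
      have hx' : x = K.size l - 1 := by omega
      simp only [this, if_true, lt_irrefl, if_false]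
      rw [hx', hv, hf.invol]
    · have hb := hK.size hr hE
      simp only [hb.2.1, hb.2.2.1, if_true]
      rw [← sub_of_mem hb.1 (hmem l (by omega) x), h.adj _ _ _ hE]
  · by_cases hxs : x < K.size s
    · simp only [hxs, if_true]
      by_cases hl : l = s
      · subst hl
        refine hs _ (v x).2 fun e => ?_
        have := h.inj hc hxs (by omega) (Subtype.ext (e.trans hv.symm))
        exact (hE (K.size l)).1 ((hfull _ _ _).mpr (Or.inl ⟨rfl, by omega, rfl⟩))
      · by_cases hl' : l < s
        · rw [← sub_of_mem hl' (hmem l hl x), h.fix l x hxs fun y =>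
            ⟨fun hE' => (hE y).1 ((hfull _ _ _).mpr (Or.inr hE')),
              fun hE' => (hE y).2 ((hfull _ _ _).mpr (Or.inr hE'))⟩]
        · exact hf.triv l _ (by omega)
    · simp only [hxs, if_false]
      refine hb l fun e => ?_
      exact (hE (K.size s - 1)).2 ((hfull _ _ _).mpr (Or.inl ⟨e, by omega, by omega⟩))

end VertexNumbering

/-! ### Cutting a graph along a single fracture edge -/

section RightTrivial

variable {V : Type*} {f : ℕ → V → V} {r s : ℕ} {b : V}

/-- If `b` is fixed by the labels up to `j`, then the component of `b` without the label `j` is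
fixed by all labels below `j`. -/
lemma IsStringAction.factor_fixed (hf : IsStringAction f r) {j : ℕ} (hb : ∀ k < j, f k b = b)
    {v : V} (h : Link f {j}ᶜ b v) : Link f (Set.Ioi j) b v ∧ ∀ k < j, f k v = v := by
  obtain ⟨p, h1, h2⟩ := hf.factor' h
  have hp : ∀ k < j, f k p = p := fun k hk =>
    hf.fixed_of_link (fun l (hl : j < l) => by omega) h1 (hb k hk)
  have : v = p := h2.closed (P := fun v => v = p) (fun q hq k hk => by rw [hq]; exact hp k hk) rfl
  rw [this]
  exact ⟨h1, hp⟩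

/-- In a connected graph, each component without the label `j` contains an end of a fracture edge with
label `j`. -/
lemma exists_fr (hconn : ∀ u v, Link f Set.univ u v) {j : ℕ} {u : V} (h : Fr f j u) (b : V) :
    ∃ v, Link f {j}ᶜ b v ∧ Fr f j v := by
  by_contra hno
  push Not at hno
  have key : ∀ v, Link f {j}ᶜ b v := fun v =>
    (hconn b v).closed (P := fun v => Link f {j}ᶜ b v) (fun p hp k _ => by
      by_cases hk : k = j
      · subst hk
        exact hp.trans (not_not.mp (hno p hp))
      · exact hp.trans (Link.step_ne hk)) Link.refl
  exact hno u (key u) h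

/-- If a vertex is fixed by all labels up to `j`, then a label `j` with several fracture edges is
good: the fracture edge that separates `b` from the rest starts in a vertex fixed by the labels
below `j`. -/
lemma good_of_nonSplit (hf : IsStringAction f r) (hconn : ∀ u v, Link f Set.univ u v) {j : ℕ}
    (hb : ∀ k < j, f k b = b) (h : NonSplit f j) : Good f j := by
  obtain ⟨u, u', hu, hu', h1, h2⟩ := h
  obtain ⟨v, hv, hF⟩ := exists_fr hconn hu b
  have hfix := (hf.factor_fixed hb hv).2
  have hne : ∀ w, Link f (Set.Iio j) v w → w = v := fun w hw =>
    hw.closed (P := fun w => w = v) (fun q hq k hk => by rw [hq]; exact hfix k hk) rfl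
  obtain ⟨w, hw, hw1, hw2⟩ : ∃ w, Fr f j w ∧ w ≠ v ∧ f j w ≠ v := by
    by_cases hh : u = v ∨ f j u = v
    · refine ⟨u', hu', ?_, ?_⟩
      · rintro rfl
        rcases hh with rfl | rfl
        · exact h1 rfl
        · exact h2 rfl
      · rintro rfl
        rcases hh with rfl | hh
        · exact h2 (hf.invol _ _).symm
        · exact h1 (hf.inj hh).symm
    · push Not at hh
      exact ⟨u, hu, hh.1, hh.2⟩
  exact ⟨v, w, hF, hw, fun e => hw1 (hne _ e.1), fun e => hw2 (hne _ e.1)⟩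

lemma RightTrivial.ne (hb : RightTrivial f s b) : f s b ≠ b := hb.split.ne

lemma RightTrivial.card_nonSplit [Finite V] (hf : IsStringGraph f (s + 1))
    (hb : RightTrivial f s b) {w : ℕ} (hc : Nat.card V = s + 2 + w) (M : Finset ℕ)
    (hM : ∀ m ∈ M, NonSplit f m) : M.card ≤ w := by
  have : Nonempty V := ⟨b⟩
  have h := hf.good_bound M fun m hm => by
    have hms : m < s + 1 := by
      obtain ⟨u, _, hu, _⟩ := hM m hm
      exact hu.lt hf.toIsStringAction
    have hne : m ≠ s := fun e => hb.split.not_nonSplit hf.toIsStringAction (e ▸ hM m hm)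
    exact ⟨hms, good_of_nonSplit hf.toIsStringAction hf.conn
      (fun k hk => hb.fixed k (by omega)) (hM m hm)⟩
  omega

end RightTrivial

section Cut

variable {V : Type*} {f : ℕ → V → V} {s i : ℕ} {a b : V}

/-- The component of `b` in the graph without the label `i`. -/
def comp (f : ℕ → V → V) (i : ℕ) (b : V) : Set V := {v | Link f {i}ᶜ b v}

/-- The pendant edge with the last label `s` ends in `b`, and the single fracture edge with label
`i < s` joins the vertex `a` to the component of `b`. -/
structure Cut (f : ℕ → V → V) (s i : ℕ) (a b : V) : Prop where
  graph : IsStringGraph f (s + 1)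
  right : RightTrivial f s b
  lt : i < s
  split : Split f i a
  link : Link f {i}ᶜ b (f i a)

namespace Cut

lemma act (h : Cut f s i a b) : IsStringAction f (s + 1) := h.graph.toIsStringAction

lemma ex_mem (h : Cut f s i a b) : f i a ∈ comp f i b := h.link

lemma b_mem (_ : Cut f s i a b) : b ∈ comp f i b := (Link.refl : Link f {i}ᶜ b b)

lemma mem_step (h : Cut f s i a b) {k : ℕ} {v : V} (hk : k ≠ i) :
    f k v ∈ comp f i b ↔ v ∈ comp f i b := by
  constructor
  · intro h'
    have : Link f {i}ᶜ (f k v) (f k (f k v)) := Link.step_ne hk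
    rw [h.act.invol] at this
    exact Link.trans h' this
  · exact fun h' => Link.trans h' (Link.step_ne hk)

lemma a_notMem (h : Cut f s i a b) : a ∉ comp f i b := fun h' =>
  h.split.1 ((h.act.symm h').trans h.link)

lemma notMem_iff (h : Cut f s i a b) {v : V} : v ∉ comp f i b ↔ Link f {i}ᶜ a v := by
  constructor
  · intro hv
    rcases h.split.cover h.graph v with h1 | h1
    · exact h1
    · exact absurd (h.link.trans h1) hv
  · exact fun hv hv' => h.a_notMem (Link.trans hv' (h.act.symm hv))

lemma mem_step_i (h : Cut f s i a b) {v : V} (h1 : v ≠ a) (h2 : v ≠ f i a) :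
    f i v ∈ comp f i b ↔ v ∈ comp f i b := by
  have hF : ¬ Fr f i v := fun hF => (h.split.2 v hF).elim h1 h2
  have hl := not_not.mp hF
  exact ⟨fun h' => Link.trans h' (h.act.symm hl), fun h' => Link.trans h' hl⟩

lemma fixed_lt (h : Cut f s i a b) {v : V} (hv : v ∈ comp f i b) {k : ℕ} (hk : k < i) :
    f k v = v :=
  (h.act.factor_fixed (fun k hk => h.right.fixed k (by have := h.lt; omega)) hv).2 k hk

/-- The component of `b` is generated by the labels greater than `i`. -/
lemma induction (h : Cut f s i a b) {P : V → Prop} (hb : P b)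
    (hP : ∀ p, P p → ∀ k, i < k → k ≤ s → P (f k p)) {v : V} (hv : v ∈ comp f i b) : P v := by
  have := (h.act.factor_fixed (fun k hk => h.right.fixed k (by have := h.lt; omega)) hv).1
  refine this.closed (fun p hp k (hk : i < k) => ?_) hb
  by_cases hks : k ≤ s
  · exact hP p hp k hk hks
  · rwa [h.act.triv k p (by omega)]

/-- The vertex of the component of `b` at the cut is incident to the labels `i` and `i + 1` only. -/
lemma x_fixed (h : Cut f s i a b) {k : ℕ} (h1 : k ≠ i) (h2 : k ≠ i + 1) :
    f k (f i a) = f i a := by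
  by_cases hk : k < i
  · exact h.fixed_lt h.ex_mem hk
  · exact (h.split.symm h.act).fixed h.act (by omega)

lemma a_fixed (h : Cut f s i a b) {k : ℕ} (h1 : i + 2 ≤ k) : f k a = a :=
  h.split.fixed h.act (Or.inr h1)

lemma x_ne_b (h : Cut f s i a b) : f i a ≠ b := fun e => by
  have := h.right.fixed i (by have := h.lt; omega)
  rw [← e, h.act.invol] at this
  exact h.split.ne this.symm

lemma y_mem (h : Cut f s i a b) : f s b ∈ comp f i b :=
  (h.mem_step (by have := h.lt; omega)).mpr h.b_mem

/-- The neighbour of `b` is incident to the labels `s - 1` and `s` only. -/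
lemma y_fixed (h : Cut f s i a b) {k : ℕ} (h1 : k ≠ s) (h2 : k + 1 ≠ s) :
    f k (f s b) = f s b := by
  by_cases hk : k < s
  · exact (h.right.split.symm h.act).fixed h.act (by omega)
  · exact h.act.triv _ _ (by omega)

lemma y_ne_x (h : Cut f s i a b) (hi : i + 1 < s) : f s b ≠ f i a := fun e => by
  have h1 := h.y_fixed (k := i) (by omega) (by omega)
  rw [e, h.act.invol] at h1
  exact h.split.ne h1.symm

lemma exists_fr_mem (h : Cut f s i a b) {k : ℕ} (h1 : i < k) (h2 : k ≤ s) :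
    ∃ v ∈ comp f i b, Fr f k v := by
  rcases h2.eq_or_lt with rfl | h2
  · exact ⟨b, h.b_mem, h.right.split.1⟩
  obtain ⟨u, hu⟩ := h.graph.fract k (by omega)
  obtain ⟨v, hv, hF⟩ := exists_fr h.graph.conn hu b
  exact ⟨v, ((h.act.factor_fixed (fun l hl => h.right.fixed l (by omega)) hv).1).gt_compl
    h1.le, hF⟩

lemma exists_fr_notMem (h : Cut f s i a b) {k : ℕ} (h1 : k < i) :
    ∃ v ∉ comp f i b, Fr f k v := by
  obtain ⟨v, hF⟩ := h.graph.fract k (by have := h.lt; omega)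
  exact ⟨v, fun hv => hF.ne (h.fixed_lt hv h1), hF⟩

/-- Labels above `i` with several fracture edges in the component of `b` increase its size. -/
lemma le_card_right [Finite V] (h : Cut f s i a b) {M : Finset ℕ}
    (hM : ∀ m ∈ M, i < m ∧ m < s ∧
      ∃ u ∈ comp f i b, ∃ v ∈ comp f i b, Fr f m u ∧ Fr f m v ∧ v ≠ u ∧ v ≠ f m u) :
    s - i + 1 + M.card ≤ (comp f i b).ncard := by
  have hlt := h.lt
  have hS : IsPort f (comp f i b) (s + 1) (f i a) i := by
    have hi : ∀ v ∈ comp f i b, ∀ k, f k v ∉ comp f i b → k = i := fun v hv k hk => by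
      by_contra hne
      exact hk ((h.mem_step hne).mpr hv)
    refine ⟨h.ex_mem, fun v hv k hk => ?_, fun k _ hk => hi _ h.ex_mem k hk,
      fun v _ k hk _ => h.act.triv k v hk⟩
    obtain rfl := hi v hv k hk
    by_contra hne
    refine hk ((h.mem_step_i ?_ hne).mpr hv)
    rintro rfl
    exact h.a_notMem hv
  have hact := isStringAction_sub h.act hS
  have : Nonempty (comp f i b) := ⟨⟨b, h.b_mem⟩⟩
  have hfr : ∀ k, i < k → k ≤ s → ∀ v (hv : v ∈ comp f i b), Fr f k v →
      Fr (sub (comp f i b) (s + 1) f) k ⟨v, hv⟩ := fun k h1 h2 v hv hF =>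
    (fr_sub h.act hS (by omega)).mpr ⟨(h.mem_step (by omega)).mpr hv, hF⟩
  have hg := good_bound hact (M := M) (N := Finset.Ioc i s)
    (fun m hm => Finset.mem_Ioc.mpr ⟨(hM m hm).1, (hM m hm).2.1.le⟩)
    (fun k hk => by
      obtain ⟨h1, h2⟩ := Finset.mem_Ioc.mp hk
      obtain ⟨v, hv, hF⟩ := h.exists_fr_mem h1 h2
      exact ⟨⟨v, hv⟩, hfr k h1 h2 v hv hF⟩)
    (fun m hm => by
      obtain ⟨h1, h2, u, hu, v, hv, hFu, hFv, hne, hne'⟩ := hM m hm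
      have e : (sub (comp f i b) (s + 1) f m ⟨u, hu⟩ : V) = f m u :=
        sub_of_mem (by omega) ((h.mem_step (by omega)).mpr hu)
      refine good_of_nonSplit (b := ⟨b, h.b_mem⟩) hact
        (fun p q => link_sub h.act hS (h.graph.conn p q)) (fun k hk => ?_)
        ⟨⟨u, hu⟩, ⟨v, hv⟩, hfr m h1 h2.le u hu hFu, hfr m h1 h2.le v hv hFv,
          fun e => hne (congrArg Subtype.val e), fun e' => hne' ?_⟩
      · have e := h.right.fixed k (by omega)
        apply Subtype.ext
        rw [sub_of_mem (by omega) (by rw [e]; exact h.b_mem), e]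
      · rw [← e, ← e'])
  rw [Nat.card_Ioc] at hg
  rw [← Nat.card_coe_set_eq]
  omega

lemma card_add_card [Finite V] (_ : Cut f s i a b) :
    (comp f i b).ncard + (comp f i b)ᶜ.ncard = Nat.card V := Set.ncard_add_ncard_compl _

end Cut

end Cut

/-! ### Small components at the end of the graph -/

section Small

variable {V : Type*} {f : ℕ → V → V} {s i m : ℕ} {a b : V}

/-- The set `S` contains two different fracture edges with label `m`. -/
def Twice (f : ℕ → V → V) (m : ℕ) (S : Set V) : Prop :=
  ∃ u ∈ S, ∃ v ∈ S, Fr f m u ∧ Fr f m v ∧ v ≠ u ∧ v ≠ f m u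

lemma not_twice {r : ℕ} (hf : IsStringAction f r) {S : Set V} (p : V)
    (h : ∀ u ∈ S, Fr f m u → u = p ∨ u = f m p) : ¬ Twice f m S := by
  rintro ⟨u, hu, v, hv, hFu, hFv, h1, h2⟩
  have := hf.invol m p
  rcases h u hu hFu with rfl | rfl <;> rcases h v hv hFv with rfl | rfl <;> simp_all

namespace Cut

/-- If `s = i + 1`, then the component of `b` consists of `b` and its neighbour. -/
lemma right_zero (h : Cut f (i + 1) i a b) :
    f (i + 1) b = f i a ∧ ∀ v ∈ comp f i b, v = b ∨ v = f i a := by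
  have key : ∀ v ∈ comp f i b, v = b ∨ v = f (i + 1) b := fun v hv => by
    refine h.induction (P := fun v => v = b ∨ v = f (i + 1) b) (Or.inl rfl) ?_ hv
    intro p hp k h1 h2
    obtain rfl : k = i + 1 := by omega
    rcases hp with rfl | rfl
    · exact Or.inr rfl
    · exact Or.inl (h.act.invol _ _)
  have := (key _ h.ex_mem).resolve_left h.x_ne_b
  exact ⟨this.symm, fun v hv => by rw [this]; exact key v hv⟩

/-- If `s = i + 2`, then a component of `b` with at most four vertices is a path with two edges. -/
lemma right_one [Finite V] (h : Cut f (i + 2) i a b) (hc : (comp f i b).ncard ≤ 4) :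
    f (i + 1) (f (i + 2) b) = f i a ∧
      ∀ v ∈ comp f i b, v = b ∨ v = f (i + 2) b ∨ v = f i a := by
  have hx := h.x_fixed (k := i + 2) (by omega) (by omega)
  have hxb := h.x_ne_b
  have hyx := h.y_ne_x (by omega)
  have hb := h.right.fixed (i + 1) (by omega)
  have hby := h.right.ne
  have hxm := h.ex_mem
  have hym := h.y_mem
  generalize f i a = x at *
  obtain ⟨y, hy⟩ : ∃ y, f (i + 2) b = y := ⟨_, rfl⟩
  obtain ⟨p, hp⟩ : ∃ p, f (i + 1) y = p := ⟨_, rfl⟩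
  obtain ⟨u, hu⟩ : ∃ u, f (i + 2) p = u := ⟨_, rfl⟩
  have i1 := h.act.invol (i + 2) b
  have i2 := h.act.invol (i + 1) y
  have i3 := h.act.invol (i + 2) p
  have i4 := h.act.invol (i + 1) b
  have hpy : p ≠ y := fun e => by
    have := h.induction (P := fun v => v = b ∨ v = y) (Or.inl rfl) (fun q hq k h1 h2 => by
      have hk : k = i + 1 ∨ k = i + 2 := by omega
      grind) hxm
    grind
  have hpb : p ≠ b := by grind
  have hpx : p = x := by
    by_contra hpx
    have hup : u ≠ p := fun e => by
      have := h.induction (P := fun v => v = b ∨ v = y ∨ v = p) (Or.inl rfl)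
        (fun q hq k h1 h2 => by
          have hk : k = i + 1 ∨ k = i + 2 := by omega
          grind) hxm
      grind
    have := length_le_ncard (S := comp f i b) (l := [b, y, p, u, x]) (by simp; grind) (by
      have hpm := (h.mem_step (k := i + 1) (by omega)).mpr hym
      have hum := (h.mem_step (k := i + 2) (by omega)).mpr hpm
      have := h.b_mem
      simp; grind)
    simp at this
    omega
  refine ⟨by rw [hy, hp, hpx], fun v hv => ?_⟩
  rw [hy]
  refine h.induction (P := fun v => v = b ∨ v = y ∨ v = x) (Or.inl rfl)
    (fun q hq k h1 h2 => by
      have hk : k = i + 1 ∨ k = i + 2 := by omega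
      grind) hv

/-- If `s = i + 2` and the label `i + 1` has two fracture edges in the component of `b`, then this
component is a path with labels `s, i + 1, s, i + 1`, the middle edge `s` being doubled by `i`. -/
lemma right_one' [Finite V] (h : Cut f (i + 2) i a b) (hc : (comp f i b).ncard ≤ 6)
    (ht : Twice f (i + 1) (comp f i b)) :
    ∃ p u, f (i + 1) (f (i + 2) b) = p ∧ f (i + 2) p = u ∧ f i p = u ∧ f (i + 1) u = f i a ∧
      [b, f (i + 2) b, p, u, f i a].Nodup ∧
      ∀ v ∈ comp f i b, v = b ∨ v = f (i + 2) b ∨ v = p ∨ v = u ∨ v = f i a := by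
  have hx := h.x_fixed (k := i + 2) (by omega) (by omega)
  have hxb := h.x_ne_b
  have hyx := h.y_ne_x (by omega)
  have hb := h.right.fixed (i + 1) (by omega)
  have hbi := h.right.fixed i (by omega)
  have hby := h.right.ne
  have hxm := h.ex_mem
  have hym := h.y_mem
  have hbm := h.b_mem
  have hyi := h.y_fixed (k := i) (by omega) (by omega)
  have hx' := h.act.invol i a
  have ham := h.a_notMem
  have hsp := (h.right.split).2
  have hmi := fun v => h.mem_step_i (v := v)
  generalize f i a = x at *
  obtain ⟨y, hy⟩ : ∃ y, f (i + 2) b = y := ⟨_, rfl⟩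
  obtain ⟨p, hp⟩ : ∃ p, f (i + 1) y = p := ⟨_, rfl⟩
  obtain ⟨u, hu⟩ : ∃ u, f (i + 2) p = u := ⟨_, rfl⟩
  obtain ⟨t, ht'⟩ : ∃ t, f (i + 1) u = t := ⟨_, rfl⟩
  obtain ⟨t2, ht2⟩ : ∃ t2, f (i + 2) t = t2 := ⟨_, rfl⟩
  have i1 := h.act.invol (i + 2) b
  have i2 := h.act.invol (i + 1) y
  have i3 := h.act.invol (i + 2) p
  have i4 := h.act.invol (i + 1) u
  have i5 := h.act.invol (i + 2) t
  have hpm := (h.mem_step (k := i + 1) (by omega)).mpr hym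
  have hum := (h.mem_step (k := i + 2) (by omega)).mpr hpm
  have htm := (h.mem_step (k := i + 1) (by omega)).mpr hum
  have htm2 := (h.mem_step (k := i + 2) (by omega)).mpr htm
  have hpy : p ≠ y := fun e => by
    have := h.induction (P := fun v => v = b ∨ v = y) (Or.inl rfl) (fun q hq k h1 h2 => by
      have hk : k = i + 1 ∨ k = i + 2 := by omega
      grind) hxm
    grind
  have hpb : p ≠ b := by grind
  have hpx : p ≠ x := fun e => by
    refine not_twice h.act y (fun v hv hF => ?_) ht
    have := h.induction (P := fun v => v = b ∨ v = y ∨ v = p) (Or.inl rfl)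
      (fun q hq k h1 h2 => by
        have hk : k = i + 1 ∨ k = i + 2 := by omega
        grind) hv
    have := hF.ne
    grind
  have hup : u ≠ p := fun e => by
    have := h.induction (P := fun v => v = b ∨ v = y ∨ v = p) (Or.inl rfl)
      (fun q hq k h1 h2 => by
        have hk : k = i + 1 ∨ k = i + 2 := by omega
        grind) hxm
    grind
  have htu : t ≠ u := fun e => by
    have := h.induction (P := fun v => v = b ∨ v = y ∨ v = p ∨ v = u) (Or.inl rfl)
      (fun q hq k h1 h2 => by
        have hk : k = i + 1 ∨ k = i + 2 := by omega
        grind) hxm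
    grind
  have htx : t = x := by
    by_contra htx
    have htt : t2 ≠ t := fun e => by
      have := h.induction (P := fun v => v = b ∨ v = y ∨ v = p ∨ v = u ∨ v = t) (Or.inl rfl)
        (fun q hq k h1 h2 => by
          have hk : k = i + 1 ∨ k = i + 2 := by omega
          grind) hxm
      grind
    have := length_le_ncard (S := comp f i b) (l := [b, y, p, u, t, t2, x]) (by simp; grind (splits := 30))
      (by simp; grind)
    simp at this
    omega
  have hall : ∀ v ∈ comp f i b, v = b ∨ v = y ∨ v = p ∨ v = u ∨ v = x := fun v hv =>
    h.induction (P := fun v => v = b ∨ v = y ∨ v = p ∨ v = u ∨ v = x) (Or.inl rfl)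
      (fun q hq k h1 h2 => by
        have hk : k = i + 1 ∨ k = i + 2 := by omega
        grind) hv
  -- the second edge with the last label is not a fracture edge, so it must be doubled
  have hpi : f i p = u := by
    have h1 : f i p ∈ comp f i b := (hmi p (by grind) hpx).mpr (by grind)
    have h2 : f i u ∈ comp f i b := (hmi u (by grind) (by grind)).mpr (by grind)
    have i6 := h.act.invol i p
    have i7 := h.act.invol i u
    by_contra hne
    have h3 : f i p = p := by grind
    have h4 : f i u = u := by grind
    have hF : Fr f (i + 2) p := fun hl => by
      have := hl.closed (P := fun v => v = y ∨ v = p) (fun q hq k (hk : k ≠ i + 2) => by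
        have h5 := h.fixed_lt (v := q) (k := k) (by grind)
        have h6 := h.act.triv k q
        have hk : k < i ∨ k = i ∨ k = i + 1 ∨ i + 2 + 1 ≤ k := by omega
        grind) (Or.inr rfl)
      grind
    grind
  exact ⟨p, u, by rw [hy, hp], hu, hpi, by rw [ht', htx], by simp; grind, fun v hv => by
    have := hall v hv
    grind⟩

/-- If `s = i + 3`, then the component of `b` is a path with three edges or contains two more
vertices. -/
lemma right_two (h : Cut f (i + 3) i a b) :
    (f (i + 2) (f (i + 3) b) = f (i + 1) (f i a) ∧
      ∀ v ∈ comp f i b, v = b ∨ v = f (i + 3) b ∨ v = f (i + 1) (f i a) ∨ v = f i a) ∨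
    [b, f (i + 3) b, f (i + 2) (f (i + 3) b), f (i + 2) (f (i + 1) (f i a)), f (i + 1) (f i a),
      f i a].Nodup := by
  have hx := h.x_fixed (k := i + 2) (by omega) (by omega)
  have hx3 := h.x_fixed (k := i + 3) (by omega) (by omega)
  have hxb := h.x_ne_b
  have hyx := h.y_ne_x (by omega)
  have hb := h.right.fixed (i + 1) (by omega)
  have hb2 := h.right.fixed (i + 2) (by omega)
  have hby := h.right.ne
  have hxm := h.ex_mem
  have hym := h.y_mem
  have hy1 := h.y_fixed (k := i + 1) (by omega) (by omega)
  generalize f i a = x at *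
  obtain ⟨y, hy⟩ : ∃ y, f (i + 3) b = y := ⟨_, rfl⟩
  obtain ⟨p, hp⟩ : ∃ p, f (i + 2) y = p := ⟨_, rfl⟩
  obtain ⟨q, hq⟩ : ∃ q, f (i + 1) x = q := ⟨_, rfl⟩
  obtain ⟨u, hu⟩ : ∃ u, f (i + 2) q = u := ⟨_, rfl⟩
  have i1 := h.act.invol (i + 3) b
  have i2 := h.act.invol (i + 2) y
  have i3 := h.act.invol (i + 1) x
  have i4 := h.act.invol (i + 2) q
  have hq3 : f (i + 3) q = q := by rw [← hq, ← h.act.comm _ _ _ le_rfl, hx3]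
  have hpy : p ≠ y := fun e => by
    have := h.induction (P := fun v => v = b ∨ v = y) (Or.inl rfl) (fun q hq k h1 h2 => by
      have hk : k = i + 1 ∨ k = i + 2 ∨ k = i + 3 := by omega
      grind) hxm
    grind
  rw [hy, hp, hq, hu]
  by_cases hpq : p = q
  · refine Or.inl ⟨hpq, fun v hv => ?_⟩
    refine h.induction (P := fun v => v = b ∨ v = y ∨ v = q ∨ v = x) (Or.inl rfl)
      (fun q hq k h1 h2 => by
        have hk : k = i + 1 ∨ k = i + 2 ∨ k = i + 3 := by omega
        grind) hv
  · have hqx : q ≠ x := fun e => by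
      have := h.induction (P := fun v => v ≠ x) hxb.symm (fun q hq k h1 h2 => by
        have := h.act.invol k q
        have hk : k = i + 1 ∨ k = i + 2 ∨ k = i + 3 := by omega
        grind) hxm
      grind
    have huq : u ≠ q := fun e => by
      have := h.induction (P := fun v => v ≠ x ∧ v ≠ q) (by grind) (fun q hq k h1 h2 => by
        have := h.act.invol k q
        have hk : k = i + 1 ∨ k = i + 2 ∨ k = i + 3 := by omega
        grind) hxm
      grind
    right
    simp
    grind (splits := 30)

lemma right_two_of_le_four [Finite V] (h : Cut f (i + 3) i a b) (hc : (comp f i b).ncard ≤ 4) :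
    f (i + 2) (f (i + 3) b) = f (i + 1) (f i a) ∧
      ∀ v ∈ comp f i b, v = b ∨ v = f (i + 3) b ∨ v = f (i + 1) (f i a) ∨ v = f i a := by
  refine h.right_two.resolve_right fun hl => ?_
  have := length_le_ncard (S := comp f i b) hl (by
    simp [h.mem_step, h.b_mem, h.ex_mem])
  simp at this
  omega

lemma right_two_not_twice [Finite V] (h : Cut f (i + 3) i a b) (hc : (comp f i b).ncard ≤ 5) :
    ¬ Twice f (i + 2) (comp f i b) := by
  rcases h.right_two with hl | hl
  · refine not_twice h.act (f (i + 3) b) fun u hu hF => ?_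
    have h1 := h.x_fixed (k := i + 2) (by omega) (by omega)
    have h2 := h.right.fixed (i + 2) (by omega)
    have := hF.ne
    grind
  · have := length_le_ncard (S := comp f i b) hl (by
      simp [h.mem_step, h.b_mem, h.ex_mem])
    simp at this
    omega

set_option maxHeartbeats 1000000 in
/-- If `s = i + 3` and the labels `i + 1` and `i + 2` have two fracture edges in the component of
`b`, then this component is a path with labels `s, i + 2, i + 1, i + 2, i + 1`. -/
lemma right_two' [Finite V] (h : Cut f (i + 3) i a b) (hc : (comp f i b).ncard ≤ 7)
    (ht : Twice f (i + 2) (comp f i b)) (ht' : Twice f (i + 1) (comp f i b)) :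
    ∃ p u q, f (i + 2) (f (i + 3) b) = p ∧ f (i + 1) p = u ∧ f (i + 2) u = q ∧
      f (i + 1) q = f i a ∧ (∀ v ∈ [p, u, q], f i v = v ∧ f (i + 3) v = v) ∧
      [b, f (i + 3) b, p, u, q, f i a].Nodup ∧
      ∀ v ∈ comp f i b, v = b ∨ v = f (i + 3) b ∨ v = p ∨ v = u ∨ v = q ∨ v = f i a := by
  rcases h.right_two with ⟨e, hl⟩ | hl
  · refine absurd ht (not_twice h.act (f (i + 3) b) fun u hu hF => ?_)
    have h1 := h.x_fixed (k := i + 2) (by omega) (by omega)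
    have h2 := h.right.fixed (i + 2) (by omega)
    have := hF.ne
    grind
  have hx := h.x_fixed (k := i + 2) (by omega) (by omega)
  have hx3 := h.x_fixed (k := i + 3) (by omega) (by omega)
  have hb := h.right.fixed (i + 1) (by omega)
  have hb2 := h.right.fixed (i + 2) (by omega)
  have hbi := h.right.fixed i (by omega)
  have hxm := h.ex_mem
  have hym := h.y_mem
  have hbm := h.b_mem
  have hy1 := h.y_fixed (k := i + 1) (by omega) (by omega)
  have hyi := h.y_fixed (k := i) (by omega) (by omega)
  have hxi := h.act.invol i a
  have ham := h.a_notMem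
  have hmi := fun v => h.mem_step_i (v := v)
  generalize f i a = x at *
  obtain ⟨y, hy⟩ : ∃ y, f (i + 3) b = y := ⟨_, rfl⟩
  obtain ⟨p, hp⟩ : ∃ p, f (i + 2) y = p := ⟨_, rfl⟩
  obtain ⟨q, hq⟩ : ∃ q, f (i + 1) x = q := ⟨_, rfl⟩
  obtain ⟨u, hu⟩ : ∃ u, f (i + 2) q = u := ⟨_, rfl⟩
  have i1 := h.act.invol (i + 3) b
  have i2 := h.act.invol (i + 2) y
  have i3 := h.act.invol (i + 1) x
  have i4 := h.act.invol (i + 2) q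
  have hq3 : f (i + 3) q = q := by rw [← hq, ← h.act.comm _ _ _ le_rfl, hx3]
  have hpi : f i p = p := by rw [← hp, h.act.comm _ _ _ le_rfl, ← hy, hyi]
  have c13 : ∀ v, f (i + 1) (f (i + 3) v) = f (i + 3) (f (i + 1) v) :=
    fun v => h.act.comm _ _ _ le_rfl
  rw [hy, hp, hq, hu] at hl
  have hpm : p ∈ comp f i b := by rw [← hp, h.mem_step (by omega)]; rwa [hy] at hym
  have hqm : q ∈ comp f i b := by rw [← hq, h.mem_step (by omega)]; exact hxm
  have hum : u ∈ comp f i b := by rw [← hu, h.mem_step (by omega)]; exact hqm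
  have m1 : ∀ v, v ∈ comp f i b → f (i + 1) v ∈ comp f i b :=
    fun v hv => (h.mem_step (by omega)).mpr hv
  have m3 : ∀ v, v ∈ comp f i b → f (i + 3) v ∈ comp f i b :=
    fun v hv => (h.mem_step (by omega)).mpr hv
  have hsmall : ∀ z ∈ comp f i b, ∀ z' ∈ comp f i b, z ∈ [b, y, p, u, q, x] ∨
      z' ∈ [b, y, p, u, q, x] ∨ z = z' := by
    intro z hz z' hz'
    by_contra hne
    push Not at hne
    obtain ⟨h1, h2, hne⟩ := hne
    have := length_le_ncard (S := comp f i b) (l := z :: z' :: [b, y, p, u, q, x])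
      (List.nodup_cons.mpr ⟨by simpa [hne] using h1, List.nodup_cons.mpr ⟨h2, hl⟩⟩)
      (by simp; grind)
    simp at this
    omega
  have hl' := hl
  simp only [List.mem_cons, List.not_mem_nil, or_false] at hsmall
  simp only [List.nodup_cons, List.mem_cons, List.not_mem_nil, or_false, not_or] at hl
  have j1 := h.act.invol (i + 1) p
  have j2 := h.act.invol (i + 1) u
  have j3 := h.act.invol (i + 3) p
  have j4 := h.act.invol (i + 3) u
  have hpp : f (i + 1) p ≠ p := fun e => by
    have hz : f (i + 3) p ≠ p := fun e' => by
      have := h.induction (P := fun v => v = b ∨ v = y ∨ v = p) (Or.inl rfl)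
        (fun q hq k h1 h2 => by
          have hk : k = i + 1 ∨ k = i + 2 ∨ k = i + 3 := by omega
          grind) hxm
      grind
    have hz1 := c13 p
    have hzm := m3 p hpm
    have hu1 : f (i + 1) u = u := by
      have := hsmall (f (i + 3) p) hzm (f (i + 1) u) (m1 u hum)
      grind (splits := 40)
    refine not_twice h.act x (fun v hv hF => ?_) ht'
    have := hF.ne
    have := hsmall v hv _ (m1 v hv)
    have := h.act.invol (i + 1) v
    grind
  have hpu : f (i + 1) p = u := by
    by_contra hne
    have hu1 : f (i + 1) u = u := by
      have := hsmall _ (m1 p hpm) _ (m1 u hum)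
      grind
    have hu3 : f (i + 3) u = u := by
      have := hsmall _ (m1 p hpm) _ (m3 u hum)
      have := c13 u
      grind
    have := h.induction (P := fun v => v ≠ x ∧ v ≠ q ∧ v ≠ u) (by grind) (fun v hv k h1 h2 => by
      have := h.act.invol k v
      have hk : k = i + 1 ∨ k = i + 2 ∨ k = i + 3 := by omega
      grind) hxm
    grind
  have hp3 : f (i + 3) p = p := by
    by_contra hne
    have hpu3 : f (i + 3) p = u := by
      have := hsmall _ (m3 p hpm) _ (m3 u hum)
      have := c13 p
      grind (splits := 40)
    have hall : ∀ v ∈ comp f i b, v = b ∨ v = y ∨ v = p ∨ v = u ∨ v = q ∨ v = x := fun v hv =>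
      h.induction (P := fun v => v = b ∨ v = y ∨ v = p ∨ v = u ∨ v = q ∨ v = x) (Or.inl rfl)
        (fun q hq k h1 h2 => by
          have hk : k = i + 1 ∨ k = i + 2 ∨ k = i + 3 := by omega
          grind) hv
    refine not_twice h.act x (fun v hv hF => ?_) ht'
    have := hF.ne
    have := hF.ne_label (j := i + 3) (by omega)
    have := hall v hv
    grind
  have hu3 : f (i + 3) u = u := by
    rw [← hpu, ← c13, hp3]
  have hall : ∀ v ∈ comp f i b, v = b ∨ v = y ∨ v = p ∨ v = u ∨ v = q ∨ v = x := fun v hv =>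
    h.induction (P := fun v => v = b ∨ v = y ∨ v = p ∨ v = u ∨ v = q ∨ v = x) (Or.inl rfl)
      (fun q hq k h1 h2 => by
        have hk : k = i + 1 ∨ k = i + 2 ∨ k = i + 3 := by omega
        grind) hv
  have hqi : f i q = q := by
    by_contra hne
    have hqi : f i q = u := by
      have := hall _ ((hmi q (by grind) (by grind)).mpr hqm)
      have := h.act.invol i q
      grind
    refine not_twice h.act y (fun v hv hF => ?_) ht
    have := hF.ne
    have hl := hF.ne_label (j := i) (by omega)
    have := h.act.invol i q
    clear hsmall m1 m3 c13 hmi ht ht'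
    rcases hall v hv with h | h | h | h | h | h <;> grind
  have hui : f i u = u := by rw [← hu, h.act.comm _ _ _ le_rfl, hqi]
  refine ⟨p, u, q, by rw [hy, hp], hpu, by rw [← hu, h.act.invol], by rw [← hq, h.act.invol],
    by simp [*], by rwa [hy], fun v hv => by rw [hy]; exact hall v hv⟩

end Cut

end Small

section Small

variable {V : Type*} {f : ℕ → V → V} {s i m : ℕ} {a b : V}

namespace Cut

/-- If `s = i + 4`, then the labels `i + 1` and `i + 3` cannot both have two fracture edges in a
component of at most eight vertices: outside of the edges at its two ends only three vertices are
left, on which two commuting involutions have to act. -/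
lemma right_three [Finite V] (h : Cut f (i + 4) i a b) (hc : (comp f i b).ncard ≤ 8)
    (ht1 : Twice f (i + 1) (comp f i b)) (ht3 : Twice f (i + 3) (comp f i b)) : False := by
  have hx2 := h.x_fixed (k := i + 2) (by omega) (by omega)
  have hx3 := h.x_fixed (k := i + 3) (by omega) (by omega)
  have hx4 := h.x_fixed (k := i + 4) (by omega) (by omega)
  have hxb := h.x_ne_b
  have hyx := h.y_ne_x (by omega)
  have hb1 := h.right.fixed (i + 1) (by omega)
  have hb2 := h.right.fixed (i + 2) (by omega)
  have hb3 := h.right.fixed (i + 3) (by omega)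
  have hby := h.right.ne
  have hxm := h.ex_mem
  have hym := h.y_mem
  have hbm := h.b_mem
  have hy1 := h.y_fixed (k := i + 1) (by omega) (by omega)
  have hy2 := h.y_fixed (k := i + 2) (by omega) (by omega)
  generalize f i a = x at *
  generalize hy : f (i + 4) b = y at *
  obtain ⟨p, hp⟩ : ∃ p, f (i + 3) y = p := ⟨_, rfl⟩
  obtain ⟨q, hq⟩ : ∃ q, f (i + 1) x = q := ⟨_, rfl⟩
  have inv : ∀ k v, f k (f k v) = v := h.act.invol
  have c13 : ∀ v, f (i + 1) (f (i + 3) v) = f (i + 3) (f (i + 1) v) :=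
    fun v => h.act.comm _ _ _ le_rfl
  have hq3 : f (i + 3) q = q := by rw [← hq, ← c13, hx3]
  have hp1 : f (i + 1) p = p := by rw [← hp, c13, hy1]
  have hR : ∀ k, k ≠ i → ∀ v, v ∈ comp f i b → f k v ∈ comp f i b :=
    fun k hk v hv => (h.mem_step hk).mpr hv
  have i0 := inv (i + 4) b
  have i1 := inv (i + 3) y
  have i2 := inv (i + 1) x
  rw [hy] at i0
  rw [hp] at i1
  rw [hq] at i2
  have hpm : p ∈ comp f i b := by rw [← hp]; exact hR _ (by omega) _ hym
  have hqm : q ∈ comp f i b := by rw [← hq]; exact hR _ (by omega) _ hxm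
  have hpy : p ≠ y := fun e => by
    have := h.induction (P := fun v => v = b ∨ v = y) (Or.inl rfl) (fun q hq k h1 h2 => by
      have hk : k = i + 1 ∨ k = i + 2 ∨ k = i + 3 ∨ k = i + 4 := by omega
      grind) hxm
    grind
  have hqx : q ≠ x := fun e => by
    have := h.induction (P := fun v => v ≠ x) (by grind) (fun q hq k h1 h2 => by
      have := inv k q
      have hk : k = i + 1 ∨ k = i + 2 ∨ k = i + 3 ∨ k = i + 4 := by omega
      grind) hxm
    grind
  have hl : [b, y, p, q, x].Nodup := by simp; grind (splits := 30)
  let D : V → Prop := fun v => v ∈ comp f i b ∧ v ∉ [b, y, p, q, x]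
  have hD : ∀ z1 z2 z3 z4, D z1 → D z2 → D z3 → D z4 → ¬ [z1, z2, z3, z4].Nodup := by
    intro z1 z2 z3 z4 h1 h2 h3 h4 hz
    have := length_le_ncard (S := comp f i b) (l := [z1, z2, z3, z4] ++ [b, y, p, q, x])
      (List.nodup_append.mpr ⟨hz, hl, fun z hz z' hz' e => by
        simp only [List.mem_cons, List.not_mem_nil, or_false] at hz
        subst e
        rcases hz with rfl | rfl | rfl | rfl
        exacts [h1.2 hz', h2.2 hz', h3.2 hz', h4.2 hz']⟩)
      (by simp [h1.1, h2.1, h3.1, h4.1, *])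
    simp at this
    omega
  have hD1 : ∀ v, D v → D (f (i + 1) v) := fun v hv => by
    refine ⟨hR _ (by omega) _ hv.1, ?_⟩
    have := hv.2
    have := inv (i + 1) v
    simp only [List.mem_cons, List.not_mem_nil, or_false, not_or] at *
    grind
  have hD3 : ∀ v, D v → D (f (i + 3) v) := fun v hv => by
    refine ⟨hR _ (by omega) _ hv.1, ?_⟩
    have := hv.2
    have := inv (i + 3) v
    simp only [List.mem_cons, List.not_mem_nil, or_false, not_or] at *
    grind
  obtain ⟨v, hv, hF⟩ : ∃ v, D v ∧ Fr f (i + 1) v := by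
    by_contra hno
    refine not_twice h.act x (fun u hu hF => ?_) ht1
    by_contra hne
    refine hno ⟨u, ⟨hu, ?_⟩, hF⟩
    have := hF.ne
    simp only [List.mem_cons, List.not_mem_nil, or_false]
    grind
  obtain ⟨v', hv', hF'⟩ : ∃ v, D v ∧ Fr f (i + 3) v := by
    by_contra hno
    refine not_twice h.act y (fun u hu hF => ?_) ht3
    by_contra hne
    refine hno ⟨u, ⟨hu, ?_⟩, hF⟩
    have := hF.ne
    simp only [List.mem_cons, List.not_mem_nil, or_false]
    grind
  have n1 := hF.ne
  have n2 := hF.ne_label (j := i + 3) (by omega)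
  have n3 := hF'.ne
  have d1 := hD _ _ _ _ hv (hD1 _ hv) hv' (hD3 _ hv')
  have d2 := hD _ _ _ _ hv (hD1 _ hv) (hD3 _ hv) (hD3 _ (hD1 _ hv))
  have e1 := c13 v
  have e2 := inv (i + 3) v
  have e3 := inv (i + 3) v'
  have e4 := inv (i + 1) v
  have e5 := inv (i + 3) (f (i + 1) v)
  have e6 := inv (i + 1) (f (i + 3) v)
  clear hD1 hD3 hD hl
  clear_value D
  simp only [List.nodup_cons, List.mem_cons, List.not_mem_nil, or_false, not_or, not_false_eq_true,
    List.nodup_nil, and_true] at d1 d2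
  clear inv c13 hR
  by_cases hfix : f (i + 3) v = v
  · clear d2
    grind (splits := 40)
  · clear d1
    grind (splits := 40)

end Cut

end Small

/-! ### Small components at the start of the graph -/

section Left

variable {V : Type*} {f : ℕ → V → V} {s i m : ℕ} {a b : V}

lemma fr_of_leaf {z : V} (hz : ∀ k, k ≠ m → f k z = z) (hm : f m z ≠ z) : Fr f m z := fun h =>
  hm (h.closed (P := fun v => v = z) (fun v hv k hk => by rw [hv]; exact hz k hk) rfl)

/-- The single fracture edge with label `i` starts in `a`, and all smaller labels have a fracture edge
in the component of `a` without the label `i`. -/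
structure Side (f : ℕ → V → V) (r i : ℕ) (a : V) : Prop where
  graph : IsStringGraph f r
  lt : i < r
  split : Split f i a
  low : ∀ k < i, ∃ v, Link f {i}ᶜ a v ∧ Fr f k v

namespace Side

variable {r : ℕ}

lemma act (h : Side f r i a) : IsStringAction f r := h.graph.toIsStringAction

/-- If a label greater than `i` acts on the component of `a`, then `i + 1` moves `a`. -/
lemma move (h : Side f r i a) {v : V} (hv : Link f {i}ᶜ a v) {k : ℕ} (hk : i < k)
    (hkv : f k v ≠ v) : f (i + 1) a ≠ a := fun e => by
  have hfix : ∀ l, i < l → f l a = a := fun l hl => by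
    rcases (show l = i + 1 ∨ i + 2 ≤ l by omega) with rfl | hl
    · exact e
    · exact h.split.fixed h.act (Or.inr hl)
  obtain ⟨p, h1, h2⟩ := h.act.factor' hv
  have hp : p = a := h1.closed (P := fun v => v = a)
    (fun q hq l hl => by rw [hq]; exact hfix l hl) rfl
  subst hp
  exact hkv (h.act.fixed_of_link (fun l (hl : l < i) => by omega) h2 (hfix k hk))

lemma exists_separated (h : Side f r i a) : ∃ T : Finset V, ↑T ⊆ {v | Link f {i}ᶜ a v} ∧
    i + 1 ≤ T.card ∧
    ∀ p ∈ T, ∀ q ∈ T, p ≠ q → ∃ m ∈ Finset.range i, ¬ Link f {m}ᶜ p q := by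
  obtain ⟨T, h1, h2, h3⟩ := _root_.exists_separated h.act (O := {v | Link f {i}ᶜ a v})
    ⟨a, Link.refl⟩ (Finset.range i) fun m hm => by
      have hm := Finset.mem_range.mp hm
      obtain ⟨v, hv, hF⟩ := h.low m hm
      exact ⟨v, hv, hv.trans (Link.step_ne (by omega)), hF⟩
  rw [Finset.card_range] at h2
  exact ⟨T, h1, h2, h3⟩

lemma le_card [Finite V] (h : Side f r i a) : i + 1 ≤ {v | Link f {i}ᶜ a v}.ncard := by
  obtain ⟨T, h1, h2, -⟩ := h.exists_separated
  have h3 := Set.ncard_le_ncard h1 (Set.toFinite _)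
  rw [Set.ncard_coe_finset] at h3
  omega

/-- If a label greater than `i` acts on the component of `a`, then every vertex of this component has
a partner from which the labels below `i` do not separate it. -/
lemma bound [Finite V] (h : Side f r i a) {v : V} (hv : Link f {i}ᶜ a v) {k : ℕ} (hk : i < k)
    (hkv : f k v ≠ v) : 2 * (i + 1) ≤ {v | Link f {i}ᶜ a v}.ncard := by
  have hmove := h.move hv hk hkv
  obtain ⟨T, h1, h2, h3⟩ := h.exists_separated
  have hpart : ∀ v, Link f {i}ᶜ a v → ∃ q, Link f {i}ᶜ a q ∧ q ≠ v ∧ Link f (Set.Ioi i) v q := by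
    intro v hv
    refine hv.closed
      (P := fun v => ∃ q, Link f {i}ᶜ a q ∧ q ≠ v ∧ Link f (Set.Ioi i) v q) ?_ ?_
    · rintro p ⟨q, hq, hne, hl⟩ l (hl' : l ≠ i)
      refine ⟨f l q, hq.trans (Link.step_ne hl'), fun e => hne (h.act.inj e), ?_⟩
      rcases lt_or_gt_of_ne hl' with hl' | hl'
      · exact h.act.link_map (fun m (hm : i < m) => by omega) hl
      · have hl'' : l ∈ Set.Ioi i := hl'
        exact (h.act.symm (Link.step hl'')).trans (hl.trans (Link.step hl''))
    · exact ⟨f (i + 1) a, Link.step_ne (by omega), hmove, Link.step (Nat.lt_succ_self i)⟩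
  have := two_mul_card_le h.act h1 h3 fun p hp => by
    obtain ⟨q, hq, hne, hl⟩ := hpart p hp
    exact ⟨q, hq, hne, fun m hm => hl.gt_compl (Finset.mem_range.mp hm).le⟩
  omega

end Side

namespace Cut

lemma left_induction (h : Cut f s i a b) {P : V → Prop} (ha : P a)
    (hP : ∀ p, P p → ∀ k, k ≠ i → P (f k p)) {v : V} (hv : v ∉ comp f i b) : P v :=
  (h.notMem_iff.mp hv).closed (fun p hp k hk => hP p hp k hk) ha

lemma side (h : Cut f s i a b) : Side f (s + 1) i a where
  graph := h.graph
  lt := by have := h.lt; omega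
  split := h.split
  low k hk := by
    obtain ⟨v, hv, hF⟩ := h.exists_fr_notMem hk
    exact ⟨v, h.notMem_iff.mp hv, hF⟩

lemma compl_comp (h : Cut f s i a b) : (comp f i b)ᶜ = {v | Link f {i}ᶜ a v} :=
  Set.ext fun _ => h.notMem_iff

/-- If the single fracture edge with label `0` starts in `a` and the label `1` moves `a`, then a small
component of `a` is the path `1, {0, 2}` or the path `1, 2, {1, 3}`. -/
lemma left_zero [Finite V] (h : Cut f s 0 a b) (hc : (comp f 0 b)ᶜ.ncard ≤ 4)
    (hmove : f 1 a ≠ a)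
    (hleaf : ∀ z ∉ comp f 0 b, ∀ m, m ≠ 0 → (∀ k, k ≠ m → f k z = z) → f m z = z) :
    (∃ c d, f 1 a = c ∧ f 2 c = d ∧ f 0 c = d ∧ f 1 d = d ∧
      (∀ k, 3 ≤ k → f k c = c ∧ f k d = d) ∧ [a, c, d].Nodup ∧
      ∀ v ∉ comp f 0 b, v = a ∨ v = c ∨ v = d) ∨
    (∃ c d e, f 1 a = c ∧ f 2 c = d ∧ f 1 d = e ∧ f 3 d = e ∧ f 2 e = e ∧ f 3 c = c ∧
      (∀ v ∈ [c, d, e], f 0 v = v ∧ ∀ k, 4 ≤ k → f k v = v) ∧ [a, c, d, e].Nodup ∧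
      ∀ v ∉ comp f 0 b, v = a ∨ v = c ∨ v = d ∨ v = e) := by
  have inv : ∀ k v, f k (f k v) = v := h.act.invol
  have hL : ∀ k, k ≠ 0 → ∀ v, v ∉ comp f 0 b → f k v ∉ comp f 0 b :=
    fun k hk v hv h' => hv ((h.mem_step hk).mp h')
  have hL0 : ∀ v, v ∉ comp f 0 b → v ≠ a → f 0 v ∉ comp f 0 b := fun v hv hva h' =>
    hv ((h.mem_step_i hva (fun e => hv (e ▸ h.ex_mem))).mp h')
  have ha := h.a_notMem
  have hx := h.ex_mem
  have hxi := inv 0 a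
  have hafix : ∀ k, 2 ≤ k → f k a = a := fun k hk => h.a_fixed (by omega)
  obtain ⟨c, hc'⟩ : ∃ c, f 1 a = c := ⟨_, rfl⟩
  obtain ⟨d, hd⟩ : ∃ d, f 2 c = d := ⟨_, rfl⟩
  have hcfix : ∀ k, 3 ≤ k → f k c = c := fun k hk => by
    rw [← hc', ← h.act.comm 1 k _ (by omega), hafix k (by omega)]
  have hdfix : ∀ k, 4 ≤ k → f k d = d := fun k hk => by
    rw [← hd, ← h.act.comm 2 k _ (by omega), hcfix k (by omega)]
  have i1 := inv 1 a
  have i2 := inv 2 c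
  have hcL : c ∉ comp f 0 b := hc' ▸ hL 1 (by omega) a ha
  have hdL : d ∉ comp f 0 b := hd ▸ hL 2 (by omega) c hcL
  have inv0 := inv 0
  have ha2 := hafix 2 le_rfl
  have hc3 := hcfix 3 le_rfl
  have hdc : d ≠ c := fun e => by
    have hall : ∀ v ∉ comp f 0 b, v = a ∨ v = c := fun v hv =>
      h.left_induction (P := fun v => v = a ∨ v = c) (Or.inl rfl) (fun q hq k hk => by
        have h1 := hafix k
        have h2 := hcfix k
        have : k = 1 ∨ k = 2 ∨ 3 ≤ k := by omega
        grind) hv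
    have := hleaf c hcL 1 (by omega) (fun k hk => by
      have h2 := hcfix k
      have h3 := hall _ (hL0 c hcL (by grind))
      have h4 := inv 0 c
      have : k = 0 ∨ k = 2 ∨ 3 ≤ k := by omega
      grind)
    grind
  have hda : d ≠ a := by grind
  by_cases h4 : f 1 d = d ∧ f 3 d = d
  · left
    have hall : ∀ v ∉ comp f 0 b, v = a ∨ v = c ∨ v = d := fun v hv =>
      h.left_induction (P := fun v => v = a ∨ v = c ∨ v = d) (Or.inl rfl) (fun q hq k hk => by
        have h1 := hafix k
        have h2 := hcfix k
        have h3 := hdfix k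
        have : k = 1 ∨ k = 2 ∨ k = 3 ∨ 4 ≤ k := by omega
        grind) hv
    refine ⟨c, d, hc', hd, ?_, h4.1, fun k hk => ?_, by simp; grind, hall⟩
    · by_contra hne
      have h3 := hall _ (hL0 d hdL (by grind))
      have h4 := inv 0 d
      have := hleaf d hdL 2 (by omega) (fun k hk => by
        have h2 := hdfix k
        have : k = 0 ∨ k = 1 ∨ k = 3 ∨ 4 ≤ k := by omega
        grind)
      grind
    · have h2 := hcfix k
      have h3 := hdfix k
      have : k = 3 ∨ 4 ≤ k := by omega
      grind
  · right
    obtain ⟨e, heL, he, hee⟩ : ∃ e ∉ comp f 0 b, [a, c, d, e].Nodup ∧ (f 1 d = e ∨ f 3 d = e) := by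
      have j1 := inv 1 d
      have j3 := inv 3 d
      by_cases h1 : f 1 d = d
      · refine ⟨f 3 d, hL _ (by omega) _ hdL, ?_, Or.inr rfl⟩
        have := hafix 3 (by omega)
        simp
        grind
      · refine ⟨f 1 d, hL _ (by omega) _ hdL, ?_, Or.inl rfl⟩
        simp
        grind
    have hall : ∀ v ∉ comp f 0 b, v = a ∨ v = c ∨ v = d ∨ v = e := fun v hv => by
      have := mem_of_ncard_le he (S := (comp f 0 b)ᶜ) (by simp; grind) (by simpa using hc) hv
      simpa using this
    have hen := he
    simp only [List.nodup_cons, List.mem_cons, List.not_mem_nil, or_false, not_or,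
      not_false_eq_true, List.nodup_nil, and_true] at he
    have he2 : f 2 e = e := by
      have := hall _ (hL 2 (by omega) e heL)
      have := inv 2 e
      grind
    have hefix : ∀ k, 4 ≤ k → f k e = e := fun k hk => by
      have := hall _ (hL k (by omega) e heL)
      have := inv k e
      have := hafix k (by omega)
      have := hcfix k (by omega)
      have := hdfix k (by omega)
      grind
    have he0 : f 0 e = e := by
      have := hall _ (hL0 e heL (by grind))
      have := h.act.comm 0 2 e le_rfl
      have := inv 0 e
      grind
    have h1 : f 1 d = e := by
      by_contra hne
      have := hleaf e heL 3 (by omega) (fun k hk => by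
        have := hall _ (hL 1 (by omega) e heL)
        have := inv 1 e
        have := hefix k
        have : k = 0 ∨ k = 1 ∨ k = 2 ∨ 4 ≤ k := by omega
        grind)
      have := inv 3 d
      grind
    have h3 : f 3 d = e := by
      by_contra hne
      have := hleaf e heL 1 (by omega) (fun k hk => by
        have := hall _ (hL 3 (by omega) e heL)
        have := inv 3 e
        have := hefix k
        have := hafix 3 (by omega)
        have : k = 0 ∨ k = 2 ∨ k = 3 ∨ 4 ≤ k := by omega
        grind)
      have := inv 1 d
      grind
    have hc0 : f 0 c = c := by
      have := hall _ (hL0 c hcL (by grind))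
      have := h.act.comm 0 3 c (by omega)
      have := inv 0 c
      grind
    have hd0 : f 0 d = d := by rw [← hd, h.act.comm 0 2 _ le_rfl, hc0]
    refine ⟨c, d, e, hc', hd, h1, h3, he2, hc3, ?_, hen, hall⟩
    simp only [List.mem_cons, List.not_mem_nil, or_false]
    rintro v (rfl | rfl | rfl)
    exacts [⟨hc0, fun k hk => hcfix k (by omega)⟩, ⟨hd0, hdfix⟩, ⟨he0, hefix⟩]

/-- If the single fracture edge with label `1` starts in `a` and the label `2` moves `a`, then a small
component of `a` is a square with labels `0` and `2`, in which the edge with label `2` that does not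
contain `a` may be doubled by the label `1`. -/
lemma left_one [Finite V] (h : Cut f s 1 a b) (hc : (comp f 1 b)ᶜ.ncard ≤ 5)
    (hmove : f 2 a ≠ a) :
    ∃ c d e, f 2 a = c ∧ f 0 a = d ∧ f 2 d = e ∧ f 0 c = e ∧ f 1 c = c ∧
      (∀ v ∈ [c, d, e], ∀ k, 3 ≤ k → f k v = v) ∧ (f 1 d = d ∧ f 1 e = e ∨ f 1 d = e) ∧
      [a, c, d, e].Nodup ∧ ∀ v ∉ comp f 1 b, v = a ∨ v = c ∨ v = d ∨ v = e := by
  have inv : ∀ k v, f k (f k v) = v := h.act.invol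
  have hL : ∀ k, k ≠ 1 → ∀ v, v ∉ comp f 1 b → f k v ∉ comp f 1 b :=
    fun k hk v hv h' => hv ((h.mem_step hk).mp h')
  have hL0 : ∀ v, v ∉ comp f 1 b → v ≠ a → f 1 v ∉ comp f 1 b := fun v hv hva h' =>
    hv ((h.mem_step_i hva (fun e => hv (e ▸ h.ex_mem))).mp h')
  have ha := h.a_notMem
  have hx := h.ex_mem
  have hxi := inv 1 a
  have hafix : ∀ k, 3 ≤ k → f k a = a := fun k hk => h.a_fixed (by omega)
  obtain ⟨v, hv, hF⟩ := h.exists_fr_notMem (k := 0) (by omega)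
  have hFn := hF.ne
  obtain ⟨c, hc'⟩ : ∃ c, f 2 a = c := ⟨_, rfl⟩
  obtain ⟨d, hd⟩ : ∃ d, f 0 a = d := ⟨_, rfl⟩
  obtain ⟨e, he⟩ : ∃ e, f 2 d = e := ⟨_, rfl⟩
  have c02 : ∀ v, f 0 (f 2 v) = f 2 (f 0 v) := fun v => h.act.comm 0 2 v le_rfl
  have hce : f 0 c = e := by rw [← hc', c02, hd, he]
  have hcL : c ∉ comp f 1 b := hc' ▸ hL 2 (by omega) a ha
  have hdL : d ∉ comp f 1 b := hd ▸ hL 0 (by omega) a ha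
  have heL : e ∉ comp f 1 b := he ▸ hL 2 (by omega) d hdL
  have i1 := inv 2 a
  have i2 := inv 0 a
  have i3 := inv 2 d
  have i4 := inv 0 c
  have hda : d ≠ a := fun e => by
    have := h.left_induction (P := fun v => f 0 v = v) (by grind) (fun q hq k hk => by
      rcases (show k = 0 ∨ 2 ≤ k by omega) with rfl | hk
      · rw [hq, hq]
      · rw [h.act.comm 0 k q hk, hq]) hv
    exact hFn this
  have hdfix : ∀ k, 3 ≤ k → f k d = d := fun k hk => by
    rw [← hd, ← h.act.comm 0 k _ (by omega), hafix k hk]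
  have hdc : d ≠ c := fun e => by
    have := h.left_induction (P := fun v => v = a ∨ v = c) (Or.inl rfl) (fun q hq k hk => by
      have h1 := hafix k
      have h2 := hdfix k
      have : k = 0 ∨ k = 2 ∨ 3 ≤ k := by omega
      grind) hv
    have := hF.ne_label (j := 2) (by omega)
    grind
  have hnd : [a, c, d, e].Nodup := by simp; grind
  have hnd' := hnd
  simp only [List.nodup_cons, List.mem_cons, List.not_mem_nil, or_false, not_or,
    not_false_eq_true, List.nodup_nil, and_true] at hnd
  have hall : ∀ v ∉ comp f 1 b, v = a ∨ v = c ∨ v = d ∨ v = e := fun z hz => by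
    by_contra hne
    have hmz : f 0 z ≠ z := h.left_induction (P := fun v => f 0 v ≠ v) (by grind)
      (fun q hq k hk => by
        rcases (show k = 0 ∨ 2 ≤ k by omega) with rfl | hk
        · exact fun e => hq (h.act.inj e)
        · rw [h.act.comm 0 k q hk]
          exact fun e => hq (h.act.inj e)) hz
    have i5 := inv 0 z
    have := length_le_ncard (S := (comp f 1 b)ᶜ) (l := [z, f 0 z, a, c, d, e])
      (by simp only [List.nodup_cons, List.mem_cons, List.not_mem_nil, or_false, not_or]; grind)
      (by have := hL 0 (by omega) z hz; simp; grind)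
    simp at this
    omega
  -- no path without the label `0` joins the two edges with this label
  have hno : ∀ p q, (p = a ∨ p = c) → (q = d ∨ q = e) → ¬ Link f {0}ᶜ p q := by
    intro p q hp hq hl
    have l1 : Link f {0}ᶜ a c := hc' ▸ Link.step_ne (by omega)
    have l2 : Link f {0}ᶜ d e := he ▸ Link.step_ne (by omega)
    have l3 : Link f {0}ᶜ a p := by rcases hp with rfl | rfl; exacts [Link.refl, l1]
    have l4 : Link f {0}ᶜ q d := by rcases hq with rfl | rfl; exacts [Link.refl, h.act.symm l2]
    have l5 := l3.trans (hl.trans l4)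
    have l6 := (h.act.symm l1).trans (l5.trans l2)
    have l7 := h.act.symm l5
    have l8 := h.act.symm l6
    unfold Fr at hF
    have := hall v hv
    grind
  have hno' : ∀ p k, (p = a ∨ p = c) → k ≠ 0 → f k p ≠ d ∧ f k p ≠ e := fun p k hp hk =>
    ⟨fun e => hno p _ hp (Or.inl e) (Link.step_ne hk),
      fun e => hno p _ hp (Or.inr e) (Link.step_ne hk)⟩
  have hcfix : ∀ k, 3 ≤ k → f k c = c := fun k hk => by
    have := hall _ (hL k (by omega) c hcL)
    have := hno' c k (Or.inr rfl) (by omega)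
    have := hafix k hk
    have := inv k c
    grind
  have hc1 : f 1 c = c := by
    have := hall _ (hL0 c hcL (by grind))
    have := hno' c 1 (Or.inr rfl) (by omega)
    have := inv 1 c
    grind
  have hefix : ∀ k, 3 ≤ k → f k e = e := fun k hk => by
    rw [← hce, ← h.act.comm 0 k c (by omega), hcfix k hk]
  refine ⟨c, d, e, hc', hd, he, hce, hc1, ?_, ?_, hnd', hall⟩
  · simp only [List.mem_cons, List.not_mem_nil, or_false]
    rintro v (rfl | rfl | rfl)
    exacts [hcfix, hdfix, hefix]
  · have := hall _ (hL0 d hdL (by grind))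
    have := hall _ (hL0 e heL (by grind))
    have := inv 1 d
    have := inv 1 e
    grind

/-- If the single fracture edge with label `2` starts in `a` and the label `3` moves `a`, then a small
component of `a` is a ladder with two sides `1, 0` and rungs labelled `3`; the last rung may be
doubled by the label `1`, and the two rungs that do not contain `a` by the label `2`. -/
lemma left_two [Finite V] (h : Cut f s 2 a b) (hc : (comp f 2 b)ᶜ.ncard ≤ 6)
    (hmove : f 3 a ≠ a) :
    ∃ c a₁ c₁ a₂ c₂, f 3 a = c ∧ f 1 a = a₁ ∧ f 1 c = c₁ ∧ f 3 a₁ = c₁ ∧ f 0 a₁ = a₂ ∧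
      f 0 c₁ = c₂ ∧ f 3 a₂ = c₂ ∧ f 0 a = a ∧ f 0 c = c ∧ f 2 c = c ∧
      (∀ v ∈ [c, a₁, c₁, a₂, c₂], ∀ k, 4 ≤ k → f k v = v) ∧
      (f 1 a₂ = a₂ ∧ f 1 c₂ = c₂ ∨ f 1 a₂ = c₂) ∧
      (f 2 a₁ = a₁ ∧ f 2 c₁ = c₁ ∧ f 2 a₂ = a₂ ∧ f 2 c₂ = c₂ ∨ f 2 a₁ = c₁ ∧ f 2 a₂ = c₂) ∧
      [a, c, a₁, c₁, a₂, c₂].Nodup ∧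
      ∀ v ∉ comp f 2 b, v = a ∨ v = c ∨ v = a₁ ∨ v = c₁ ∨ v = a₂ ∨ v = c₂ := by
  have inv : ∀ k v, f k (f k v) = v := h.act.invol
  have hL : ∀ k, k ≠ 2 → ∀ v, v ∉ comp f 2 b → f k v ∉ comp f 2 b :=
    fun k hk v hv h' => hv ((h.mem_step hk).mp h')
  have hL0 : ∀ v, v ∉ comp f 2 b → v ≠ a → f 2 v ∉ comp f 2 b := fun v hv hva h' =>
    hv ((h.mem_step_i hva (fun e => hv (e ▸ h.ex_mem))).mp h')
  have ha := h.a_notMem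
  have hx := h.ex_mem
  have hxi := inv 2 a
  have hafix : ∀ k, 4 ≤ k → f k a = a := fun k hk => h.a_fixed (by omega)
  have ha0 : f 0 a = a := h.split.fixed h.act (Or.inl le_rfl)
  -- a fracture edge with label `0` that is reached from `a` by the labels `0` and `1`
  obtain ⟨v, hv, hF, hv'⟩ : ∃ v ∉ comp f 2 b, Fr f 0 v ∧ Link f (Set.Iio 2) a v := by
    obtain ⟨v, hv, hF⟩ := h.exists_fr_notMem (k := 0) (by omega)
    obtain ⟨p, h1, h2⟩ := h.act.factor (h.notMem_iff.mp hv)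
    refine ⟨p, h.notMem_iff.mpr (h1.lt_compl le_rfl), ?_, h1⟩
    exact (h.act.symm h2).closed (P := fun q => Fr f 0 q)
      (fun q hq k (hk : 2 < k) => hq.map h.act (Or.inr (by omega))) hF
  have hFn := hF.ne
  have hF3 := hF.ne_label (j := 3) (by omega)
  obtain ⟨c, hc'⟩ : ∃ c, f 3 a = c := ⟨_, rfl⟩
  obtain ⟨a1, h1⟩ : ∃ a1, f 1 a = a1 := ⟨_, rfl⟩
  obtain ⟨c1, h2⟩ : ∃ c1, f 1 c = c1 := ⟨_, rfl⟩
  obtain ⟨a2, h3⟩ : ∃ a2, f 0 a1 = a2 := ⟨_, rfl⟩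
  obtain ⟨c2, h4⟩ : ∃ c2, f 0 c1 = c2 := ⟨_, rfl⟩
  have c13 : ∀ v, f 1 (f 3 v) = f 3 (f 1 v) := fun v => h.act.comm 1 3 v le_rfl
  have c03 : ∀ v, f 0 (f 3 v) = f 3 (f 0 v) := fun v => h.act.comm 0 3 v (by omega)
  have c02 : ∀ v, f 0 (f 2 v) = f 2 (f 0 v) := fun v => h.act.comm 0 2 v le_rfl
  have h5 : f 3 a1 = c1 := by rw [← h1, ← c13, hc', h2]
  have h6 : f 3 a2 = c2 := by rw [← h3, ← c03, h5, h4]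
  have hc0 : f 0 c = c := by rw [← hc', c03, ha0]
  have hcL : c ∉ comp f 2 b := hc' ▸ hL 3 (by omega) a ha
  have h1L : a1 ∉ comp f 2 b := h1 ▸ hL 1 (by omega) a ha
  have h2L : c1 ∉ comp f 2 b := h2 ▸ hL 1 (by omega) c hcL
  have h3L : a2 ∉ comp f 2 b := h3 ▸ hL 0 (by omega) _ h1L
  have h4L : c2 ∉ comp f 2 b := h4 ▸ hL 0 (by omega) _ h2L
  have i1 := inv 3 a
  have i2 := inv 1 a
  have i3 := inv 1 c
  have i4 := inv 0 a1
  have i5 := inv 0 c1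
  have i6 := inv 3 a1
  have i7 := inv 3 a2
  have haa : a2 ≠ a1 := fun e => by
    have := hv'.closed (P := fun v => v = a ∨ v = a1) (fun q hq k (hk : k < 2) => by
      have : k = 0 ∨ k = 1 := by omega
      grind) (Or.inl rfl)
    grind
  have hac : a2 ≠ c1 := fun e => by
    have := hv'.closed (P := fun v => v = a ∨ v = a1 ∨ v = c ∨ v = c1)
      (fun q hq k (hk : k < 2) => by
        have : k = 0 ∨ k = 1 := by omega
        grind) (Or.inl rfl)
    grind
  have hnd : [a, c, a1, c1, a2, c2].Nodup := by simp; grind (splits := 30)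
  have hall : ∀ v ∉ comp f 2 b, v = a ∨ v = c ∨ v = a1 ∨ v = c1 ∨ v = a2 ∨ v = c2 := fun v hv => by
    have := mem_of_ncard_le hnd (S := (comp f 2 b)ᶜ) (by simp; grind) (by simpa using hc) hv
    simpa using this
  have hnd' := hnd
  simp only [List.nodup_cons, List.mem_cons, List.not_mem_nil, or_false, not_or,
    not_false_eq_true, List.nodup_nil, and_true] at hnd
  have hcfix : ∀ k, 4 ≤ k → f k c = c := fun k hk => by
    have := hall _ (hL k (by omega) c hcL)
    have := h.act.comm 0 k c (by omega)
    have := hafix k hk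
    have := inv k c
    grind
  have h1fix : ∀ k, 4 ≤ k → f k a1 = a1 := fun k hk => by
    rw [← h1, ← h.act.comm 1 k a (by omega), hafix k hk]
  have h2fix : ∀ k, 4 ≤ k → f k c1 = c1 := fun k hk => by
    rw [← h2, ← h.act.comm 1 k c (by omega), hcfix k hk]
  have h3fix : ∀ k, 4 ≤ k → f k a2 = a2 := fun k hk => by
    rw [← h3, ← h.act.comm 0 k a1 (by omega), h1fix k hk]
  have h4fix : ∀ k, 4 ≤ k → f k c2 = c2 := fun k hk => by
    rw [← h4, ← h.act.comm 0 k c1 (by omega), h2fix k hk]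
  have hc2 : f 2 c = c := by
    have := hall _ (hL0 c hcL (by grind))
    have := c02 c
    have := inv 2 c
    grind
  have hno : ∀ p q, (p = a1 ∨ p = c1) → (q = a2 ∨ q = c2) → ¬ Link f {0}ᶜ p q := by
    intro p q hp hq hl
    have l1 : Link f {0}ᶜ a1 c1 := h5 ▸ Link.step_ne (by omega)
    have l2 : Link f {0}ᶜ a2 c2 := h6 ▸ Link.step_ne (by omega)
    have l3 : Link f {0}ᶜ a1 p := by rcases hp with rfl | rfl; exacts [Link.refl, l1]
    have l4 : Link f {0}ᶜ q a2 := by rcases hq with rfl | rfl; exacts [Link.refl, h.act.symm l2]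
    have l5 := l3.trans (hl.trans l4)
    have l6 := (h.act.symm l1).trans (l5.trans l2)
    have l7 := h.act.symm l5
    have l8 := h.act.symm l6
    unfold Fr at hF
    have := hall v hv
    grind
  have hno' : ∀ p, (p = a1 ∨ p = c1) → f 2 p ≠ a2 ∧ f 2 p ≠ c2 := fun p hp =>
    ⟨fun e => hno p _ hp (Or.inl e) (Link.step_ne (by omega)),
      fun e => hno p _ hp (Or.inr e) (Link.step_ne (by omega))⟩
  refine ⟨c, a1, c1, a2, c2, hc', h1, h2, h5, h3, h4, h6, ha0, hc0, hc2, ?_, ?_, ?_, hnd', hall⟩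
  · simp only [List.mem_cons, List.not_mem_nil, or_false]
    rintro v (rfl | rfl | rfl | rfl | rfl)
    exacts [hcfix, h1fix, h2fix, h3fix, h4fix]
  · have := hall _ (hL 1 (by omega) a2 h3L)
    have := inv 1 a2
    have := c13 a2
    have := inv 1 a1
    have := inv 1 c1
    grind
  · have e1 := hno' a1 (Or.inl rfl)
    have e2 := hno' c1 (Or.inr rfl)
    have e3 := hall _ (hL0 a1 h1L (by grind))
    have e4 := hall _ (hL0 c1 h2L (by grind))
    have e5 := inv 2 a1
    have e6 := inv 2 c1
    have e7 := c02 a1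
    have e8 := c02 c1
    have e9 : f 2 a1 = a1 ∨ f 2 a1 = c1 := by grind
    have e10 : f 2 c1 = a1 ∨ f 2 c1 = c1 := by grind
    clear hno hno' hall e3 e4
    grind

end Cut

end Left

/-! ### Graphs in which a large label acts at the start -/

namespace Core

lemma full_L3 (l x y : ℕ) : L3.full 3 l x y ↔
    (l, x, y) ∈ [(0, 0, 1), (2, 0, 1), (1, 1, 2), (0, 2, 3), (1, 3, 4), (2, 4, 5)] := by
  constructor
  · rintro ((⟨rfl | rfl, rfl, rfl⟩ | ⟨rfl, rfl, rfl⟩) | ⟨-, h1, h2, rfl⟩)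
    iterate 3 simp
    obtain rfl : x = l + 2 := by
      simp only [L3] at h2; omega
    interval_cases l <;> simp
  · simp only [List.mem_cons, Prod.mk.injEq, List.not_mem_nil, or_false]
    rintro (⟨rfl, rfl, rfl⟩ | ⟨rfl, rfl, rfl⟩ | ⟨rfl, rfl, rfl⟩ | ⟨rfl, rfl, rfl⟩ | ⟨rfl, rfl,
      rfl⟩ | ⟨rfl, rfl, rfl⟩) <;> simp [full, L3]

lemma full_Q3 (l x y : ℕ) : Q3.full 4 l x y ↔
    (l, x, y) ∈ [(1, 0, 1), (3, 0, 1), (2, 1, 2), (1, 2, 3), (0, 3, 4), (1, 4, 5), (2, 5, 6), (3,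
      6, 7)] := by
  constructor
  · rintro ((⟨rfl | rfl, rfl, rfl⟩ | ⟨rfl, rfl, rfl⟩ | ⟨rfl, rfl, rfl⟩) | ⟨-, h1, h2, rfl⟩)
    iterate 4 simp
    obtain rfl : x = l + 3 := by
      simp only [Q3] at h2; omega
    interval_cases l <;> simp
  · simp only [List.mem_cons, Prod.mk.injEq, List.not_mem_nil, or_false]
    rintro (⟨rfl, rfl, rfl⟩ | ⟨rfl, rfl, rfl⟩ | ⟨rfl, rfl, rfl⟩ | ⟨rfl, rfl, rfl⟩ | ⟨rfl, rfl,
      rfl⟩ | ⟨rfl, rfl, rfl⟩ | ⟨rfl, rfl, rfl⟩ | ⟨rfl, rfl, rfl⟩) <;> simp [full, Q3]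

lemma full_A (l x y : ℕ) : A.full 4 l x y ↔
    (l, x, y) ∈ [(2, 2, 0), (2, 3, 1), (0, 0, 1), (0, 2, 3), (1, 3, 4), (2, 4, 5), (3, 5, 6)] :=
      by
  constructor
  · rintro ((⟨rfl, rfl, rfl⟩ | ⟨rfl, rfl, rfl⟩ | ⟨rfl, rfl, rfl⟩) | ⟨-, h1, h2, rfl⟩)
    iterate 3 simp
    obtain rfl : x = l + 2 := by
      simp only [A] at h2; omega
    interval_cases l <;> simp
  · simp only [List.mem_cons, Prod.mk.injEq, List.not_mem_nil, or_false]
    rintro (⟨rfl, rfl, rfl⟩ | ⟨rfl, rfl, rfl⟩ | ⟨rfl, rfl, rfl⟩ | ⟨rfl, rfl, rfl⟩ | ⟨rfl, rfl,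
      rfl⟩ | ⟨rfl, rfl, rfl⟩ | ⟨rfl, rfl, rfl⟩) <;> simp [full, A]

lemma full_G (l x y : ℕ) : G.full 3 l x y ↔
    (l, x, y) ∈ [(1, 2, 0), (2, 2, 0), (2, 3, 1), (0, 0, 1), (0, 2, 3), (1, 3, 4), (2, 4, 5)] :=
      by
  constructor
  · rintro ((⟨rfl, rfl, rfl⟩ | ⟨rfl, rfl, rfl⟩ | ⟨rfl, rfl, rfl⟩ | ⟨rfl, rfl, rfl⟩) | ⟨-, h1, h2,
      rfl⟩)
    iterate 4 simp
    obtain rfl : x = l + 2 := by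
      simp only [G, A] at h2; omega
    interval_cases l <;> simp
  · simp only [List.mem_cons, Prod.mk.injEq, List.not_mem_nil, or_false]
    rintro (⟨rfl, rfl, rfl⟩ | ⟨rfl, rfl, rfl⟩ | ⟨rfl, rfl, rfl⟩ | ⟨rfl, rfl, rfl⟩ | ⟨rfl, rfl,
      rfl⟩ | ⟨rfl, rfl, rfl⟩ | ⟨rfl, rfl, rfl⟩) <;> simp [full, G, A]

lemma full_B (l x y : ℕ) : B.full 5 l x y ↔
    (l, x, y) ∈ [(3, 3, 0), (3, 4, 1), (3, 5, 2), (0, 0, 1), (1, 1, 2), (0, 3, 4), (1, 4, 5), (2,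
      5, 6), (3, 6, 7), (4, 7, 8)] := by
  constructor
  · rintro ((⟨rfl, rfl, rfl⟩ | ⟨rfl, rfl, rfl⟩ | ⟨rfl, rfl, rfl⟩ | ⟨rfl, rfl, rfl⟩ | ⟨rfl, rfl,
      rfl⟩) | ⟨-, h1, h2, rfl⟩)
    iterate 5 simp
    obtain rfl : x = l + 3 := by
      simp only [B] at h2; omega
    interval_cases l <;> simp
  · simp only [List.mem_cons, Prod.mk.injEq, List.not_mem_nil, or_false]
    rintro (⟨rfl, rfl, rfl⟩ | ⟨rfl, rfl, rfl⟩ | ⟨rfl, rfl, rfl⟩ | ⟨rfl, rfl, rfl⟩ | ⟨rfl, rfl,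
      rfl⟩ | ⟨rfl, rfl, rfl⟩ | ⟨rfl, rfl, rfl⟩ | ⟨rfl, rfl, rfl⟩ | ⟨rfl, rfl, rfl⟩ | ⟨rfl, rfl,
      rfl⟩) <;> simp [full, B]

lemma full_H1 (l x y : ℕ) : H1.full 4 l x y ↔
    (l, x, y) ∈ [(1, 3, 0), (3, 3, 0), (3, 4, 1), (3, 5, 2), (0, 0, 1), (1, 1, 2), (0, 3, 4), (1,
      4, 5), (2, 5, 6), (3, 6, 7)] := by
  constructor
  · rintro ((⟨rfl, rfl, rfl⟩ | ⟨rfl, rfl, rfl⟩ | ⟨rfl, rfl, rfl⟩ | ⟨rfl, rfl, rfl⟩ | ⟨rfl, rfl,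
      rfl⟩ | ⟨rfl, rfl, rfl⟩) | ⟨-, h1, h2, rfl⟩)
    iterate 6 simp
    obtain rfl : x = l + 3 := by
      simp only [H1, B] at h2; omega
    interval_cases l <;> simp
  · simp only [List.mem_cons, Prod.mk.injEq, List.not_mem_nil, or_false]
    rintro (⟨rfl, rfl, rfl⟩ | ⟨rfl, rfl, rfl⟩ | ⟨rfl, rfl, rfl⟩ | ⟨rfl, rfl, rfl⟩ | ⟨rfl, rfl,
      rfl⟩ | ⟨rfl, rfl, rfl⟩ | ⟨rfl, rfl, rfl⟩ | ⟨rfl, rfl, rfl⟩ | ⟨rfl, rfl, rfl⟩ | ⟨rfl, rfl,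
      rfl⟩) <;> simp [full, H1, B]

lemma full_H2 (l x y : ℕ) : H2.full 4 l x y ↔
    (l, x, y) ∈ [(2, 3, 0), (2, 4, 1), (3, 3, 0), (3, 4, 1), (3, 5, 2), (0, 0, 1), (1, 1, 2), (0,
      3, 4), (1, 4, 5), (2, 5, 6), (3, 6, 7)] := by
  constructor
  · rintro ((⟨rfl, rfl, rfl⟩ | ⟨rfl, rfl, rfl⟩ | ⟨rfl, rfl, rfl⟩ | ⟨rfl, rfl, rfl⟩ | ⟨rfl, rfl,
      rfl⟩ | ⟨rfl, rfl, rfl⟩ | ⟨rfl, rfl, rfl⟩) | ⟨-, h1, h2, rfl⟩)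
    iterate 7 simp
    obtain rfl : x = l + 3 := by
      simp only [H2, B] at h2; omega
    interval_cases l <;> simp
  · simp only [List.mem_cons, Prod.mk.injEq, List.not_mem_nil, or_false]
    rintro (⟨rfl, rfl, rfl⟩ | ⟨rfl, rfl, rfl⟩ | ⟨rfl, rfl, rfl⟩ | ⟨rfl, rfl, rfl⟩ | ⟨rfl, rfl,
      rfl⟩ | ⟨rfl, rfl, rfl⟩ | ⟨rfl, rfl, rfl⟩ | ⟨rfl, rfl, rfl⟩ | ⟨rfl, rfl, rfl⟩ | ⟨rfl, rfl,
      rfl⟩ | ⟨rfl, rfl, rfl⟩) <;> simp [full, H2, B]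

lemma full_X3 (l x y : ℕ) : X3.full 4 l x y ↔
    (l, x, y) ∈ [(1, 3, 0), (2, 3, 0), (2, 4, 1), (3, 3, 0), (3, 4, 1), (3, 5, 2), (0, 0, 1), (1,
      1, 2), (0, 3, 4), (1, 4, 5), (2, 5, 6), (3, 6, 7)] := by
  constructor
  · rintro ((⟨rfl, rfl, rfl⟩ | ⟨rfl, rfl, rfl⟩ | ⟨rfl, rfl, rfl⟩ | ⟨rfl, rfl, rfl⟩ | ⟨rfl, rfl,
      rfl⟩ | ⟨rfl, rfl, rfl⟩ | ⟨rfl, rfl, rfl⟩ | ⟨rfl, rfl, rfl⟩) | ⟨-, h1, h2, rfl⟩)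
    iterate 8 simp
    obtain rfl : x = l + 3 := by
      simp only [X3, H2, B] at h2; omega
    interval_cases l <;> simp
  · simp only [List.mem_cons, Prod.mk.injEq, List.not_mem_nil, or_false]
    rintro (⟨rfl, rfl, rfl⟩ | ⟨rfl, rfl, rfl⟩ | ⟨rfl, rfl, rfl⟩ | ⟨rfl, rfl, rfl⟩ | ⟨rfl, rfl,
      rfl⟩ | ⟨rfl, rfl, rfl⟩ | ⟨rfl, rfl, rfl⟩ | ⟨rfl, rfl, rfl⟩ | ⟨rfl, rfl, rfl⟩ | ⟨rfl, rfl,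
      rfl⟩ | ⟨rfl, rfl, rfl⟩ | ⟨rfl, rfl, rfl⟩) <;> simp [full, X3, H2, B]

end Core

section Mixed

variable {V : Type*} {f : ℕ → V → V} {s i m w : ℕ} {a b : V}

lemma ncard_le_length {S : Set V} (l : List V) (h : ∀ x ∈ S, x ∈ l) : S.ncard ≤ l.length := by
  classical
  have h1 : S ⊆ (l.toFinset : Set V) := fun x hx => by simpa using h x hx
  exact (Set.ncard_le_ncard h1 (Finset.finite_toSet _)).trans
    ((Set.ncard_coe_finset _).le.trans (List.toFinset_card_le l))

/-- To number the vertices by a list, all edges and all fixed vertices have to be checked. -/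
lemma vertexNumbering_of_list {r n : ℕ} {E : ℕ → ℕ → ℕ → Prop} (hf : IsStringAction f r)
    (vs : List V) (hn : vs.length = n) (hvs : ∀ p, p ∈ vs) (L : List (ℕ × ℕ × ℕ))
    (hE : ∀ l x y, E l x y ↔ (l, x, y) ∈ L)
    (adj : ∀ e ∈ L, f e.1 (vs.getD e.2.1 b) = vs.getD e.2.2 b)
    (fix : ∀ l < r, ∀ x < n, (∀ e ∈ L, e.1 = l → e.2.1 ≠ x ∧ e.2.2 ≠ x) →
      f l (vs.getD x b) = vs.getD x b) :
    VertexNumbering f n E (vs.getD · b) := by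
  refine ⟨fun p => ?_, fun l x y h => adj _ ((hE l x y).mp h), fun l x hx h => ?_⟩
  · obtain ⟨k, hk, rfl⟩ := List.getElem_of_mem (hvs p)
    exact ⟨k, by omega, by simp [hk]⟩
  by_cases hl : l < r
  · refine fix l hl x hx fun e he hel => ⟨?_, ?_⟩
    · rintro rfl
      exact (h e.2.2).1 ((hE _ _ _).mpr (hel ▸ he))
    · rintro rfl
      exact (h e.2.1).2 ((hE _ _ _).mpr (hel ▸ he))
  · exact hf.triv _ _ (by omega)

/-- A label without fracture edges at the vertices of the first side has all its fracture edges on the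
second one. -/
lemma twice_of_left (_ : Cut f s i a b) (hn : ∀ v ∉ comp f i b, ¬ Fr f m v)
    (hN : NonSplit f m) : Twice f m (comp f i b) := by
  obtain ⟨u, v, hu, hv, h1, h2⟩ := hN
  exact ⟨u, by_contra fun hu' => hn u hu' hu, v, by_contra fun hv' => hn v hv' hv, hu, hv, h1, h2⟩

namespace Cut

lemma right_one_not_twice [Finite V] (h : Cut f (i + 2) i a b) (hc : (comp f i b).ncard ≤ 4) :
    ¬ Twice f (i + 1) (comp f i b) := by
  obtain ⟨h1, h2⟩ := h.right_one hc
  refine not_twice h.act (f i a) fun u hu hF => ?_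
  have := hF.ne
  have := h.right.fixed (i + 1) (by omega)
  have := h.act.invol (i + 1) (f (i + 2) b)
  grind

/-- A count of the component of `b` from below, in terms of the labels between `m` and `s`. -/
lemma le_card_Ioo [Finite V] (h : Cut f s i a b) (hm : i ≤ m)
    (ht : ∀ k, m < k → k < s → Twice f k (comp f i b)) :
    s - i + 1 + (s - m - 1) ≤ (comp f i b).ncard := by
  have := h.le_card_right (M := Finset.Ioo m s) fun k hk => by
    obtain ⟨h1, h2⟩ := Finset.mem_Ioo.mp hk
    exact ⟨by omega, h2, ht k h1 h2⟩
  rwa [Nat.card_Ioo] at this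

/-- The vertices on the two sides of a cut, listed together. -/
lemma cover_list (_ : Cut f s i a b) {l₁ l₂ l : List V} (h₁ : ∀ v ∈ comp f i b, v ∈ l₁)
    (h₂ : ∀ v ∉ comp f i b, v ∈ l₂) (h : ∀ v ∈ l₁, v ∈ l) (h' : ∀ v ∈ l₂, v ∈ l) (p : V) :
    p ∈ l := by
  by_cases hp : p ∈ comp f i b
  exacts [h _ (h₁ p hp), h' _ (h₂ p hp)]

lemma rev (h : Cut f s i a b) {k : ℕ} {u v : V} (e : f k u = v) : f k v = u :=
  (h.act.eq_iff.mp e).symm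

/-- The number of vertices in terms of the sizes of the two sides of a cut. -/
lemma card_eq [Finite V] (h : Cut f s i a b) {l₁ l₂ : List V} (h₁ : ∀ v ∈ comp f i b, v ∈ l₁)
    (h₂ : ∀ v ∉ comp f i b, v ∈ l₂) : Nat.card V ≤ l₁.length + l₂.length := by
  have := h.card_add_card
  have := ncard_le_length l₁ h₁
  have := ncard_le_length (S := (comp f i b)ᶜ) l₂ h₂
  omega

/-- The case of the first side `1, {0, 2}` or `1, 2, {1, 3}`: the number of vertices leaves no space for
further labels, which gives `L3` and `Q3`. -/
lemma listed_left_zero [Finite V] (h : Cut f s 0 a b) (hc : Nat.card V = s + 2 + w) (hw : w ≤ 3)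
    (hN : ∀ k, 0 < k → k < s → NonSplit f k) (hmove : f 1 a ≠ a)
    (hleaf : ∀ z ∉ comp f 0 b, ∀ m, m ≠ 0 → (∀ k, k ≠ m → f k z = z) → f m z = z) :
    Listed f (s + 1) b w := by
  have hadd := h.card_add_card
  have h0 := h.le_card_right (M := ∅) (by simp)
  simp only [Finset.card_empty] at h0
  have ha2 : ∀ k, 2 ≤ k → f k a = a := fun k hk => h.a_fixed hk
  have e1 := h.a_notMem
  rcases h.left_zero (by omega) hmove hleaf with
    ⟨c, d, h1, h2, h3, h4, h5, h6, hall⟩ | ⟨c, d, e, h1, h2, h3, h4, h5, h6, h7, h8, hall⟩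
  · have e2 : c ∉ comp f 0 b := h1 ▸ fun h' => e1 ((h.mem_step (by omega)).mp h')
    have e3 : d ∉ comp f 0 b := h2 ▸ fun h' => e2 ((h.mem_step (by omega)).mp h')
    have hL : 3 ≤ (comp f 0 b)ᶜ.ncard := length_le_ncard h6 (by simp [e1, e2, e3])
    have hs : 2 ≤ s := by
      by_contra hs
      have := h.act.triv 2 c (by omega)
      simp_all
    have ht : ∀ k, 1 < k → k < s → Twice f k (comp f 0 b) := fun k hk hks =>
      twice_of_left h (fun v hv hF => by
        have e1 := hF.ne
        have e2 := ha2 k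
        have e3 := h5 k
        have e5 := hF.ne_label (j := 0) (by omega)
        have e6 := hall v hv
        have e7 := h.act.invol 0 c
        have e8 := h.act.invol 2 c
        have : k = 2 ∨ 3 ≤ k := by omega
        grind) (hN k (by omega) hks)
    have hM := h.le_card_Ioo (m := 1) (by omega) ht
    rcases (show s = 2 ∨ s = 3 by omega) with rfl | rfl
    · obtain ⟨h8, h9⟩ := h.right_one (by omega)
      simp only [zero_add] at h8 h9
      have q1 : ∀ v ∈ comp f 0 b, v ∈ [b, f 2 b, f 0 a] := by simpa using h9
      have q2 : ∀ v ∉ comp f 0 b, v ∈ [a, c, d] := by simpa using hall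
      have := h.card_eq q1 q2
      simp only [List.length_cons, List.length_nil] at this
      obtain rfl : w = 2 := by omega
      have hy0 := h.y_fixed (k := 0) (by omega) (by omega)
      have hb0 := h.right.fixed 0 (by omega)
      have hb1 := h.right.fixed 1 (by omega)
      have hx2 := h.x_fixed (k := 2) (by omega) (by omega)
      have ha2' := ha2 2 le_rfl
      have j1 := h.rev h1
      have j2 := h.rev h2
      have j3 := h.rev h3
      have j4 := h.rev h8
      have j5 := h.rev (rfl : f 2 b = f 2 b)
      refine ⟨Core.L3, by simp [Core.listed], le_rfl, _, vertexNumbering_of_list (b := b) h.act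
        [d, c, a, f 0 a, f 2 b, b] rfl ?_ _ Core.full_L3 ?_ ?_, rfl⟩
      · intro p
        exact h.cover_list q1 q2 (by simp) (by simp) p
      · simp only [List.forall_mem_cons, List.not_mem_nil, false_imp_iff, implies_true, and_true,
          List.getD_cons_succ, List.getD_cons_zero]
        and_intros <;> first | rfl | assumption | trivial
      · intro l hl k hk hno
        replace hk : k < 6 := hk
        interval_cases l <;> interval_cases k <;> first
          | exact absurd hno (by decide)
          | (simp only [List.getD_cons_succ, List.getD_cons_zero]; assumption)
    · exact absurd (ht 2 (by omega) (by omega)) (h.right_two_not_twice (by omega))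
  · have e2 : c ∉ comp f 0 b := h1 ▸ fun h' => e1 ((h.mem_step (by omega)).mp h')
    have e3 : d ∉ comp f 0 b := h2 ▸ fun h' => e2 ((h.mem_step (by omega)).mp h')
    have e4 : e ∉ comp f 0 b := h3 ▸ fun h' => e3 ((h.mem_step (by omega)).mp h')
    have hL : 4 ≤ (comp f 0 b)ᶜ.ncard := length_le_ncard h8 (by simp [e1, e2, e3, e4])
    simp only [List.nodup_cons, List.mem_cons, List.not_mem_nil, or_false, not_or] at h8
    have hs : 3 ≤ s := by
      by_contra hs
      have := h.act.triv 3 d (by omega)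
      simp_all
    have ht : ∀ k, 2 < k → k < s → Twice f k (comp f 0 b) := fun k hk hks =>
      twice_of_left h (fun v hv hF => by
        have e1 := hF.ne
        have e2 := ha2 k
        have e3 := fun v hv => (h7 v hv).2 k
        have e5 := hF.ne_label (j := 1) (by omega)
        have e6 := hall v hv
        have e7 := h.act.invol 1 d
        have e8 := h.act.invol 3 d
        have : k = 3 ∨ 4 ≤ k := by omega
        simp only [List.mem_cons, List.not_mem_nil, or_false] at e3
        grind) (hN k (by omega) hks)
    have hM := h.le_card_Ioo (m := 2) (by omega) ht
    obtain rfl : s = 3 := by omega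
    obtain ⟨h9, h10⟩ := h.right_two_of_le_four (by omega)
    simp only [zero_add] at h9 h10
    have q1 : ∀ v ∈ comp f 0 b, v ∈ [b, f 3 b, f 1 (f 0 a), f 0 a] := by simpa using h10
    have q2 : ∀ v ∉ comp f 0 b, v ∈ [a, c, d, e] := by simpa using hall
    have := h.card_eq q1 q2
    simp only [List.length_cons, List.length_nil] at this
    obtain rfl : w = 3 := by omega
    simp only [List.forall_mem_cons, List.not_mem_nil, false_imp_iff, implies_true, and_true] at h7
    obtain ⟨⟨k1, -⟩, ⟨k2, -⟩, k3, -⟩ := h7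
    have hy0 := h.y_fixed (k := 0) (by omega) (by omega)
    have hy1 := h.y_fixed (k := 1) (by omega) (by omega)
    have hb0 := h.right.fixed 0 (by omega)
    have hb1 := h.right.fixed 1 (by omega)
    have hb2 := h.right.fixed 2 (by omega)
    have hx2 := h.x_fixed (k := 2) (by omega) (by omega)
    have hx3 := h.x_fixed (k := 3) (by omega) (by omega)
    have ha2' := ha2 2 le_rfl
    have ha3' := ha2 3 (by omega)
    have hp0 : f 0 (f 1 (f 0 a)) = f 1 (f 0 a) := by
      rw [← h9, h.act.comm 0 2 _ le_rfl, hy0]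
    have hp3 : f 3 (f 1 (f 0 a)) = f 1 (f 0 a) := by
      rw [← h.act.comm 1 3 _ le_rfl, hx3]
    have j1 := h.rev h1
    have j2 := h.rev h2
    have j3 := h.rev h3
    have j4 := h.rev h4
    have j5 := h.rev h9
    have j6 := h.rev (rfl : f 3 b = f 3 b)
    refine ⟨Core.Q3, by simp [Core.listed], le_rfl, _, vertexNumbering_of_list (b := b) h.act
      [e, d, c, a, f 0 a, f 1 (f 0 a), f 3 b, b] rfl ?_ _ Core.full_Q3 ?_ ?_, rfl⟩
    · intro p
      exact h.cover_list q1 q2 (by simp) (by simp) p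
    · simp only [List.forall_mem_cons, List.not_mem_nil, false_imp_iff, implies_true, and_true,
        List.getD_cons_succ, List.getD_cons_zero]
      and_intros <;> first | rfl | assumption | trivial
    · intro l hl k hk hno
      replace hk : k < 8 := hk
      interval_cases l <;> interval_cases k <;> first
        | exact absurd hno (by decide)
        | (simp only [List.getD_cons_succ, List.getD_cons_zero]; assumption)

/-- A label is a fracture label of the vertex `a` if the only ways out of some set are its edges. -/
lemma fr_of_closed {P : V → Prop} {u : V} {k : ℕ} (hP : ∀ p, P p → ∀ l, l ≠ k → P (f l p))
    (hu : P u) (hk : ¬ P (f k u)) : Fr f k u := fun hl =>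
  hk (hl.closed (fun p hp l hl => hP p hp l hl) hu)

/-- The case in which the first side contains a square: the graphs `A` and `G`. -/
lemma listed_left_one [Finite V] (h : Cut f s 1 a b) (hc : Nat.card V = s + 2 + w) (hw : w ≤ 3)
    (hN : ∀ k, 1 < k → k < s → NonSplit f k) (hmove : f 2 a ≠ a) :
    Listed f (s + 1) b w := by
  have hadd := h.card_add_card
  have h0 := h.le_card_right (M := ∅) (by simp)
  simp only [Finset.card_empty] at h0
  have hs := h.lt
  have ha3 : ∀ k, 3 ≤ k → f k a = a := fun k hk => h.a_fixed hk
  have e1 := h.a_notMem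
  obtain ⟨c, d, e, h1, h2, h3, h4, h5, h6, h7, h8, hall⟩ := h.left_one (by omega) hmove
  have e2 : c ∉ comp f 1 b := h1 ▸ fun h' => e1 ((h.mem_step (by omega)).mp h')
  have e3 : d ∉ comp f 1 b := h2 ▸ fun h' => e1 ((h.mem_step (by omega)).mp h')
  have e4 : e ∉ comp f 1 b := h3 ▸ fun h' => e3 ((h.mem_step (by omega)).mp h')
  have hL : 4 ≤ (comp f 1 b)ᶜ.ncard := length_le_ncard h8 (by simp [e1, e2, e3, e4])
  simp only [List.nodup_cons, List.mem_cons, List.not_mem_nil, or_false, not_or,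
    not_false_eq_true, List.nodup_nil, and_true] at h8
  have hfix : ∀ v ∉ comp f 1 b, ∀ k, 3 ≤ k → f k v = v := fun v hv k hk => by
    rcases hall v hv with rfl | rfl | rfl | rfl
    exacts [ha3 k hk, h6 _ (by simp) k hk, h6 _ (by simp) k hk, h6 _ (by simp) k hk]
  have ht3 : ∀ k, 2 < k → k < s → Twice f k (comp f 1 b) := fun k hk hks =>
    twice_of_left h (fun v hv hF => hF.ne (hfix v hv k hk)) (hN k (by omega) hks)
  have hb0 := h.right.fixed 0
  have hb1 := h.right.fixed 1 (by omega)
  have hx0 := h.x_fixed (k := 0) (by omega) (by omega)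
  have i1 := h.rev h1
  have i2 := h.rev h2
  have i3 := h.rev h3
  have i4 := h.rev h4
  rcases h7 with ⟨k1, k2⟩ | h7
  · have hM := h.le_card_Ioo (m := 2) (by omega) ht3
    have hs2 : s ≠ 2 := by
      rintro rfl
      have hF : Fr f 2 a := by
        refine fr_of_closed (P := fun v => v ∈ comp f 1 b ∨ v = a ∨ v = d) ?_ (by simp) ?_
        · intro p hp l hl
          have j1 := ha3 l
          have j2 := h6 d (by simp) l
          by_cases hl1 : l = 1
          · subst hl1
            rcases hp with hp | rfl | rfl
            · by_cases hpx : p = f 1 a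
              · rw [hpx, h.act.invol]; exact Or.inr (Or.inl rfl)
              · exact Or.inl ((h.mem_step_i (fun e => e1 (e ▸ hp)) hpx).mpr hp)
            · exact Or.inl h.ex_mem
            · exact Or.inr (Or.inr k1)
          · rcases hp with hp | hp | hp
            · exact Or.inl ((h.mem_step hl1).mpr hp)
            all_goals
              right
              have : l = 0 ∨ 3 ≤ l := by omega
              grind
        · rw [h1]; grind
      rcases h.right.split.2 a hF with rfl | e
      · exact e1 h.b_mem
      · exact e1 (e ▸ h.y_mem)
    rcases (show s = 3 ∨ s = 4 by omega) with rfl | rfl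
    · obtain ⟨h9, h10⟩ := h.right_one (by omega)
      simp only [Nat.reduceAdd] at h9 h10
      have q1 : ∀ v ∈ comp f 1 b, v ∈ [b, f 3 b, f 1 a] := by simpa using h10
      have q2 : ∀ v ∉ comp f 1 b, v ∈ [a, c, d, e] := by simpa using hall
      have := h.card_eq q1 q2
      simp only [List.length_cons, List.length_nil] at this
      obtain rfl : w = 2 := by omega
      have hy0 := h.y_fixed (k := 0) (by omega) (by omega)
      have hy1 := h.y_fixed (k := 1) (by omega) (by omega)
      have hb0 := h.right.fixed 0 (by omega)
      have hb2 := h.right.fixed 2 (by omega)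
      have hx3 := h.x_fixed (k := 3) (by omega) (by omega)
      have f1 := hfix a e1 3 le_rfl
      have f2 := hfix c e2 3 le_rfl
      have f3 := hfix d e3 3 le_rfl
      have f4 := hfix e e4 3 le_rfl
      have j1 := h.rev h9
      have j2 := h.rev (rfl : f 3 b = f 3 b)
      refine ⟨Core.A, by simp [Core.listed], le_rfl, _, vertexNumbering_of_list (b := b) h.act
        [e, c, d, a, f 1 a, f 3 b, b] rfl ?_ _ Core.full_A ?_ ?_, rfl⟩
      · intro p
        exact h.cover_list q1 q2 (by simp) (by simp) p
      · simp only [List.forall_mem_cons, List.not_mem_nil, false_imp_iff, implies_true, and_true,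
          List.getD_cons_succ, List.getD_cons_zero]
        and_intros <;> first | rfl | assumption | trivial
      · intro l hl k hk hno
        replace hk : k < 7 := hk
        interval_cases l <;> interval_cases k <;> first
          | exact absurd hno (by decide)
          | (simp only [List.getD_cons_succ, List.getD_cons_zero]; assumption)
    · exact absurd (ht3 3 (by omega) (by omega)) (h.right_two_not_twice (by omega))
  · have i5 := h.rev h7
    have ht : ∀ k, 1 < k → k < s → Twice f k (comp f 1 b) := fun k hk hks => by
      rcases (show k = 2 ∨ 2 < k by omega) with rfl | hk
      · refine twice_of_left h (fun v hv hF => ?_) (hN 2 (by omega) hks)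
        have l1 : Link f {2}ᶜ a d := h2 ▸ Link.step_ne (by omega)
        have l2 : Link f {2}ᶜ d e := h7 ▸ Link.step_ne (by omega)
        have l3 : Link f {2}ᶜ e c := i4 ▸ Link.step_ne (by omega)
        have l4 := (l1.trans l2).trans l3
        have l5 := h.act.symm l2
        have l6 := h.act.symm l4
        have := hall v hv
        unfold Fr at hF
        grind
      · exact ht3 k hk hks
    have hM := h.le_card_Ioo (m := 1) (by omega) ht
    rcases (show s = 2 ∨ s = 3 by omega) with rfl | rfl
    · obtain ⟨h9, h10⟩ := h.right_zero
      simp only [Nat.reduceAdd] at h9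
      have q1 : ∀ v ∈ comp f 1 b, v ∈ [b, f 1 a] := by simpa using h10
      have q2 : ∀ v ∉ comp f 1 b, v ∈ [a, c, d, e] := by simpa using hall
      have := h.card_eq q1 q2
      simp only [List.length_cons, List.length_nil] at this
      obtain rfl : w = 2 := by omega
      have hb0 := h.right.fixed 0 (by omega)
      have j1 := h.rev h9
      refine ⟨Core.G, by simp [Core.listed], le_rfl, _, vertexNumbering_of_list (b := b) h.act
        [e, c, d, a, f 1 a, b] rfl ?_ _ Core.full_G ?_ ?_, rfl⟩
      · intro p
        exact h.cover_list q1 q2 (by simp) (by simp) p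
      · simp only [List.forall_mem_cons, List.not_mem_nil, false_imp_iff, implies_true, and_true,
          List.getD_cons_succ, List.getD_cons_zero]
        and_intros <;> first | rfl | assumption | trivial
      · intro l hl k hk hno
        replace hk : k < 6 := hk
        interval_cases l <;> interval_cases k <;> first
          | exact absurd hno (by decide)
          | (simp only [List.getD_cons_succ, List.getD_cons_zero]; assumption)
    · exact absurd (ht 2 (by omega) (by omega)) (h.right_one_not_twice (by omega))

/-- The case in which the first side contains a ladder: the graphs `B`, `H1`, `H2` and `X3`. -/
lemma listed_left_two [Finite V] (h : Cut f s 2 a b) (hc : Nat.card V = s + 2 + w) (hw : w ≤ 3)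
    (hN : ∀ k, 2 < k → k < s → NonSplit f k) (hmove : f 3 a ≠ a) :
    Listed f (s + 1) b w := by
  have hadd := h.card_add_card
  have h0 := h.le_card_right (M := ∅) (by simp)
  simp only [Finset.card_empty] at h0
  have hs := h.lt
  have ha3 : ∀ k, 4 ≤ k → f k a = a := fun k hk => h.a_fixed hk
  have e1 := h.a_notMem
  obtain ⟨c, a1, c1, a2, c2, h1, h2, h3, h4, h5, h6, h7, h8, h9, h10, h11, h12, h13, hnd, hall⟩ :=
    h.left_two (by omega) hmove
  have e2 : c ∉ comp f 2 b := h1 ▸ fun h' => e1 ((h.mem_step (by omega)).mp h')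
  have e3 : a1 ∉ comp f 2 b := h2 ▸ fun h' => e1 ((h.mem_step (by omega)).mp h')
  have e4 : c1 ∉ comp f 2 b := h3 ▸ fun h' => e2 ((h.mem_step (by omega)).mp h')
  have e5 : a2 ∉ comp f 2 b := h5 ▸ fun h' => e3 ((h.mem_step (by omega)).mp h')
  have e6 : c2 ∉ comp f 2 b := h6 ▸ fun h' => e4 ((h.mem_step (by omega)).mp h')
  have hL : 6 ≤ (comp f 2 b)ᶜ.ncard := length_le_ncard hnd (by simp [e1, e2, e3, e4, e5, e6])
  simp only [List.nodup_cons, List.mem_cons, List.not_mem_nil, or_false, not_or,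
    not_false_eq_true, List.nodup_nil, and_true] at hnd
  have hfix : ∀ v ∉ comp f 2 b, ∀ k, 4 ≤ k → f k v = v := fun v hv k hk => by
    rcases hall v hv with rfl | rfl | rfl | rfl | rfl | rfl
    exacts [ha3 k hk, h11 _ (by simp) k hk, h11 _ (by simp) k hk, h11 _ (by simp) k hk,
      h11 _ (by simp) k hk, h11 _ (by simp) k hk]
  have ht4 : ∀ k, 3 < k → k < s → Twice f k (comp f 2 b) := fun k hk hks =>
    twice_of_left h (fun v hv hF => hF.ne (hfix v hv k hk)) (hN k (by omega) hks)
  have hM := h.le_card_Ioo (m := 3) (by omega) ht4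
  have hb0 := h.right.fixed 0 (by omega)
  have hb1 := h.right.fixed 1 (by omega)
  have hb2 := h.right.fixed 2 (by omega)
  have hx0 := h.x_fixed (k := 0) (by omega) (by omega)
  have hx1 := h.x_fixed (k := 1) (by omega) (by omega)
  have i1 := h.rev h1
  have i2 := h.rev h2
  have i3 := h.rev h3
  have i4 := h.rev h4
  have i5 := h.rev h5
  have i6 := h.rev h6
  have i7 := h.rev h7
  have hs34 : s = 3 ∨ s = 4 := by omega
  by_cases hB : (f 1 a2 = a2 ∧ f 1 c2 = c2) ∧ (f 2 a1 = a1 ∧ f 2 c1 = c1 ∧ f 2 a2 = a2 ∧ f 2 c2 = c2)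
  · obtain ⟨⟨k1, k2⟩, k3, k4, k5, k6⟩ := hB
    have hs3 : s ≠ 3 := by
      rintro rfl
      have hF : Fr f 3 a := by
        refine fr_of_closed (P := fun v => v ∈ comp f 2 b ∨ v = a ∨ v = a1 ∨ v = a2) ?_ (by simp) ?_
        · intro p hp l hl
          have j1 := ha3 l
          have j2 := h11 a1 (by simp) l
          have j3 := h11 a2 (by simp) l
          by_cases hl1 : l = 2
          · subst hl1
            rcases hp with hp | rfl | rfl | rfl
            · by_cases hpx : p = f 2 a
              · rw [hpx, h.act.invol]; exact Or.inr (Or.inl rfl)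
              · exact Or.inl ((h.mem_step_i (fun e => e1 (e ▸ hp)) hpx).mpr hp)
            · exact Or.inl h.ex_mem
            · exact Or.inr (Or.inr (Or.inl k3))
            · exact Or.inr (Or.inr (Or.inr k5))
          · rcases hp with hp | hp | hp | hp
            · exact Or.inl ((h.mem_step hl1).mpr hp)
            all_goals
              right
              have : l = 0 ∨ l = 1 ∨ 4 ≤ l := by omega
              grind
        · rw [h1]; grind
      rcases h.right.split.2 a hF with rfl | e
      · exact e1 h.b_mem
      · exact e1 (e ▸ h.y_mem)
    obtain rfl : s = 4 := by omega
    obtain ⟨h14, h15⟩ := h.right_one (by omega)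
    simp only [Nat.reduceAdd] at h14 h15
    have q1 : ∀ v ∈ comp f 2 b, v ∈ [b, f 4 b, f 2 a] := by simpa using h15
    have q2 : ∀ v ∉ comp f 2 b, v ∈ [a, c, a1, c1, a2, c2] := by simpa using hall
    have := h.card_eq q1 q2
    simp only [List.length_cons, List.length_nil] at this
    obtain rfl : w = 3 := by omega
    have hy0 := h.y_fixed (k := 0) (by omega) (by omega)
    have hy1 := h.y_fixed (k := 1) (by omega) (by omega)
    have hy2 := h.y_fixed (k := 2) (by omega) (by omega)
    have hb3 := h.right.fixed 3 (by omega)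
    have hx4 := h.x_fixed (k := 4) (by omega) (by omega)
    have f1 := hfix a e1 4 le_rfl
    have f2 := hfix c e2 4 le_rfl
    have f3 := hfix a1 e3 4 le_rfl
    have f4 := hfix c1 e4 4 le_rfl
    have f5 := hfix a2 e5 4 le_rfl
    have f6 := hfix c2 e6 4 le_rfl
    have j1 := h.rev h14
    have j2 := h.rev (rfl : f 4 b = f 4 b)
    refine ⟨Core.B, by simp [Core.listed], le_rfl, _, vertexNumbering_of_list (b := b) h.act
      [c2, c1, c, a2, a1, a, f 2 a, f 4 b, b] rfl ?_ _ Core.full_B ?_ ?_, rfl⟩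
    · intro p
      exact h.cover_list q1 q2 (by simp) (by simp) p
    · simp only [List.forall_mem_cons, List.not_mem_nil, false_imp_iff, implies_true, and_true,
        List.getD_cons_succ, List.getD_cons_zero]
      and_intros <;> first | rfl | assumption | trivial
    · intro l hl k hk hno
      replace hk : k < 9 := hk
      interval_cases l <;> interval_cases k <;> first
        | exact absurd hno (by decide)
        | (simp only [List.getD_cons_succ, List.getD_cons_zero]; assumption)
  · have hs4 : s ≠ 4 := by
      rintro rfl
      have ht : ∀ k, 2 < k → k < 4 → Twice f k (comp f 2 b) := fun k hk hks => by
        obtain rfl : k = 3 := by omega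
        refine twice_of_left h (fun v hv hF => ?_) (hN 3 (by omega) hks)
        have l1 : Link f {3}ᶜ a a1 := h2 ▸ Link.step_ne (by omega)
        have l2 : Link f {3}ᶜ a1 a2 := h5 ▸ Link.step_ne (by omega)
        have l3 : Link f {3}ᶜ c2 c1 := i6 ▸ Link.step_ne (by omega)
        have l4 : Link f {3}ᶜ c1 c := i3 ▸ Link.step_ne (by omega)
        -- one of the rungs is doubled, so that all rungs are linked without the label `3`
        have l5 : Link f {3}ᶜ a2 c2 := by
          rcases h12 with h12 | h12
          · rcases h13 with h13 | h13
            · exact absurd ⟨h12, h13⟩ hB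
            · exact h13.2 ▸ Link.step_ne (by omega)
          · exact h12 ▸ Link.step_ne (by omega)
        have l6 := (l2.trans l5).trans l3
        have l7 := (l1.trans l6).trans l4
        have l8 := h.act.symm l5
        have l9 := h.act.symm l6
        have l10 := h.act.symm l7
        have := hall v hv
        unfold Fr at hF
        grind
      have := h.le_card_Ioo (m := 2) (by omega) ht
      omega
    obtain rfl : s = 3 := by omega
    obtain ⟨h13', h14⟩ := h.right_zero
    simp only [Nat.reduceAdd] at h13'
    have q1 : ∀ v ∈ comp f 2 b, v ∈ [b, f 2 a] := by simpa using h14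
    have q2 : ∀ v ∉ comp f 2 b, v ∈ [a, c, a1, c1, a2, c2] := by simpa using hall
    have := h.card_eq q1 q2
    simp only [List.length_cons, List.length_nil] at this
    obtain rfl : w = 3 := by omega
    have j1 := h.rev h13'
    rcases h12 with ⟨k1, k2⟩ | k1
    · rcases h13 with h13 | ⟨k3, k4⟩
      · exact absurd ⟨⟨k1, k2⟩, h13⟩ hB
      · have j2 := h.rev k3
        have j3 := h.rev k4
        refine ⟨Core.H2, by simp [Core.listed], le_rfl, _, vertexNumbering_of_list (b := b) h.act
          [c2, c1, c, a2, a1, a, f 2 a, b] rfl ?_ _ Core.full_H2 ?_ ?_, rfl⟩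
        · intro p
          exact h.cover_list q1 q2 (by simp) (by simp) p
        · simp only [List.forall_mem_cons, List.not_mem_nil, false_imp_iff, implies_true, and_true,
            List.getD_cons_succ, List.getD_cons_zero]
          and_intros <;> first | rfl | assumption | trivial
        · intro l hl k hk hno
          replace hk : k < 8 := hk
          interval_cases l <;> interval_cases k <;> first
            | exact absurd hno (by decide)
            | (simp only [List.getD_cons_succ, List.getD_cons_zero]; assumption)
    · have j4 := h.rev k1
      rcases h13 with ⟨k3, k4, k5, k6⟩ | ⟨k3, k4⟩
      · refine ⟨Core.H1, by simp [Core.listed], le_rfl, _, vertexNumbering_of_list (b := b) h.act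
          [c2, c1, c, a2, a1, a, f 2 a, b] rfl ?_ _ Core.full_H1 ?_ ?_, rfl⟩
        · intro p
          exact h.cover_list q1 q2 (by simp) (by simp) p
        · simp only [List.forall_mem_cons, List.not_mem_nil, false_imp_iff, implies_true, and_true,
            List.getD_cons_succ, List.getD_cons_zero]
          and_intros <;> first | rfl | assumption | trivial
        · intro l hl k hk hno
          replace hk : k < 8 := hk
          interval_cases l <;> interval_cases k <;> first
            | exact absurd hno (by decide)
            | (simp only [List.getD_cons_succ, List.getD_cons_zero]; assumption)
      · have j2 := h.rev k3
        have j3 := h.rev k4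
        refine ⟨Core.X3, by simp [Core.listed], le_rfl, _, vertexNumbering_of_list (b := b) h.act
          [c2, c1, c, a2, a1, a, f 2 a, b] rfl ?_ _ Core.full_X3 ?_ ?_, rfl⟩
        · intro p
          exact h.cover_list q1 q2 (by simp) (by simp) p
        · simp only [List.forall_mem_cons, List.not_mem_nil, false_imp_iff, implies_true, and_true,
            List.getD_cons_succ, List.getD_cons_zero]
          and_intros <;> first | rfl | assumption | trivial
        · intro l hl k hk hno
          replace hk : k < 8 := hk
          interval_cases l <;> interval_cases k <;> first
            | exact absurd hno (by decide)
            | (simp only [List.getD_cons_succ, List.getD_cons_zero]; assumption)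

end Cut

end Mixed

/-! ### Graphs without single fracture edges other than the last one -/

section NoSplit

variable {V : Type*} {f : ℕ → V → V} {s w : ℕ} {b : V}

lemma not_nonSplit_of {r m : ℕ} (hf : IsStringAction f r) (p : V)
    (h : ∀ u, Fr f m u → u = p ∨ u = f m p) : ¬ NonSplit f m := by
  rintro ⟨u, v, hu, hv, h1, h2⟩
  exact not_twice hf (S := Set.univ) p (fun u _ => h u)
    ⟨u, trivial, v, trivial, hu, hv, h1, h2⟩

/-- All vertices other than `b` are reached from its neighbour by the labels less than `s`. -/
lemma RightTrivial.induction (hf : IsStringGraph f (s + 1)) (hb : RightTrivial f s b)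
    {P : V → Prop} (h0 : P (f s b)) (hP : ∀ p, P p → ∀ k < s, P (f k p)) {v : V} (hv : v ≠ b) :
    P v := by
  have hs := hf.toIsStringAction
  rcases hb.split.cover hf v with h | h
  · refine absurd (h.closed (P := fun v => v = b) (fun p hp k hk => ?_) rfl) hv
    rw [hp]
    exact hb.fixed k hk
  · refine h.closed (fun p hp k (hk : k ≠ s) => ?_) h0
    by_cases hks : k < s
    · exact hP p hp k hks
    · rwa [hs.triv k p (by omega)]

lemma listed_of_no_split_zero [Finite V] (hf : IsStringGraph f 1) (hb : RightTrivial f 0 b)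
    (hc : Nat.card V = 2 + w) : Listed f 1 b w := by
  have hs := hf.toIsStringAction
  have hall : ∀ v, v ∈ [f 0 b, b] := fun v => by
    by_cases hv : v = b
    · simp [hv]
    · exact hb.induction hf (P := fun v => v ∈ [f 0 b, b]) (by simp) (fun p hp k hk => by omega) hv
  have h1 := ncard_le_length (S := Set.univ) [f 0 b, b] (fun v _ => hall v)
  rw [Set.ncard_univ] at h1
  simp only [List.length_cons, List.length_nil] at h1
  obtain rfl : w = 0 := by omega
  refine ⟨Core.S, rfl, le_rfl, _, vertexNumbering_of_list (b := b) hs [f 0 b, b] rfl hall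
    [(0, 0, 1)] (fun l x y => ?_) ?_ ?_, rfl⟩
  · simp only [Core.full, Core.S, List.mem_cons, Prod.mk.injEq, List.not_mem_nil, or_false,
      false_or]
    omega
  · simp [hs.invol]
  · intro l hl k hk hno
    replace hk : k < 2 := hk
    interval_cases l; interval_cases k
    · exact absurd hno (by decide)
    · exact absurd hno (by decide)

lemma no_split_one (hf : IsStringGraph f 2) (hb : RightTrivial f 1 b) : ¬ NonSplit f 0 := by
  have hs := hf.toIsStringAction
  have inv := hs.invol
  have hb0 := hb.fixed 0 (by omega)
  have hne := hb.ne
  generalize hy : f 1 b = y at *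
  obtain ⟨p, hp⟩ : ∃ p, f 0 y = p := ⟨_, rfl⟩
  have i1 := inv 1 b
  have i2 := inv 0 y
  have hp1 : f 1 p = p ∨ p = y := by
    by_contra hne'
    have hF : Fr f 1 p := fun h => by
      have := h.closed (P := fun v => v = y ∨ v = p) (fun q hq k (hk : k ≠ 1) => by
        have := hs.triv k q
        have : k = 0 ∨ 2 ≤ k := by omega
        grind) (Or.inr rfl)
      have := inv 1 p
      grind
    have := hb.split.2 p hF
    grind
  refine not_nonSplit_of hs y fun u hF => ?_
  have hn := hF.ne
  by_cases hu : u = b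
  · grind
  rw [hp]
  exact hb.induction hf (P := fun v => v = y ∨ v = p) (by grind) (fun q hq k hk => by
    obtain rfl : k = 0 := by omega
    grind) hu

/-- With three labels, the first two of which have several fracture edges, there is a removable leaf:
the labels `0` and `1` generate an alternating path that starts at the neighbour of `b`, and this path
has at most six vertices. -/
lemma no_split_two [Finite V] (hf : IsStringGraph f 3) (hb : RightTrivial f 2 b)
    (hc : Nat.card V ≤ 7) (h0 : NonSplit f 0) (h1 : NonSplit f 1)
    (hirr : ∀ z ≠ b, ∀ m, NonSplit f m → (∀ k, k ≠ m → f k z = z) → f m z = z) : False := by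
  have hs := hf.toIsStringAction
  have inv := hs.invol
  have htriv : ∀ k v, 3 ≤ k → f k v = v := fun k v hk => hs.triv k v hk
  have hb0 := hb.fixed 0 (by omega)
  have hb1 := hb.fixed 1 (by omega)
  have hne := hb.ne
  have hy0 : f 0 (f 2 b) = f 2 b := (hb.split.symm hs).fixed hs (by omega)
  have hind : ∀ {P : V → Prop}, P (f 2 b) → (∀ p, P p → P (f 0 p) ∧ P (f 1 p)) →
      ∀ {v}, v ≠ b → P v := fun {P} h0 hP {v} hv => hb.induction hf h0 (fun p hp k hk => by
    rcases (show k = 0 ∨ k = 1 by omega) with rfl | rfl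
    exacts [(hP p hp).1, (hP p hp).2]) hv
  obtain ⟨u, v, hFu, hFv, huv, huv'⟩ := h0
  have hu := hFu.ne
  have hv := hFv.ne
  have hub : u ≠ b := by grind
  have hvb : v ≠ b := by grind
  generalize hy : f 2 b = y at *
  have i0 := inv 2 b
  have c02 : ∀ v, f 0 (f 2 v) = f 2 (f 0 v) := fun v => hs.comm 0 2 v le_rfl
  obtain ⟨d1, e1⟩ : ∃ d, f 1 y = d := ⟨_, rfl⟩
  obtain ⟨d2, e2⟩ : ∃ d, f 0 d1 = d := ⟨_, rfl⟩
  obtain ⟨d3, e3⟩ : ∃ d, f 1 d2 = d := ⟨_, rfl⟩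
  obtain ⟨d4, e4⟩ : ∃ d, f 0 d3 = d := ⟨_, rfl⟩
  obtain ⟨d5, e5⟩ : ∃ d, f 1 d4 = d := ⟨_, rfl⟩
  have i1 := inv 1 y
  have i2 := inv 0 d1
  have i3 := inv 1 d2
  have i4 := inv 0 d3
  have i5 := inv 1 d4
  have n1 : d1 ≠ y := fun e => by
    have := hind (P := fun v => v = y) rfl (by grind) hub
    grind
  have n2 : d2 ≠ d1 := fun e => by
    have := hind (P := fun v => v = y ∨ v = d1) (Or.inl rfl) (by grind) hub
    grind
  have n3 : d3 ≠ d2 := fun e => by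
    have a1 := hind (P := fun v => v = y ∨ v = d1 ∨ v = d2) (Or.inl rfl) (by grind) hub
    have a2 := hind (P := fun v => v = y ∨ v = d1 ∨ v = d2) (Or.inl rfl) (by grind) hvb
    grind
  have n4 : d4 ≠ d3 := fun e => by
    have a1 := hind (P := fun v => v = y ∨ v = d1 ∨ v = d2 ∨ v = d3) (Or.inl rfl) (by grind) hub
    have a2 := hind (P := fun v => v = y ∨ v = d1 ∨ v = d2 ∨ v = d3) (Or.inl rfl) (by grind) hvb
    grind
  have hl : [b, y, d1, d2, d3, d4].Nodup := by
    simp only [List.nodup_cons, List.mem_cons, List.not_mem_nil, or_false, not_or,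
      not_false_eq_true, List.nodup_nil, and_true]
    grind (splits := 30)
  have hl' := hl
  simp only [List.nodup_cons, List.mem_cons, List.not_mem_nil, or_false, not_or,
    not_false_eq_true, List.nodup_nil, and_true] at hl'
  by_cases n5 : d5 = d4
  · have hall : ∀ v, v = b ∨ v = y ∨ v = d1 ∨ v = d2 ∨ v = d3 ∨ v = d4 := fun v => by
      by_cases hvb : v = b
      · exact Or.inl hvb
      · exact Or.inr (hind (P := fun v => v = y ∨ v = d1 ∨ v = d2 ∨ v = d3 ∨ v = d4)
          (Or.inl rfl) (by grind) hvb)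
    have hF1 : Fr f 0 d1 := by
      have a1 := hall u
      have a2 := hall v
      have a3 := hFu.symm hs
      have a4 := hFv.symm hs
      grind
    have hF3 : Fr f 0 d3 := by
      have a1 := hall u
      have a2 := hall v
      have a3 := hFu.symm hs
      have a4 := hFv.symm hs
      grind
    have g1 := hF3.ne_label (j := 2) (by omega)
    have g2 : f 2 d4 ≠ d4 := fun e => by
      have := hirr d4 (by grind) 0 ⟨u, v, hFu, hFv, huv, huv'⟩ (fun k hk => by
        have := htriv k d4
        have : k = 1 ∨ k = 2 ∨ 3 ≤ k := by omega
        grind)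
      grind
    have a1 := hall (f 2 d4)
    have a2 := inv 2 d4
    have a3 := c02 d4
    have a4 := inv 2 d3
    have g3 : f 2 d4 = d1 := by
      have g4 : f 2 d4 ≠ d2 := fun e => by
        have e' : f 2 d3 = d1 := by grind
        have l1 : Link f {0}ᶜ d3 d1 := e' ▸ Link.step_ne (by omega)
        have l2 : Link f {0}ᶜ d2 d3 := e3 ▸ Link.step_ne (by omega)
        apply hF1
        rw [e2]
        exact hs.symm (l2.trans l1)
      clear hall hind
      grind
    have g5 : f 2 d2 = d3 := by grind
    refine not_nonSplit_of hs y (fun z hz => ?_) h1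
    have := hall z
    have := hz.ne
    have := hz.ne_label (j := 2) (by omega)
    have := inv 2 d2
    grind
  · have n6 : [d5, b, y, d1, d2, d3, d4].Nodup := by
      rw [List.nodup_cons]
      refine ⟨?_, hl⟩
      simp only [List.mem_cons, List.not_mem_nil, or_false, not_or]
      grind
    have hall : ∀ v, v ∈ [d5, b, y, d1, d2, d3, d4] := fun v =>
      mem_of_ncard_le (S := Set.univ) n6 (fun _ _ => trivial)
        (by rw [Set.ncard_univ]; simpa using hc) trivial
    simp only [List.mem_cons, List.not_mem_nil, or_false] at hall
    have g0 : f 0 d5 = d5 := by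
      have := hall (f 0 d5)
      have := inv 0 d5
      grind
    have g2 : f 2 d5 = d5 := by
      have := hall (f 2 d5)
      have := inv 2 d5
      have := c02 d5
      grind
    have := hirr d5 (by grind) 1 h1 (fun k hk => by
      have := htriv k d5
      have : k = 0 ∨ k = 2 ∨ 3 ≤ k := by omega
      grind)
    grind

/-- With four labels, three of which have several fracture edges, there is a removable leaf. -/
lemma no_split_three [Finite V] (hf : IsStringGraph f 4) (hb : RightTrivial f 3 b)
    (hc : Nat.card V = 8) (h0 : NonSplit f 0) (h1 : NonSplit f 1) (h2 : NonSplit f 2)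
    (hirr : ∀ z ≠ b, ∀ m, NonSplit f m → (∀ k, k ≠ m → f k z = z) → f m z = z) : False := by
  have hs := hf.toIsStringAction
  have inv := hs.invol
  have htriv : ∀ k v, 4 ≤ k → f k v = v := fun k v hk => hs.triv k v hk
  have hb0 := hb.fixed 0 (by omega)
  have hb1 := hb.fixed 1 (by omega)
  have hb2 := hb.fixed 2 (by omega)
  have hne := hb.ne
  have hy0 : f 0 (f 3 b) = f 3 b := (hb.split.symm hs).fixed hs (by omega)
  have hy1 : f 1 (f 3 b) = f 3 b := (hb.split.symm hs).fixed hs (by omega)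
  have hind : ∀ {P : V → Prop}, P (f 3 b) → (∀ p, P p → P (f 0 p) ∧ P (f 1 p) ∧ P (f 2 p)) →
      ∀ {v}, v ≠ b → P v := fun {P} h0 hP {v} hv => hb.induction hf h0 (fun p hp k hk => by
    rcases (show k = 0 ∨ k = 1 ∨ k = 2 by omega) with rfl | rfl | rfl
    exacts [(hP p hp).1, (hP p hp).2.1, (hP p hp).2.2]) hv
  obtain ⟨u, v, hFu, hFv, huv, huv'⟩ := h0
  have hu := hFu.ne
  have hv := hFv.ne
  have hub : u ≠ b := by grind
  have hvb : v ≠ b := by grind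
  generalize hy : f 3 b = y at *
  have i0 := inv 3 b
  have c02 : ∀ v, f 0 (f 2 v) = f 2 (f 0 v) := fun v => hs.comm 0 2 v le_rfl
  have c03 : ∀ v, f 0 (f 3 v) = f 3 (f 0 v) := fun v => hs.comm 0 3 v (by omega)
  have c13 : ∀ v, f 1 (f 3 v) = f 3 (f 1 v) := fun v => hs.comm 1 3 v le_rfl
  obtain ⟨y1, e1⟩ : ∃ d, f 2 y = d := ⟨_, rfl⟩
  obtain ⟨d1, e2⟩ : ∃ d, f 1 y1 = d := ⟨_, rfl⟩
  have hy10 : f 0 y1 = y1 := by rw [← e1, c02, hy0]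
  have i1 := inv 2 y
  have i2 := inv 1 y1
  have n1 : y1 ≠ y := fun e => by
    have := hind (P := fun v => v = y) rfl (by grind) hub
    grind
  have n2 : d1 ≠ y1 := fun e => by
    have := hind (P := fun v => v = y ∨ v = y1) (Or.inl rfl) (by grind) hub
    grind
  have iu := inv 0 u
  have iv := inv 0 v
  have hl : [b, y, y1, u, f 0 u, v, f 0 v].Nodup := by
    simp only [List.nodup_cons, List.mem_cons, List.not_mem_nil, or_false, not_or,
      not_false_eq_true, List.nodup_nil, and_true]
    grind (splits := 30)
  obtain ⟨z, hz⟩ : ∃ z, z ∉ [b, y, y1, u, f 0 u, v, f 0 v] := by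
    by_contra hno
    push Not at hno
    have := ncard_le_length (S := Set.univ) _ (fun v _ => hno v)
    rw [Set.ncard_univ, hc] at this
    simp at this
  have hall : ∀ p, p ∈ z :: [b, y, y1, u, f 0 u, v, f 0 v] := fun p =>
    mem_of_ncard_le (S := Set.univ) (List.nodup_cons.mpr ⟨hz, hl⟩) (fun _ _ => trivial)
      (by rw [Set.ncard_univ]; simp [hc]) trivial
  simp only [List.nodup_cons, List.mem_cons, List.not_mem_nil, or_false, not_or,
    not_false_eq_true, List.nodup_nil, and_true] at hl hall hz
  have hz0 : f 0 z = z := by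
    have := hall (f 0 z)
    have := inv 0 z
    grind
  have hz2 : f 2 z = z := by
    have := hall (f 2 z)
    have := inv 2 z
    have := c02 z
    grind
  have hz3 : f 3 z = y1 := by
    have a1 := hall (f 3 z)
    have a2 := inv 3 z
    have a3 := c03 z
    by_contra hne'
    have hz3 : f 3 z = z := by grind
    have hz1 : f 1 z ≠ z := fun e => by
      have := hind (P := fun v => v ≠ z) (by grind) (fun p hp => by
        have := inv 0 p
        have := inv 1 p
        have := inv 2 p
        grind) (v := z) (by grind)
      exact this rfl
    exact hz1 (hirr z (by grind) 1 h1 (fun k hk => by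
      have := htriv k z
      have : k = 0 ∨ k = 2 ∨ k = 3 ∨ 4 ≤ k := by omega
      grind))
  have i3 := inv 3 z
  have n3 : d1 ≠ z := fun e => by
    have := hind (P := fun v => v = y ∨ v = y1 ∨ v = z) (Or.inl rfl) (by grind) hub
    grind
  have hd1 : f 0 d1 ≠ d1 := by
    have := hall d1
    grind
  obtain ⟨d2, e3⟩ : ∃ d, f 0 d1 = d := ⟨_, rfl⟩
  obtain ⟨d3, e4⟩ : ∃ d, f 3 d1 = d := ⟨_, rfl⟩
  obtain ⟨d4, e5⟩ : ∃ d, f 0 d3 = d := ⟨_, rfl⟩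
  have e6 : f 3 d2 = d4 := by rw [← e3, ← c03, e4, e5]
  have e7 : f 1 z = d3 := by rw [← e4, ← e2, ← c13]; grind
  have i4 := inv 0 d1
  have i5 := inv 3 d1
  have i6 := inv 0 d3
  have i7 := inv 3 d2
  have hF1 : Fr f 0 d1 := by
    have a1 := hall d1
    have a2 := hFu.symm hs
    have a3 := hFv.symm hs
    grind
  have n4 : d3 ≠ d1 := fun e => by
    have := inv 1 z
    grind
  have n5 : d3 ≠ d2 := fun e => hF1.ne_label (j := 3) (by omega) (by rw [e4, e3, e])
  have n6 : d4 ≠ d3 := by grind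
  -- all vertices that are moved by the label `0`
  have hD : ∀ p, f 0 p ≠ p → p = d1 ∨ p = d2 ∨ p = d3 ∨ p = d4 := fun p hp => by
    have a1 := hall p
    have a2 := hall d1
    have a3 := hall d3
    have a4 : d4 ≠ d1 := fun e => n5 (by grind)
    clear hind hirr c02 c03 c13 htriv hall inv
    grind (splits := 40)
  have hno : ∀ p q, (p = d1 ∨ p = d3) → (q = d2 ∨ q = d4) → ¬ Link f {0}ᶜ p q := by
    intro p q hp hq hl
    have l1 : Link f {0}ᶜ d1 d3 := e4 ▸ Link.step_ne (by omega)
    have l2 : Link f {0}ᶜ d2 d4 := e6 ▸ Link.step_ne (by omega)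
    have l3 : Link f {0}ᶜ d1 p := by rcases hp with rfl | rfl; exacts [Link.refl, l1]
    have l4 : Link f {0}ᶜ q d2 := by rcases hq with rfl | rfl; exacts [Link.refl, hs.symm l2]
    exact hF1 (e3 ▸ l3.trans (hl.trans l4))
  refine not_nonSplit_of hs y (fun p hp => ?_) h2
  by_contra hne'
  have hp2 := hp.ne
  have hp3 := hp.ne_label (j := 3) (by omega)
  have hp0 : f 0 p ≠ p := by
    have := hall p
    grind
  have hq0 : f 0 (f 2 p) ≠ f 2 p := by
    rw [c02]
    exact fun e => hp0 (hs.inj e)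
  have l1 : Link f {0}ᶜ p (f 2 p) := Link.step_ne (by omega)
  have l2 := hs.symm l1
  have a1 := hD p hp0
  have a2 := hD _ hq0
  have a3 := hno p (f 2 p)
  have a4 := hno (f 2 p) p
  grind

end NoSplit

/-! ### Graphs in which only the labels up to the cut act on the first side -/

section Pure

variable {V : Type*} {f : ℕ → V → V} {s i w : ℕ} {a b : V}

/-- A vertex which is fixed by all labels except `m`, where `m` has several fracture edges. -/
structure RemovableLeaf (f : ℕ → V → V) (m : ℕ) (z : V) : Prop where
  fixed : ∀ k, k ≠ m → f k z = z
  moved : f m z ≠ z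
  nonSplit : NonSplit f m

lemma nonSplit_of_sub {r : ℕ} {S : Set V} {u : V} {l m : ℕ} (hf : IsStringAction f r)
    (hS : IsPort f S s u l) (h : NonSplit (sub S s f) m) : NonSplit f m := by
  obtain ⟨p, q, hp, hq, h1, h2⟩ := h
  have hm : m < s := hp.lt (isStringAction_sub hf hS)
  obtain ⟨hp', hp⟩ := (fr_sub hf hS hm).mp hp
  obtain ⟨-, hq⟩ := (fr_sub hf hS hm).mp hq
  refine ⟨p, q, hp, hq, fun e => h1 (Subtype.ext e), fun e => h2 (Subtype.ext ?_)⟩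
  rw [sub_of_mem hm hp', e]

namespace RemovableLeaf

variable {r m : ℕ} {z : V}

lemma lt (hz : RemovableLeaf f m z) (hf : IsStringAction f r) : m < r := by
  obtain ⟨u, _, hu, _⟩ := hz.nonSplit
  exact hu.lt hf

lemma mem_compl (hz : RemovableLeaf f m z) (hf : IsStringAction f r) {k : ℕ} {v : V} (hv : v ≠ z)
    (hk : k ≠ m ∨ v ≠ f m z) : f k v ∈ ({z}ᶜ : Set V) := fun hk' => by
  have e : f k v = z := by simpa using hk'
  rw [hf.eq_iff] at e
  by_cases hkm : k = m
  · subst hkm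
    exact hk.elim (· rfl) (· e)
  · rw [hz.fixed k hkm] at e
    exact hv e

lemma isPort (hz : RemovableLeaf f m z) (hf : IsStringAction f r) :
    IsPort f ({z}ᶜ : Set V) r (f m z) m where
  mem := hz.moved
  port v hv k hk := by
    by_contra hne
    exact hk (hz.mem_compl hf hv (Or.inr hne))
  label k _ hk := by
    by_contra hne
    exact hk (hz.mem_compl hf hz.moved (Or.inl hne))
  triv v _ k hk _ := hf.triv k v hk

lemma isStringGraph_sub (hz : RemovableLeaf f m z) (hf : IsStringGraph f r) :
    IsStringGraph (sub ({z}ᶜ : Set V) r f) r := by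
  have hs := hf.toIsStringAction
  refine _root_.isStringGraph_sub hf (hz.isPort hs) fun k hk => ?_
  by_cases hkm : k = m
  · subst hkm
    obtain ⟨u, v, hu, hv, h1, h2⟩ := hz.nonSplit
    by_cases hh : u = z ∨ u = f k z
    · refine ⟨v, fun e => ?_, hz.mem_compl hs (fun e => ?_) (Or.inr fun e => ?_), hv⟩ <;>
        (have := hs.invol k z; grind)
    · push Not at hh
      exact ⟨u, hh.1, hz.mem_compl hs hh.1 (Or.inr hh.2), hu⟩
  · obtain ⟨v, hv⟩ := hf.fract k hk
    have hvz : v ≠ z := fun e => hv.ne (by rw [e]; exact hz.fixed k hkm)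
    exact ⟨v, hvz, hz.mem_compl hs hvz (Or.inl hkm), hv⟩

lemma rightTrivial_sub (hz : RemovableLeaf f m z) (hf : IsStringGraph f r) (hs : s < r)
    (hms : m ≠ s) (hb : Split f s b) (hbz : b ∈ ({z}ᶜ : Set V))
    (hfix : ∀ k, k ≠ s → f k b = b ∨ f k b = z) :
    RightTrivial (sub ({z}ᶜ : Set V) r f) s ⟨b, hbz⟩ := by
  have ha := hf.toIsStringAction
  have hm := hz.mem_compl ha hbz (Or.inl hms.symm)
  refine ⟨fun k hk => ?_, (fr_sub ha (hz.isPort ha) hs).mpr ⟨hm, hb.1⟩, fun v hv => ?_⟩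
  · rcases hfix k hk with e | e
    · by_cases hkr : k < r
      · exact Subtype.ext (by rw [sub_of_mem hkr (by rwa [e]), e])
      · exact (hz.isStringGraph_sub hf).triv _ _ (by omega)
    · exact sub_of_notMem (by simp [e])
  · obtain ⟨-, hF⟩ := (fr_sub ha (hz.isPort ha) hs).mp hv
    rcases hb.2 _ hF with e | e
    · exact Or.inl (Subtype.ext e)
    · exact Or.inr (Subtype.ext (by rw [sub_of_mem hs hm, e]))

end RemovableLeaf

lemma card_compl_singleton [Finite V] (z : V) : Nat.card ({z}ᶜ : Set V) + 1 = Nat.card V := by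
  rw [Nat.card_coe_set_eq, ← Set.ncard_add_ncard_compl ({z} : Set V), Set.ncard_singleton]
  omega

/-- The path `0, 1, 2, …` starts with a pendant edge. -/
lemma Listed.exists_first {r : ℕ} (hr : 0 < r) (hc : Nat.card V = r + 1)
    (h : Listed f r b 0) : ∃ z ≠ b, (∀ k, k ≠ 0 → f k z = z) ∧ f 0 z ≠ z ∧
      ∀ p, f 0 p ≠ p → p = z ∨ p = f 0 z := by
  obtain ⟨K, hK, hr', v, hv, hb⟩ := h
  have hsz := Core.size_eq hK hr'
  obtain rfl : K = Core.S := hK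
  have hfull : ∀ l x y, Core.S.full r l x y ↔ (l < r ∧ x = l ∧ y = x + 1) := by
    intro l x y
    simp only [Core.full, Core.S, false_or]
    omega
  have hinj : ∀ x y, x < r + 1 → y < r + 1 → v x = v y → x = y := fun x y hx hy e =>
    hv.inj (by omega) (by omega) (by omega) e
  have e0 : f 0 (v 0) = v 1 := hv.adj 0 0 1 ((hfull _ _ _).mpr (by omega))
  refine ⟨v 0, fun e => ?_, fun k hk => hv.fix k 0 (by omega) fun y => by
    rw [hfull, hfull]; omega, fun e => ?_, fun p hp => ?_⟩
  · have := hinj _ _ (by omega) (by omega) (e.trans hb.symm)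
    omega
  · have := hinj _ _ (by omega) (by omega) (e0.symm.trans e)
    omega
  · obtain ⟨x, hx, rfl⟩ := hv.surj p
    by_contra hne
    refine hp (hv.fix 0 x hx fun y => ?_)
    rw [hfull, hfull]
    have h0 : x ≠ 0 := fun e => hne (Or.inl (by rw [e]))
    have h1 : x ≠ 1 := fun e => hne (Or.inr (by rw [e, e0]))
    omega

/-- The path `1, 0, 1, 2, …` has a removable leaf, and the label `0` occurs only next to it. -/
lemma Listed.exists_removableLeaf {r : ℕ} (hf : IsStringAction f r) (hc : Nat.card V = r + 2)
    (h : Listed f r b 1) : ∃ z ≠ b, RemovableLeaf f 1 z ∧ f 1 z ≠ b ∧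
      (∀ k, k ≠ 0 → k ≠ 1 → f k (f 1 z) = f 1 z) ∧ f 0 (f 1 z) ≠ f 1 z ∧
      ∀ p, f 0 p ≠ p → p = f 1 z ∨ p = f 0 (f 1 z) := by
  obtain ⟨K, hK, hr, v, hv, hb⟩ := h
  have hsz := Core.size_eq hK hr
  obtain rfl : K = Core.T := hK
  have hr' : 3 ≤ r := hr
  have hfull : ∀ l x y, Core.T.full r l x y ↔
      (l = 1 ∧ x = 0 ∧ y = 1) ∨ (l < r ∧ x = l + 1 ∧ y = x + 1) := by
    intro l x y
    simp [Core.full, Core.T, Core.leaf, Core.S]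
  have hinj : ∀ x y, x < r + 2 → y < r + 2 → v x = v y → x = y := fun x y hx hy e =>
    hv.inj (by omega) (by omega) (by omega) e
  have fx : ∀ l, ∀ x < r + 2, (∀ y, ¬ Core.T.full r l x y ∧ ¬ Core.T.full r l y x) →
      f l (v x) = v x := fun l x hx => hv.fix l x (by omega)
  simp only [hfull] at fx
  have e0 : f 1 (v 0) = v 1 := hv.adj 1 0 1 ((hfull _ _ _).mpr (by omega))
  have e1 : f 0 (v 1) = v 2 := hv.adj 0 1 2 ((hfull _ _ _).mpr (by omega))
  have e2 : f 1 (v 2) = v 3 := hv.adj 1 2 3 ((hfull _ _ _).mpr (by omega))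
  have h0 : ∀ k, k ≠ 1 → f k (v 0) = v 0 := fun k hk => fx k 0 (by omega) (fun y => by omega)
  have hne : v 1 ≠ v 0 := fun e => by have := hinj 1 0 (by omega) (by omega) e; omega
  refine ⟨v 0, fun e => ?_, ⟨h0, by rwa [e0], v 0, v 2, fr_of_leaf h0 (by rwa [e0]), ?_,
    fun e => ?_, fun e => ?_⟩, fun e => ?_, fun k hk hk' => ?_, fun e => ?_, fun p hp => ?_⟩
  · have := hinj _ _ (by omega) (by omega) (e.trans hb.symm)
    omega
  · refine Cut.fr_of_closed (P := fun p => p = v 1 ∨ p = v 2) ?_ (Or.inr rfl) ?_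
    · rintro p (rfl | rfl) l hl
      · by_cases hl0 : l = 0
        · subst hl0; exact Or.inr e1
        · exact Or.inl (fx l 1 (by omega) (fun y => by omega))
      · by_cases hl0 : l = 0
        · subst hl0; exact Or.inl (by rw [← e1, hf.invol])
        · exact Or.inr (fx l 2 (by omega) (fun y => by omega))
    · rw [e2]
      rintro (e | e)
      · have := hinj _ _ (by omega) (by omega) e; omega
      · have := hinj _ _ (by omega) (by omega) e; omega
  · have := hinj _ _ (by omega) (by omega) e; omega
  · rw [e0] at e
    have := hinj _ _ (by omega) (by omega) e; omega
  · rw [e0] at e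
    have := hinj _ _ (by omega) (by omega) (e.trans hb.symm); omega
  · rw [e0]
    exact fx k 1 (by omega) (fun y => by omega)
  · rw [e0, e1] at e
    have := hinj _ _ (by omega) (by omega) e; omega
  · obtain ⟨x, hx, rfl⟩ := hv.surj p
    by_contra hne
    rw [e0, e1] at hne
    refine hp (fx 0 x (by omega) fun y => ?_)
    have h1 : x ≠ 1 := fun e => hne (Or.inl (by rw [e]))
    have h2 : x ≠ 2 := fun e => hne (Or.inr (by rw [e]))
    omega

namespace Side

variable {r : ℕ} {S : Set V}

lemma isPort (h : Side f r i a) (hL : ∀ v, Link f {i}ᶜ a v → ∀ k, i < k → f k v = v)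
    (hS : ∀ v, v ∈ S ↔ v = f i a ∨ Link f {i}ᶜ a v) : IsPort f S (i + 1) (f i a) (i - 1) where
  mem := (hS _).mpr (Or.inl rfl)
  port v hv k hk := by
    rcases (hS v).mp hv with e | hv
    · exact e
    refine absurd ((hS _).mpr ?_) hk
    by_cases hki : k = i
    · subst hki
      by_cases hva : v = a
      · exact Or.inl (by rw [hva])
      · have hF : ¬ Fr f k v := fun hF => (h.split.2 v hF).elim hva fun e =>
          h.split.1 (e ▸ hv)
        exact Or.inr (hv.trans (not_not.mp hF))
    · exact Or.inr (hv.trans (Link.step_ne hki))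
  label k hk hk' := by
    by_contra hki
    refine hk' ((hS _).mpr ?_)
    by_cases hki' : k = i
    · rw [hki', h.act.invol]; exact Or.inr Link.refl
    · exact Or.inl ((h.split.symm h.act).fixed h.act (by omega))
  triv v hv k hk hk' := by
    rcases (hS v).mp hv with rfl | hv
    · rcases (hS _).mp hk' with e | hl
      · exact e
      · refine absurd (hl.trans (h.act.symm (Link.step_ne (show k ≠ i by omega)))) h.split.1
    · exact hL v hv k hk

/-- The component of `a` together with the edge with label `i` forms a graph whose last label is a
pendant edge. -/
lemma graph_sub (h : Side f r i a) (hL : ∀ v, Link f {i}ᶜ a v → ∀ k, i < k → f k v = v)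
    (hS : ∀ v, v ∈ S ↔ v = f i a ∨ Link f {i}ᶜ a v) (hx : f i a ∈ S) :
    IsStringGraph (sub S (i + 1) f) (i + 1) ∧ RightTrivial (sub S (i + 1) f) i ⟨f i a, hx⟩ := by
  have hP := h.isPort hL hS
  have ha : a ∈ S := (hS a).mpr (Or.inr Link.refl)
  have hfr := h.split.symm h.act
  refine ⟨isStringGraph_sub h.graph hP fun k hk => ?_, fun k hk => ?_, ?_, ?_⟩
  · rcases (show k < i ∨ k = i by omega) with hk | rfl
    · obtain ⟨v, hv, hF⟩ := h.low k hk
      exact ⟨v, (hS v).mpr (Or.inr hv),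
        (hS _).mpr (Or.inr (hv.trans (Link.step_ne (by omega)))), hF⟩
    · exact ⟨a, ha, hx, h.split.1⟩
  · by_cases hk' : k < i
    · by_cases hm : f k (f i a) ∈ S
      · refine Subtype.ext ?_
        rw [sub_of_mem (by omega) hm]
        refine ((hS _).mp hm).resolve_right fun hl => ?_
        exact h.split.1 (hl.trans (h.act.symm (Link.step_ne (show k ≠ i by omega))))
      · exact sub_of_notMem hm
    · exact (isStringAction_sub h.act hP).triv _ _ (by omega)
  · exact (fr_sub h.act hP (by omega)).mpr ⟨by simpa [h.act.invol] using ha, hfr.1⟩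
  · intro v hv
    obtain ⟨-, hF⟩ := (fr_sub h.act hP (by omega)).mp hv
    rcases hfr.2 _ hF with e | e
    · exact Or.inl (Subtype.ext e)
    · refine Or.inr (Subtype.ext ?_)
      rw [sub_of_mem (by omega) (by simpa [h.act.invol] using ha), e]

lemma card_sub [Finite V] (h : Side f r i a)
    (hS : ∀ v, v ∈ S ↔ v = f i a ∨ Link f {i}ᶜ a v) :
    Nat.card S = {v | Link f {i}ᶜ a v}.ncard + 1 := by
  have : S = insert (f i a) {v | Link f {i}ᶜ a v} := Set.ext hS
  have hx : f i a ∉ {v | Link f {i}ᶜ a v} := h.split.1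
  rw [Nat.card_coe_set_eq, this, Set.ncard_insert_of_notMem hx]

/-- The vertices in the component of `a` have the same neighbours in the induced graph. -/
lemma coe_sub (h : Side f r i a) (hL : ∀ v, Link f {i}ᶜ a v → ∀ k, i < k → f k v = v)
    (hS : ∀ v, v ∈ S ↔ v = f i a ∨ Link f {i}ᶜ a v) {z : S} (hz : (z : V) ≠ f i a) (k : ℕ) :
    (sub S (i + 1) f k z : V) = f k z := by
  have hP := h.isPort hL hS
  have hmem : f k z ∈ S := by
    by_contra hk
    exact hz (hP.port z z.2 k hk)
  by_cases hki : k < i + 1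
  · exact sub_of_mem hki hmem
  · rw [hP.triv z z.2 k (by omega) hmem, (isStringAction_sub h.act hP).triv k z (by omega)]

lemma removableLeaf_of_sub (h : Side f r i a) {m : ℕ}
    (hL : ∀ v, Link f {i}ᶜ a v → ∀ k, i < k → f k v = v)
    (hS : ∀ v, v ∈ S ↔ v = f i a ∨ Link f {i}ᶜ a v) {z : S} (hz : (z : V) ≠ f i a)
    (hl : RemovableLeaf (sub S (i + 1) f) m z) : RemovableLeaf f m (z : V) where
  fixed k hk := by rw [← h.coe_sub hL hS hz, hl.fixed k hk]
  moved e := hl.moved (Subtype.ext (by rw [h.coe_sub hL hS hz, e]))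
  nonSplit := nonSplit_of_sub h.act (h.isPort hL hS) hl.nonSplit

end Side

namespace Cut

variable {S : Set V}

/-- The vertices of the first side of a cut and the other end of the edge at the cut. -/
lemma mem_left_iff (h : Cut f s i a b) (hS : ∀ v, v ∈ S ↔ v = f i a ∨ v ∉ comp f i b) (v : V) :
    v ∈ S ↔ v = f i a ∨ Link f {i}ᶜ a v := by
  rw [hS, h.notMem_iff]

lemma left_fixed (h : Cut f s i a b) (hL : ∀ v ∉ comp f i b, ∀ k, i < k → f k v = v) (v : V)
    (hv : Link f {i}ᶜ a v) : ∀ k, i < k → f k v = v := hL v (h.notMem_iff.mpr hv)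

/-- If the first side of a cut is a path, then the whole graph can be numbered by continuing this
path through a list of the vertices on the second side. -/
lemma vertexNumbering_append (h : Cut f s i a b) (hL : ∀ v ∉ comp f i b, ∀ k, i < k → f k v = v)
    (hS : ∀ v, v ∈ S ↔ v = f i a ∨ v ∉ comp f i b) {v : ℕ → S}
    (hv : VertexNumbering (sub S (i + 1) f) (i + 2) (Core.S.full (i + 1)) v)
    (hvx : (v (i + 1) : V) = f i a) (hinj : ∀ x < i + 1, (v x : V) ≠ f i a)
    (vs : List V) (hvs : ∀ p ∈ comp f i b, p ∈ f i a :: vs) (L : List (ℕ × ℕ × ℕ))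
    {E : ℕ → ℕ → ℕ → Prop} {n : ℕ} (hn : n = i + 2 + vs.length)
    (hmem : ∀ p ∈ vs, p ∈ comp f i b)
    (hE : ∀ l x y, E l x y ↔ (l < i + 1 ∧ x = l ∧ y = x + 1) ∨
      ∃ e ∈ L, l = i + e.1 ∧ x = i + 1 + e.2.1 ∧ y = i + 1 + e.2.2)
    (adj : ∀ e ∈ L, f (i + e.1) ((f i a :: vs).getD e.2.1 b) = (f i a :: vs).getD e.2.2 b)
    (fix : ∀ j ≤ s - i, ∀ x ≤ vs.length, (j = 0 → 0 < x) →
      (∀ e ∈ L, e.1 = j → e.2.1 ≠ x ∧ e.2.2 ≠ x) →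
      f (i + j) ((f i a :: vs).getD x b) = (f i a :: vs).getD x b) :
    VertexNumbering f n E (fun k => if k < i + 1 then (v k : V)
      else (f i a :: vs).getD (k - (i + 1)) b) := by
  have hP := h.side.isPort (h.left_fixed hL) (h.mem_left_iff hS)
  have hfull : ∀ l x y, Core.S.full (i + 1) l x y ↔ (l < i + 1 ∧ x = l ∧ y = x + 1) := by
    intro l x y
    simp only [Core.full, Core.S, false_or]
    omega
  have hst : ∀ k, ∀ x < i + 1, f k (v x) ∈ S := fun k x hx => by
    by_contra hk
    exact hinj x hx (hP.port _ (v x).2 k hk)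
  refine ⟨fun p => ?_, fun l x y hE' => ?_, fun l x hx hno => ?_⟩
  · by_cases hp : p ∈ comp f i b
    · obtain ⟨k, hk, e⟩ := List.getElem_of_mem (hvs p hp)
      refine ⟨k + (i + 1), by simp only [List.length_cons] at hk; omega, ?_⟩
      simp only [show ¬ k + (i + 1) < i + 1 by omega, if_false, Nat.add_sub_cancel]
      rw [List.getD_eq_getElem _ _ hk, e]
    · obtain ⟨k, hk, e⟩ := hv.surj ⟨p, (hS p).mpr (Or.inr hp)⟩
      have hk' : k < i + 1 := by
        by_contra hk'
        obtain rfl : k = i + 1 := by omega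
        replace hvx : p = f i a := by rw [e] at hvx; exact hvx
        exact hp (by rw [hvx]; exact h.ex_mem)
      exact ⟨k, by omega, by simp [hk', e]⟩
  · rcases (hE l x y).mp hE' with ⟨hl, rfl, rfl⟩ | ⟨e, he, rfl, rfl, rfl⟩
    · have e1 := hv.adj x x (x + 1) ((hfull _ _ _).mpr ⟨hl, rfl, rfl⟩)
      have e2 := sub_of_mem (s := i + 1) hl (hst x x hl)
      rw [e1] at e2
      simp only [hl, if_true]
      rw [← e2]
      by_cases hx : x + 1 < i + 1
      · simp only [hx, if_true]
      · obtain rfl : x = i := by omega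
        simp [hvx]
    · simp only [show ∀ k, ¬ i + 1 + k < i + 1 by omega, if_false, Nat.add_sub_cancel_left]
      exact adj e he
  · by_cases hx' : x < i + 1
    · simp only [hx', if_true]
      by_cases hl : l < i + 1
      · rw [← sub_of_mem hl (hst l x hx'), hv.fix l x (by omega) fun y => ?_]
        have := hno y
        rw [hE, hE] at this
        rw [hfull, hfull]
        exact ⟨fun h' => this.1 (Or.inl h'), fun h' => this.2 (Or.inl h')⟩
      · refine hL _ (((hS _).mp (v x).2).resolve_left (hinj x hx')) l (by omega)
    · simp only [hx', if_false]
      obtain ⟨k, rfl⟩ : ∃ k, x = i + 1 + k := ⟨x - (i + 1), by omega⟩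
      rw [Nat.add_sub_cancel_left]
      have hk : k < (f i a :: vs).length := by simp only [List.length_cons]; omega
      have hc : (f i a :: vs).getD k b ∈ comp f i b := by
        rw [List.getD_eq_getElem _ _ hk]
        rcases List.mem_cons.mp (List.getElem_mem hk) with e | e
        · rw [e]; exact h.ex_mem
        · exact hmem _ e
      by_cases hl : l < i
      · exact h.fixed_lt hc hl
      · by_cases hls : l ≤ s
        · obtain ⟨j, rfl⟩ : ∃ j, l = i + j := ⟨l - i, by omega⟩
          refine fix j (by omega) k (by omega) (fun hj => ?_) fun e he hej => ⟨fun hk => ?_, fun hk => ?_⟩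
          · by_contra hk0
            exact (hno i).2 ((hE _ _ _).mpr (Or.inl (by omega)))
          · exact (hno (i + 1 + e.2.2)).1 ((hE _ _ _).mpr
              (Or.inr ⟨e, he, by rw [hej], by rw [hk], rfl⟩))
          · exact (hno (i + 1 + e.2.1)).2 ((hE _ _ _).mpr
              (Or.inr ⟨e, he, by rw [hej], rfl, by rw [hk]⟩))
        · exact h.act.triv _ _ (by omega)

end Cut

end Pure

/-! ### The classification of the graphs whose last label is a pendant edge -/

namespace Core

lemma full_M2 (i l x y : ℕ) : (M2 i).full (i + 2 + 1) l x y ↔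
    (l < i + 1 ∧ x = l ∧ y = x + 1) ∨
      ∃ e ∈ [(1, 0, 1), (0, 1, 2), (2, 1, 2), (1, 2, 3), (2, 3, 4)],
        l = i + e.1 ∧ x = i + 1 + e.2.1 ∧ y = i + 1 + e.2.2 := by
  simp only [full, M2, List.mem_cons, List.not_mem_nil, or_false, exists_eq_or_imp,
    exists_eq_left]
  constructor
  · rintro ((h | ⟨h | h, h1, h2⟩) | ⟨h1, h2, h3, h4⟩)
    · by_cases hl : l < i + 1
      · left; omega
      · right; left; omega
    · right; right; left; omega
    · right; right; right; left; omega
    · by_cases hl : l = i + 1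
      · right; right; right; right; left; omega
      · right; right; right; right; right; omega
  · rintro (h | h | h | h | h | h)
    · left; left; omega
    · left; left; omega
    · left; right; omega
    · left; right; omega
    · right; omega
    · right; omega

lemma full_M1 (i l x y : ℕ) : (M1 i).full (i + 3 + 1) l x y ↔
    (l < i + 1 ∧ x = l ∧ y = x + 1) ∨
      ∃ e ∈ [(1, 0, 1), (2, 1, 2), (1, 2, 3), (2, 3, 4), (3, 4, 5)],
        l = i + e.1 ∧ x = i + 1 + e.2.1 ∧ y = i + 1 + e.2.2 := by
  simp only [full, M1, List.mem_cons, List.not_mem_nil, or_false, exists_eq_or_imp,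
    exists_eq_left]
  constructor
  · rintro ((h | h) | ⟨h1, h2, h3, h4⟩)
    · by_cases hl : l < i + 1
      · left; omega
      · right; left; omega
    · right; right; left; omega
    · by_cases hl : l = i + 1
      · right; right; right; left; omega
      · by_cases hl : l = i + 2
        · right; right; right; right; left; omega
        · right; right; right; right; right; omega
  · rintro (h | h | h | h | h | h)
    · left; left; omega
    · left; left; omega
    · left; right; omega
    · right; omega
    · right; omega
    · right; omega

end Core

section Classification

namespace Cut

variable {V : Type*} {f : ℕ → V → V} {s i w : ℕ} {a b : V}

/-- If the first side of a cut has few vertices, then it is a path: the other possibility would have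
a removable leaf. -/
lemma path_left [Finite V] (h : Cut f s i a b) (hw : w ≤ 3)
    (hirr : ∀ z ≠ b, ∀ m, ¬ RemovableLeaf f m z)
    (hL : ∀ v ∉ comp f i b, ∀ k, i < k → f k v = v) {S : Set V} (hx : f i a ∈ S)
    (hS : ∀ v, v ∈ S ↔ v = f i a ∨ v ∉ comp f i b) (hc : (comp f i b)ᶜ.ncard + 1 = i + w)
    (hT : ∀ w' ≤ 3, Nat.card S = i + 2 + w' →
      Listed (sub S (i + 1) f) (i + 1) ⟨f i a, hx⟩ w') :
    w = 2 ∧ ∃ v, VertexNumbering (sub S (i + 1) f) (i + 2) (Core.S.full (i + 1)) v ∧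
      (v (i + 1) : V) = f i a ∧ ∀ x < i + 1, (v x : V) ≠ f i a := by
  have hle := h.side.le_card
  rw [← h.compl_comp] at hle
  have hcS := h.side.card_sub (h.mem_left_iff hS)
  rw [← h.compl_comp] at hcS
  have hact := isStringAction_sub h.act (h.side.isPort (h.left_fixed hL) (h.mem_left_iff hS))
  rcases (show w = 2 ∨ w = 3 by omega) with rfl | rfl
  · obtain ⟨K, hK, hr, v, hv, hb⟩ := hT 0 (by omega) (by omega)
    have hsz := Core.size_eq hK hr
    obtain rfl : K = Core.S := hK
    rw [hsz] at hv hb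
    refine ⟨rfl, v, hv, congrArg Subtype.val hb, fun x hx' e => ?_⟩
    have := hv.inj (by omega) (by omega) (by omega) ((Subtype.ext e).trans hb.symm)
    omega
  · obtain ⟨z, hz, hl, -⟩ := (hT 1 (by omega) (by omega)).exists_removableLeaf hact (by omega)
    have hzx : (z : V) ≠ f i a := fun e => hz (Subtype.ext e)
    refine absurd (h.side.removableLeaf_of_sub (h.left_fixed hL) (h.mem_left_iff hS) hzx hl)
      (hirr _ (fun e => ?_) _)
    exact ((hS _).mp z.2).resolve_left hzx (e ▸ h.b_mem)

set_option maxHeartbeats 400000 in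
/-- If the labels above `i` do not act on the first side of the cut, then the first side is a smaller
graph of the same kind, and the second side is either a single edge or a path which extends the
first side to `M1` or `M2`. -/
lemma listed_of_pure [Finite V] (h : Cut f s i a b) (hc : Nat.card V = s + 2 + w) (hw : w ≤ 3)
    (hN : ∀ k, i < k → k < s → NonSplit f k)
    (hirr : ∀ z ≠ b, ∀ m, ¬ RemovableLeaf f m z)
    (hL : ∀ v ∉ comp f i b, ∀ k, i < k → f k v = v)
    (hT : ∀ (S : Set V) (hx : f i a ∈ S), (∀ v, v ∈ S ↔ v = f i a ∨ v ∉ comp f i b) →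
      ∀ w' ≤ 3, Nat.card S = i + 2 + w' → Listed (sub S (i + 1) f) (i + 1) ⟨f i a, hx⟩ w') :
    Listed f (s + 1) b w := by
  have hlt := h.lt
  have hadd := h.card_add_card
  have hle := h.side.le_card
  rw [← h.compl_comp] at hle
  have hg := h.right.card_nonSplit h.graph hc (Finset.Ioo i s) fun k hk =>
    hN k (Finset.mem_Ioo.mp hk).1 (Finset.mem_Ioo.mp hk).2
  rw [Nat.card_Ioo] at hg
  have ht : ∀ k, i < k → k < s → Twice f k (comp f i b) := fun k hk hks =>
    twice_of_left h (fun v hv hF => hF.ne (hL v hv k hk)) (hN k hk hks)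
  have hS : ∀ v, v ∈ {v | v = f i a ∨ v ∉ comp f i b} ↔ v = f i a ∨ v ∉ comp f i b :=
    fun v => Iff.rfl
  have hx : f i a ∈ {v | v = f i a ∨ v ∉ comp f i b} := Or.inl rfl
  have hbk := h.right.fixed
  rcases (show s = i + 1 ∨ s = i + 2 ∨ s = i + 3 ∨ s = i + 4 by omega) with
    rfl | rfl | rfl | rfl
  · obtain ⟨e, hall⟩ := h.right_zero
    have hS' : ∀ v, v ∈ ({b}ᶜ : Set V) ↔ v = f i a ∨ v ∉ comp f i b := by
      intro v
      have := h.x_ne_b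
      have := h.b_mem
      by_cases hv : v ∈ comp f i b
      · have := hall v hv
        simp only [Set.mem_compl_iff, Set.mem_singleton_iff]
        grind
      · simp only [Set.mem_compl_iff, Set.mem_singleton_iff, hv, not_false_eq_true, or_true,
          iff_true]
        rintro rfl
        exact hv h.b_mem
    have hcS := h.side.card_sub (h.mem_left_iff hS')
    rw [← h.compl_comp] at hcS
    have hR : (comp f i b).ncard = 2 := by
      refine le_antisymm (ncard_le_length [b, f i a] (by simpa using hall))
        (length_le_ncard (l := [b, f i a]) (by simpa using h.x_ne_b.symm)
          (by simp [h.b_mem, h.ex_mem]))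
    obtain ⟨K, hK, hr, v, hv, hb⟩ := hT _ h.x_ne_b hS' w hw (by omega)
    have hsz := Core.size_eq hK hr
    refine ⟨K, hK, by omega, _, hv.extend h.act hbk (fun v h1 h2 => ?_) (Core.wf_listed hK).1 hr
      (by omega) (by rw [hb, e]), ?_⟩
    · have hv : v ∉ comp f i b := fun hv => (hall v hv).elim h1 (by rwa [← e])
      exact hL v hv _ (by omega)
    · have := (Core.wf_listed hK).1.le
      have : ¬ K.size (i + 1 + 1) - 1 < K.size (i + 1) := by
        simp only [Core.size] at hsz ⊢; omega
      simp only [this, if_false]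
  · obtain ⟨p, u, h1, h2, h3, h4, hl, hall⟩ := h.right_one' (by omega) (ht _ (by omega) (by omega))
    have hR : (comp f i b).ncard = 5 := by
      refine le_antisymm (ncard_le_length [b, f (i + 2) b, p, u, f i a] (by simpa using hall))
        (length_le_ncard hl ?_)
      simp only [← h1, ← h2, List.forall_mem_cons, List.not_mem_nil, false_imp_iff, implies_true,
        and_true]
      refine ⟨h.b_mem, h.y_mem, ?_, ?_, h.ex_mem⟩ <;> simp [h.mem_step, h.b_mem]
    obtain ⟨rfl, v, hv, hvx, hinj⟩ := h.path_left hw hirr hL hx hS (by omega) (hT _ hx hS)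
    have j1 := h.rev h1
    have j2 := h.rev h2
    have j3 := h.rev h3
    have j4 := h.rev h4
    have j5 := h.rev (rfl : f (i + 2) b = f (i + 2) b)
    have g1 := hbk i (by omega)
    have g2 := hbk (i + 1) (by omega)
    have g3 := h.y_fixed (k := i) (by omega) (by omega)
    have g4 := h.x_fixed (k := i + 2) (by omega) (by omega)
    refine ⟨Core.M2 i, Or.inr ⟨i, Or.inr rfl⟩, le_rfl, _, h.vertexNumbering_append hL hS hv hvx hinj
      [u, p, f (i + 2) b, b] ?_ [(1, 0, 1), (0, 1, 2), (2, 1, 2), (1, 2, 3), (2, 3, 4)]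
      (by simp only [Core.size, Core.M2, List.length_cons, List.length_nil]; omega) ?_
      (Core.full_M2 i) ?_ ?_, ?_⟩
    · intro q hq
      have := hall q hq
      simp only [List.mem_cons, List.not_mem_nil, or_false]
      tauto
    · simp only [← h1, ← h2, List.forall_mem_cons, List.not_mem_nil, false_imp_iff, implies_true,
        and_true]
      refine ⟨?_, ?_, h.y_mem, h.b_mem⟩ <;> simp [h.mem_step, h.b_mem]
    · simp only [List.forall_mem_cons, List.not_mem_nil, false_imp_iff, implies_true, and_true,
        List.getD_cons_succ, List.getD_cons_zero]
      and_intros <;> first | rfl | assumption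
    · intro l hl k hk h0 hno
      replace hl : l ≤ 2 := by omega
      replace hk : k ≤ 4 := hk
      interval_cases l <;> interval_cases k <;> first
        | exact absurd hno (by decide)
        | exact absurd (h0 rfl) (by decide)
        | (simp only [List.getD_cons_succ, List.getD_cons_zero]; assumption)
    · rw [show (Core.M2 i).size (i + 2 + 1) - 1 = i + 1 + 4 by
        simp only [Core.size, Core.M2]; omega]
      rw [if_neg (by omega), Nat.add_sub_cancel_left]
      rfl
  · obtain ⟨p, u, q, h1, h2, h3, h4, h5, hl, hall⟩ := h.right_two' (by omega)
      (ht _ (by omega) (by omega)) (ht _ (by omega) (by omega))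
    have hmem : ∀ v ∈ [b, f (i + 3) b, p, u, q, f i a], v ∈ comp f i b := by
      simp only [← h1, ← h2, ← h3, List.forall_mem_cons, List.not_mem_nil, false_imp_iff,
        implies_true, and_true]
      refine ⟨h.b_mem, h.y_mem, ?_, ?_, ?_, h.ex_mem⟩ <;> simp [h.mem_step, h.b_mem]
    have hR : (comp f i b).ncard = 6 := 
      le_antisymm (ncard_le_length [b, f (i + 3) b, p, u, q, f i a] (by simpa using hall))
        (length_le_ncard hl hmem)
    obtain ⟨rfl, v, hv, hvx, hinj⟩ := h.path_left hw hirr hL hx hS (by omega) (hT _ hx hS)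
    have j1 := h.rev h1
    have j2 := h.rev h2
    have j3 := h.rev h3
    have j4 := h.rev h4
    have j5 := h.rev (rfl : f (i + 3) b = f (i + 3) b)
    have g1 := hbk i (by omega)
    have g2 := hbk (i + 1) (by omega)
    have g3 := hbk (i + 2) (by omega)
    have g4 := h.y_fixed (k := i) (by omega) (by omega)
    have g5 := h.y_fixed (k := i + 1) (by omega) (by omega)
    have g6 := h.x_fixed (k := i + 2) (by omega) (by omega)
    have g7 := h.x_fixed (k := i + 3) (by omega) (by omega)
    simp only [List.forall_mem_cons, List.not_mem_nil, false_imp_iff, implies_true,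
      and_true] at h5
    obtain ⟨⟨k1, k2⟩, ⟨k3, k4⟩, k5, k6⟩ := h5
    refine ⟨Core.M1 i, Or.inr ⟨i, Or.inl rfl⟩, le_rfl, _, h.vertexNumbering_append hL hS hv hvx hinj
      [q, u, p, f (i + 3) b, b] ?_ [(1, 0, 1), (2, 1, 2), (1, 2, 3), (2, 3, 4), (3, 4, 5)]
      (by simp only [Core.size, Core.M1, List.length_cons, List.length_nil]; omega)
      (fun v hv => hmem v ?_) (Core.full_M1 i) ?_ ?_, ?_⟩
    · intro q hq
      have := hall q hq
      simp only [List.mem_cons, List.not_mem_nil, or_false]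
      tauto
    · simp only [List.mem_cons, List.not_mem_nil, or_false] at hv ⊢
      tauto
    · simp only [List.forall_mem_cons, List.not_mem_nil, false_imp_iff, implies_true, and_true,
        List.getD_cons_succ, List.getD_cons_zero]
      and_intros <;> first | rfl | assumption
    · intro l hl k hk h0 hno
      replace hl : l ≤ 3 := by omega
      replace hk : k ≤ 5 := hk
      interval_cases l <;> interval_cases k <;> first
        | exact absurd hno (by decide)
        | exact absurd (h0 rfl) (by decide)
        | (simp only [List.getD_cons_succ, List.getD_cons_zero]; assumption)
    · rw [show (Core.M1 i).size (i + 3 + 1) - 1 = i + 1 + 5 by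
        simp only [Core.size, Core.M1]; omega]
      rw [if_neg (by omega), Nat.add_sub_cancel_left]
      rfl
  · exact (h.right_three (by omega) (ht _ (by omega) (by omega))
      (ht _ (by omega) (by omega))).elim

end Cut

variable {V : Type*} {f : ℕ → V → V} {s w : ℕ} {b : V}

/-- The step of the induction which removes a leaf. -/
lemma listed_of_removableLeaf [Finite V] (hf : IsStringGraph f (s + 1)) (hb : RightTrivial f s b)
    (hc : Nat.card V = s + 2 + w) (hw : w ≤ 3) {z : V} {m : ℕ} (hzb : z ≠ b)
    (hz : RemovableLeaf f m z)
    (hT : ∀ hb' : b ∈ ({z}ᶜ : Set V), IsStringGraph (sub {z}ᶜ (s + 1) f) (s + 1) →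
      RightTrivial (sub {z}ᶜ (s + 1) f) s ⟨b, hb'⟩ →
      ∀ w' ≤ 3, Nat.card ({z}ᶜ : Set V) = s + 2 + w' →
      Listed (sub {z}ᶜ (s + 1) f) (s + 1) ⟨b, hb'⟩ w') :
    Listed f (s + 1) b w := by
  have hs := hf.toIsStringAction
  have hms : m ≠ s := fun e => hb.split.not_nonSplit hs (e ▸ hz.nonSplit)
  have hbz : b ∈ ({z}ᶜ : Set V) := Ne.symm hzb
  have hg := hz.isStringGraph_sub hf
  have hr := hz.rightTrivial_sub hf (by omega) hms hb.split hbz fun k hk => Or.inl (hb.fixed k hk)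
  have hcz := card_compl_singleton z
  have hmr := hz.lt hs
  obtain ⟨hfix, hmove, -⟩ := hz
  have : Nonempty ({z}ᶜ : Set V) := ⟨⟨b, hbz⟩⟩
  have hpos := hg.good_bound ∅ (by simp)
  simp only [Finset.card_empty] at hpos
  obtain ⟨w, rfl⟩ : ∃ w', w = w' + 1 := ⟨w - 1, by omega⟩
  obtain ⟨K, hK, hrm, v, hv, hvb⟩ := hT hbz hg hr w (by omega) (by omega)
  have hsz := Core.size_eq hK hrm
  have hwf := (Core.wf_listed hK).1
  obtain ⟨x, hx, hvx⟩ := hv.surj ⟨f m z, hmove⟩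
  -- the neighbour of the leaf is fixed by all labels commuting with `m`
  have hfixn : ∀ l, l + 2 ≤ m ∨ m + 2 ≤ l → f l (f m z) = f m z := fun l hl => by
    rw [hs.comm' (by omega : l + 2 ≤ m ∨ m + 2 ≤ l ∨ l = m), hfix l (by omega)]
  have hlab : ∀ l y, K.full (s + 1) l x y ∨ K.full (s + 1) l y x → l + 1 = m ∨ l = m + 1 := by
    intro l y hE
    have hb' : l < s + 1 ∧ y < K.size (s + 1) ∧ x ≠ y := by
      rcases hE with hE | hE
      · have := hwf.size hrm hE; tauto
      · have := hwf.size hrm hE; exact ⟨this.1, this.2.1, this.2.2.2.symm⟩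
    have hmv : sub ({z}ᶜ : Set V) (s + 1) f l (v x) = v y := by
      rcases hE with hE | hE
      · exact hv.adj _ _ _ hE
      · rw [hg.eq_iff]; exact (hv.adj _ _ _ hE).symm
    have hne : sub ({z}ᶜ : Set V) (s + 1) f l (v x) ≠ v x := fun e =>
      hb'.2.2 (hv.inj (by omega) hx hb'.2.1 (e.symm.trans hmv))
    by_contra hl
    by_cases hlm : l = m
    · subst hlm
      refine hne (sub_of_notMem ?_)
      rw [hvx]; simp [hs.invol]
    · have e := hfixn l (by omega)
      refine hne (Subtype.ext ?_)
      rw [hvx, sub_of_mem hb'.1 (by rw [e]; exact hmove), e]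
  have hxlt : x + 1 < K.size (s + 1) := by
    by_contra hx'
    have hx' : x = K.size (s + 1) - 1 := by omega
    rw [hx', hvb] at hvx
    have e : b = f m z := congrArg Subtype.val hvx
    have := hb.fixed m hms
    rw [e, hs.invol] at this
    exact hmove this.symm
  have hm2 : m + 2 ≤ s + 1 := by omega
  refine ⟨K.leaf m x, Core.leaf_mem_listed hK (by omega) hrm hxlt hlab, max_le hrm hm2, _,
    VertexNumbering.leaf hs hfix hmove hwf hrm hv (by omega) hx (by rw [hvx]), ?_⟩
  have : (K.leaf m x).size (s + 1) - 1 = K.size (s + 1) := by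
    have := hwf.le
    simp only [Core.size, Core.leaf]; omega
  rw [this, if_neg (by omega), hvb]

/-- The string graphs with `s + 1` labels and `s + 2 + w` vertices whose last label is a pendant
edge belong to the list. -/
theorem listed_of_rightTrivial.{u} (n : ℕ) : ∀ {V : Type u} [Finite V] {f : ℕ → V → V} {s w : ℕ}
    {b : V}, Nat.card V = n → IsStringGraph f (s + 1) → RightTrivial f s b →
    Nat.card V = s + 2 + w → w ≤ 3 → Listed f (s + 1) b w := by
  classical
  induction n using Nat.strong_induction_on with
  | _ n ih =>
  intro V _ f s w b hn hf hb hc hw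
  have hs := hf.toIsStringAction
  by_cases hirr : ∃ z ≠ b, ∃ m, RemovableLeaf f m z
  · obtain ⟨z, hzb, m, hz⟩ := hirr
    refine listed_of_removableLeaf hf hb hc hw hzb hz fun hb' hg hr w' hw' hc' => ?_
    refine ih _ ?_ rfl hg hr hc' hw'
    have := card_compl_singleton z
    omega
  push Not at hirr
  have hirr' : ∀ z ≠ b, ∀ m, NonSplit f m → (∀ k, k ≠ m → f k z = z) → f m z = z :=
    fun z hz m hm hfix => by_contra fun h => hirr z hz m ⟨hfix, h, hm⟩
  by_cases hsp : ∃ i < s, ∃ a, Split f i a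
  · -- the largest label below `s` with a single fracture edge
    obtain ⟨i, ⟨his, a, ha⟩, hmax⟩ : ∃ i, (i < s ∧ ∃ a, Split f i a) ∧
        ∀ k, i < k → k < s → ¬ ∃ a, Split f k a := by
      let P : ℕ → Prop := fun i => i < s ∧ ∃ a, Split f i a
      obtain ⟨i₀, hi₀, a₀, ha₀⟩ := hsp
      have h1 := Nat.findGreatest_spec (P := P) hi₀.le ⟨hi₀, a₀, ha₀⟩
      refine ⟨_, h1, fun k hk hks hex => ?_⟩
      exact Nat.findGreatest_is_greatest (P := P) hk hks.le ⟨hks, hex⟩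
    have hN : ∀ k, i < k → k < s → NonSplit f k := fun k hk hks =>
      (hf.split_or_nonSplit (by omega)).resolve_left (hmax k hk hks)
    obtain ⟨a, h⟩ : ∃ a, Cut f s i a b := by
      rcases ha.cover hf b with h | h
      · refine ⟨f i a, hf, hb, his, ha.symm hs, ?_⟩
        rw [hs.invol]; exact hs.symm h
      · exact ⟨a, hf, hb, his, ha, hs.symm h⟩
    by_cases hL : ∀ v ∉ comp f i b, ∀ k, i < k → f k v = v
    · refine h.listed_of_pure hc hw hN (fun z hz m => hirr z hz m) hL fun S hx hS w' hw' hc' => ?_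
      obtain ⟨h1, h2⟩ := h.side.graph_sub (h.left_fixed hL) (h.mem_left_iff hS) hx
      refine ih _ ?_ rfl h1 h2 hc' hw'
      rw [h.side.card_sub (h.mem_left_iff hS), ← h.compl_comp, ← hn, ← h.card_add_card]
      have := length_le_ncard (S := comp f i b) (l := [b, f i a])
        (by simpa using h.x_ne_b.symm) (by simp [h.b_mem, h.ex_mem])
      simp only [List.length_cons, List.length_nil] at this
      omega
    · push Not at hL
      obtain ⟨v, hv, k, hk, hkv⟩ := hL
      have hmove := h.side.move (h.notMem_iff.mp hv) hk hkv
      have hbd := h.side.bound (h.notMem_iff.mp hv) hk hkv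
      rw [← h.compl_comp] at hbd
      have hadd := h.card_add_card
      have h0 := h.le_card_right (M := ∅) (by simp)
      simp only [Finset.card_empty] at h0
      rcases (show i = 0 ∨ i = 1 ∨ i = 2 by omega) with rfl | rfl | rfl
      · refine h.listed_left_zero hc hw hN hmove fun z hz m hm hfix => ?_
        have hzb : z ≠ b := fun e => hz (e ▸ h.b_mem)
        by_contra hmz
        have hF := fr_of_leaf hfix hmz
        have hms := hF.lt hs
        by_cases hm' : m = s
        · subst hm'
          rcases hb.split.2 z hF with e | e
          · exact hzb e
          · exact hz (e ▸ h.y_mem)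
        · exact hmz (hirr' z hzb m (hN m (by omega) (by omega)) hfix)
      · exact h.listed_left_one hc hw hN hmove
      · exact h.listed_left_two hc hw hN hmove
  · have hN : ∀ k < s, NonSplit f k := fun k hk =>
      (hf.split_or_nonSplit (by omega)).resolve_left fun h => hsp ⟨k, hk, h⟩
    have hg := hb.card_nonSplit hf hc (Finset.range s) fun k hk => hN k (Finset.mem_range.mp hk)
    rw [Finset.card_range] at hg
    rcases (show s = 0 ∨ s = 1 ∨ s = 2 ∨ s = 3 by omega) with rfl | rfl | rfl | rfl
    · exact listed_of_no_split_zero hf hb (by omega)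
    · exact (no_split_one hf hb (hN 0 (by omega))).elim
    · exact (no_split_two hf hb (by omega) (hN 0 (by omega)) (hN 1 (by omega)) hirr').elim
    · exact (no_split_three hf hb (by omega) (hN 0 (by omega)) (hN 1 (by omega))
        (hN 2 (by omega)) hirr').elim

end Classification

/-! ### The end of the graph on the small side of a single fracture edge -/

section LeftEnd

variable {V : Type*} {f : ℕ → V → V} {r i w : ℕ} {a : V}

/-- The first label is a pendant edge, or it is followed by a pendant edge with the next label. -/
def LeftEnd (f : ℕ → V → V) : Prop :=
  (∃ b, RightTrivial f 0 b) ∨ ∃ z, RemovableLeaf f 1 z ∧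
    (∀ k, k ≠ 0 → k ≠ 1 → f k (f 1 z) = f 1 z) ∧ Split f 0 (f 1 z)

lemma link_dual_iff (hf : IsStringAction f r) (hi : i < r) {u v : V} :
    Link (dual r f) {r - 1 - i}ᶜ u v ↔ Link f {i}ᶜ u v := by
  constructor
  · intro h
    have := link_dual (K := {i}ᶜ) (fun k hk (hk' : r - 1 - k ≠ r - 1 - i) => by
      show k ≠ i; omega) hf.dual h
    rwa [dual_dual hf] at this
  · exact link_dual (fun k hk (hk' : r - 1 - k ≠ i) => by
      show k ≠ r - 1 - i; omega) hf

lemma fr_dual_iff (hf : IsStringAction f r) (hi : i < r) {v : V} :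
    Fr (dual r f) (r - 1 - i) v ↔ Fr f i v := by
  constructor
  · intro h
    have := fr_of_dual hf (by omega) h
    rwa [show r - 1 - (r - 1 - i) = i by omega] at this
  · intro h
    exact fr_dual hf (by omega) (by rwa [show r - 1 - (r - 1 - i) = i by omega])

lemma Split.dual_of_lt (hf : IsStringAction f r) (hi : i < r) (h : Split f i a) :
    Split (_root_.dual r f) (r - 1 - i) a :=
  Split.dual hf (by omega) (by rwa [show r - 1 - (r - 1 - i) = i by omega])

/-- If the label `0` has a fracture edge in the component of `a`, then so do all labels below `i`:
a label `k` without one would keep this component together, so that the labels below `k` would not act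
on it. -/
lemma Split.side (hf : IsStringGraph f r) (hi : i < r) (ha : Split f i a)
    (h : 0 < i → ∃ v, Link f {i}ᶜ a v ∧ Fr f 0 v) : Side f r i a := by
  have hs := hf.toIsStringAction
  refine ⟨hf, hi, ha, fun k hk => ?_⟩
  rcases Nat.eq_zero_or_pos k with rfl | hk0
  · exact h hk
  obtain ⟨v, hv, hF⟩ := h (by omega)
  by_contra hno
  push Not at hno
  have hl : Link f {k}ᶜ a v := hv.closed (P := fun v => Link f {i}ᶜ a v ∧ Link f {k}ᶜ a v)
    (fun p hp l hl => ⟨hp.1.trans (Link.step hl), by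
      by_cases hlk : l = k
      · subst hlk
        exact hp.2.trans (not_not.mp (hno p hp.1))
      · exact hp.2.trans (Link.step_ne hlk)⟩) ⟨Link.refl, Link.refl⟩ |>.2
  exact hF.ne ((hs.factor_fixed (fun j hj => ha.fixed hs (by omega)) hl).2 0 hk0)

/-- The variant of `Split.side` for the labels above `i`. -/
lemma Split.side_dual (hf : IsStringGraph f r) (hi : i < r) (ha : Split f i a)
    (h : i < r - 1 → ∃ v, Link f {i}ᶜ a v ∧ Fr f (r - 1) v) :
    Side (_root_.dual r f) r (r - 1 - i) a := by
  have hs := hf.toIsStringAction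
  refine Split.side hf.dual (by omega) (ha.dual_of_lt hs hi) fun h0 => ?_
  obtain ⟨v, hv, hF⟩ := h (by omega)
  refine ⟨v, (link_dual_iff hs hi).mpr hv, ?_⟩
  have := (fr_dual_iff hs (show r - 1 < r by omega)).mpr hF
  rwa [Nat.sub_self] at this

lemma Side.mul_le_card [Finite V] (h : Side f r i a) (h' : Side (dual r f) r (r - 1 - i) a) :
    (i + 1) * (r - i) ≤ {v | Link f {i}ᶜ a v}.ncard := by
  classical
  have hi := h.lt
  obtain ⟨S, h1, h2, h3⟩ := h.exists_separated
  obtain ⟨T, h4, h5, h6⟩ := h'.exists_separated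
  have := mul_card_le h.act (fun v => Iff.rfl) (M := Finset.range i)
    (N := (Finset.range r).filter (i < ·)) (fun m hm => Finset.mem_range.mp hm)
    (fun m hm => (Finset.mem_filter.mp hm).2) h1
    (fun v hv => (link_dual_iff h.act hi).mp (h4 hv)) h3 (fun p hp q hq hpq => by
      obtain ⟨m, hm, hl⟩ := h6 p hp q hq hpq
      have hm := Finset.mem_range.mp hm
      refine ⟨r - 1 - m, by simp; omega, fun h' => hl ?_⟩
      rw [← link_dual_iff h.act (by omega)] at h'
      rwa [show r - 1 - (r - 1 - m) = m by omega] at h')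
  refine le_trans (Nat.mul_le_mul h2 ?_) this
  omega

lemma Split.card_add_card [Finite V] (hf : IsStringGraph f r) (ha : Split f i a) :
    {v | Link f {i}ᶜ a v}.ncard + {v | Link f {i}ᶜ (f i a) v}.ncard = Nat.card V := by
  rw [← Set.ncard_add_ncard_compl {v | Link f {i}ᶜ a v}]
  congr 2
  ext v
  constructor
  · intro hv hv'
    exact ha.1 (Link.trans hv' (hf.symm hv))
  · exact fun hv => (ha.cover hf v).resolve_left hv

/-- If the component of `a` has at most one vertex more than necessary, then it is a path, possibly
with a pendant edge. -/
lemma Side.leftEnd [Finite V] (h : Side f r i a) (hr : 2 ≤ r)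
    (hc : {v | Link f {i}ᶜ a v}.ncard ≤ i + 2)
    (hup : i + 1 < r → ∃ v, Link f {i}ᶜ (f i a) v ∧ Fr f (i + 1) v)
    (hno : 0 < i → ∀ v, Link f {i}ᶜ (f i a) v → ¬ Fr f 0 v) : LeftEnd f := by
  have hs := h.act
  have hle := h.le_card
  have hF0 : ∀ v, Fr f 0 v → v = f i a ∨ Link f {i}ᶜ a v := fun v hv => by
    rcases Nat.eq_zero_or_pos i with rfl | hi
    · exact (h.split.2 v hv).symm.imp id fun e => by rw [e]; exact Link.refl
    · exact Or.inr ((h.split.cover h.graph v).resolve_right fun hl => hno hi v hl hv)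
  by_cases hL : ∀ v, Link f {i}ᶜ a v → ∀ k, i < k → f k v = v
  · obtain ⟨S, hS⟩ : ∃ S : Set V, ∀ v, v ∈ S ↔ v = f i a ∨ Link f {i}ᶜ a v :=
      ⟨{v | v = f i a ∨ Link f {i}ᶜ a v}, fun v => Iff.rfl⟩
    have hx : f i a ∈ S := (hS _).mpr (Or.inl rfl)
    obtain ⟨hg, hR⟩ := h.graph_sub hL hS hx
    have hcS := h.card_sub hS
    have hsub := fun z hz => h.coe_sub hL hS (z := z) hz
    obtain ⟨v₀, hv₀⟩ := h.graph.fract 0 (by omega)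
    have hmoved : ∀ p : S, f 0 p ≠ p → f 0 p ∈ S → sub S (i + 1) f 0 p ≠ p := fun p hp hp' e => by
      have := sub_of_mem (Nat.succ_pos i) hp'
      rw [e] at this
      exact hp this.symm
    have hmem : ∀ p, Fr f 0 p → ∃ hp : p ∈ S, sub S (i + 1) f 0 ⟨p, hp⟩ ≠ ⟨p, hp⟩ := fun p hp => by
      have h1 := (hS p).mpr (hF0 p hp)
      exact ⟨h1, hmoved ⟨p, h1⟩ hp.ne ((hS _).mpr (hF0 _ (hp.symm hs)))⟩
    -- the split label `0`, in terms of the induced graph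
    have hsplit : ∀ z : S, (z : V) ≠ f i a →
        (∀ p, sub S (i + 1) f 0 p ≠ p → p = z ∨ p = sub S (i + 1) f 0 z) → Split f 0 (z : V) := by
      intro z hz hp
      have hall : ∀ p, Fr f 0 p → p = z ∨ p = f 0 z := fun p hF => by
        obtain ⟨h1, h2⟩ := hmem p hF
        rcases hp _ h2 with e | e
        · exact Or.inl (congrArg Subtype.val e)
        · exact Or.inr ((congrArg Subtype.val e).trans (hsub z hz 0))
      refine ⟨?_, hall⟩
      rcases hall v₀ hv₀ with e | e
      · exact e ▸ hv₀
      · have := hv₀.symm hs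
        rwa [e, hs.invol] at this
    rcases (show Nat.card S = i + 2 + 0 ∨ Nat.card S = i + 2 + 1 by omega) with hcS | hcS
    · obtain ⟨z, hz, h1, h2, h3⟩ := (listed_of_rightTrivial _ rfl hg hR hcS (by omega)).exists_first
        (by omega) (by omega)
      have hz' : (z : V) ≠ f i a := fun e => hz (Subtype.ext e)
      exact Or.inl ⟨z, fun k hk => by rw [← hsub z hz' k, h1 k hk], hsplit z hz' h3⟩
    · obtain ⟨z, hz, h1, h2, h3, h4, h5⟩ :=
        (listed_of_rightTrivial _ rfl hg hR hcS (by omega)).exists_removableLeaf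
        hg.toIsStringAction (by omega)
      have hz' : (z : V) ≠ f i a := fun e => hz (Subtype.ext e)
      have hz'' : (sub S (i + 1) f 1 z : V) ≠ f i a := fun e => h2 (Subtype.ext e)
      refine Or.inr ⟨z, h.removableLeaf_of_sub hL hS hz' h1, fun k hk hk' => ?_, ?_⟩
      · rw [← hsub z hz' 1, ← hsub _ hz'' k, h3 k hk hk']
      · rw [← hsub z hz' 1]
        exact hsplit _ hz'' h5
  · push Not at hL
    obtain ⟨p, hp, k, hk, hkp⟩ := hL
    have hmove := h.move hp hk hkp
    have hbd := h.bound hp hk hkp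
    obtain rfl : i = 0 := by omega
    simp only [zero_add] at *
    have hz1 : Link f {0}ᶜ a (f 1 a) := Link.step_ne one_ne_zero
    have hall : ∀ v, Link f {0}ᶜ a v → v = a ∨ v = f 1 a := fun v hv => by
      have := mem_of_ncard_le (S := {v | Link f {0}ᶜ a v}) (l := [a, f 1 a])
        (by simpa using hmove.symm) (by simpa using ⟨Link.refl, hz1⟩) hc hv
      simpa using this
    have hzx : f 1 a ≠ f 0 a := h.split.1.ne_label one_ne_zero
    have hza : ∀ k, k ≠ 1 → f k (f 1 a) = f 1 a := fun k hk => by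
      rcases Nat.eq_zero_or_pos k with rfl | hk0
      · have hl : Link f {0}ᶜ a (f 0 (f 1 a)) := by
          refine hz1.trans (not_not.mp fun hF => ?_)
          rcases h.split.2 _ hF with e | e
          · exact hmove e
          · exact hzx e
        refine (hall _ hl).resolve_left fun e => hzx ?_
        rw [hs.eq_iff] at e; exact e
      · refine (hall _ (hz1.trans (Link.step_ne hk0.ne'))).resolve_left fun e => ?_
        rw [hs.eq_iff, h.split.fixed hs (j := k) (Or.inr (by omega))] at e
        exact hmove e
    have hma : f 1 (f 1 a) = a := hs.invol 1 a
    obtain ⟨u, hu, hF⟩ := hup (by omega)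
    have hu' : ¬ Link f {0}ᶜ a u := fun hl => h.split.1 (hl.trans (hs.symm hu))
    refine Or.inr ⟨f 1 a, ⟨hza, by rw [hma]; exact hmove.symm, f 1 a, u,
      fr_of_leaf hza (by rw [hma]; exact hmove.symm), hF, fun e => hu' (e ▸ hz1),
      fun e => hu' (by rw [e, hma]; exact Link.refl)⟩, fun k hk hk' => ?_, ?_⟩
    · rw [hma]
      exact h.split.fixed hs (Or.inr (by omega))
    · rw [hma]; exact h.split

/-- At one of the two ends, the graph is a path, possibly with a pendant edge. -/
theorem exists_leftEnd [Finite V] [Nonempty V] (hf : IsStringGraph f r)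
    (hc : Nat.card V = r + 1 + w) (hw : w ≤ 3) (hr : w + 4 ≤ r) :
    LeftEnd f ∨ LeftEnd (dual r f) := by
  have hs := hf.toIsStringAction
  obtain ⟨i, hi, a, ha⟩ := exists_split hf hc hw hr
  have hmul : ∀ a, Side f r i a → Side (dual r f) r (r - 1 - i) a →
      (i + 1) * (r - i) ≤ {v | Link f {i}ᶜ a v}.ncard := fun a h h' => h.mul_le_card h'
  have hsum : ∀ a, Split f i a →
      {v | Link f {i}ᶜ a v}.ncard + {v | Link f {i}ᶜ (f i a) v}.ncard = r + 1 + w :=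
    fun a ha => (ha.card_add_card hf).trans hc
  have hpos : ∀ a, 0 < {v | Link f {i}ᶜ a v}.ncard := fun a =>
    (Set.ncard_pos (Set.toFinite _)).mpr ⟨a, Link.refl⟩
  -- orient the edge such that the small labels are at its start and the large ones at its end
  obtain ⟨a, h1, h2⟩ : ∃ a, Side f r i a ∧ Side (dual r f) r (r - 1 - i) (f i a) := by
    rcases Nat.eq_zero_or_pos i with rfl | hi0
    · obtain ⟨u, hu⟩ := hf.fract (r - 1) (by omega)
      rcases ha.cover hf u with hl | hl
      · refine ⟨f 0 a, (ha.symm hs).side hf hi (by omega), ?_⟩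
        rw [hs.invol]
        exact ha.side_dual hf hi fun _ => ⟨u, hl, hu⟩
      · exact ⟨a, ha.side hf hi (by omega), (ha.symm hs).side_dual hf hi fun _ => ⟨u, hl, hu⟩⟩
    · obtain ⟨v, hv⟩ := hf.fract 0 (by omega)
      obtain ⟨a, ha, hl⟩ : ∃ a, Split f i a ∧ Link f {i}ᶜ a v := by
        rcases ha.cover hf v with hl | hl
        exacts [⟨a, ha, hl⟩, ⟨f i a, ha.symm hs, hl⟩]
      have h := ha.side hf hi fun _ => ⟨v, hl, hv⟩
      refine ⟨a, h, (ha.symm hs).side_dual hf hi fun hi' => ?_⟩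
      obtain ⟨u, hu⟩ := hf.fract (r - 1) (by omega)
      refine ⟨u, (ha.cover hf u).resolve_left fun hlu => ?_, hu⟩
      have e1 := hmul a h (ha.side_dual hf hi fun _ => ⟨u, hlu, hu⟩)
      have e2 := hsum a ha
      have e3 := hpos (f i a)
      obtain ⟨j, rfl⟩ : ∃ j, i = j + 1 := ⟨i - 1, by omega⟩
      obtain ⟨t, rfl⟩ : ∃ t, r = j + t + 3 := ⟨r - j - 3, by omega⟩
      rw [show j + t + 3 - (j + 1) = t + 2 by omega] at e1
      nlinarith [Nat.zero_le (j * t)]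
  have ha := h1.split
  have hx := ha.symm hs
  have hs1 := hsum a ha
  have hc1 := h1.le_card
  have hset : ∀ a, {v | Link (dual r f) {r - 1 - i}ᶜ a v} = {v | Link f {i}ᶜ a v} := fun a =>
    Set.ext fun v => link_dual_iff hs hi
  have hc2 := h2.le_card
  rw [hset] at hc2
  by_cases hsmall : {v | Link f {i}ᶜ a v}.ncard ≤ i + 2
  · refine Or.inl (h1.leftEnd (by omega) hsmall (fun hi' => ?_) fun hi0 v hl hF => ?_)
    · obtain ⟨v, hv, hF⟩ := h2.low (r - 1 - (i + 1)) (by omega)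
      exact ⟨v, (link_dual_iff hs hi).mp hv, (fr_dual_iff hs hi').mp hF⟩
    · have e1 := hmul _ (hx.side hf hi fun _ => ⟨v, hl, hF⟩) h2
      obtain ⟨j, rfl⟩ : ∃ j, i = j + 1 := ⟨i - 1, by omega⟩
      obtain ⟨t, rfl⟩ : ∃ t, r = j + t + 2 := ⟨r - j - 2, by omega⟩
      rw [show j + t + 2 - (j + 1) = t + 1 by omega] at e1
      nlinarith [Nat.zero_le (j * t)]
  · have hd : dual r f (r - 1 - i) (f i a) = a := by
      rw [dual_of_lt (by omega), show r - 1 - (r - 1 - i) = i by omega, hs.invol]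
    refine Or.inr (h2.leftEnd (by omega) (by rw [hset]; omega) (fun hi' => ?_)
      fun hi0 v hl hF => ?_) <;> rw [hd] at *
    · obtain ⟨v, hv, hF⟩ := h1.low (i - 1) (by omega)
      refine ⟨v, (link_dual_iff hs hi).mpr hv, ?_⟩
      have := (fr_dual_iff hs (show i - 1 < r by omega)).mpr hF
      rwa [show r - 1 - (i - 1) = r - 1 - i + 1 by omega] at this
    · have hF' : Fr f (r - 1) v := (fr_dual_iff hs (by omega)).mp (by rwa [Nat.sub_self])
      have e1 := hmul _ h1 (ha.side_dual hf hi fun _ => ⟨v, (link_dual_iff hs hi).mp hl, hF'⟩)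
      obtain ⟨t, rfl⟩ : ∃ t, r = i + t + 2 := ⟨r - i - 2, by omega⟩
      rw [show i + t + 2 - i = t + 2 by omega] at e1
      have e2 : t + 2 ≤ {v | Link f {i}ᶜ (f i a) v}.ncard := by omega
      nlinarith [Nat.zero_le (i * t)]

end LeftEnd

/-! ### The classification of string graphs -/

section Graphs

variable {V : Type*} {f : ℕ → V → V} {r w : ℕ} {b : V}

/-- The graph which arises from a core by attaching a pendant edge with label `r - 2` to the last
vertex of the path. The new vertex gets the last number. -/
def Core.tail (K : Core) (r l x y : ℕ) : Prop :=
  K.full r l x y ∨ (l = r - 2 ∧ x = K.size r - 1 ∧ y = K.size r)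

/-- The graph is described by a listed core, possibly with a pendant edge at the end of the path. -/
def Described (f : ℕ → V → V) (r w : ℕ) : Prop :=
  (∃ K ∈ Core.listed w, K.rmin ≤ r ∧ ∃ v, VertexNumbering f (K.size r) (K.full r) v) ∨
  ∃ w', w = w' + 1 ∧ ∃ K ∈ Core.listed w', K.rmin ≤ r ∧
    ∃ v, VertexNumbering f (K.size r + 1) (K.tail r) v

lemma NonSplit.dual (hf : IsStringAction f r) {m : ℕ} (hm : m < r) (h : NonSplit f m) :
    NonSplit (dual r f) (r - 1 - m) := by
  obtain ⟨u, v, hu, hv, h1, h2⟩ := h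
  refine ⟨u, v, (fr_dual_iff hf hm).mpr hu, (fr_dual_iff hf hm).mpr hv, h1, ?_⟩
  rwa [dual_of_lt (by omega), show r - 1 - (r - 1 - m) = m by omega]

lemma dual_fixed {P : ℕ → Prop} {z : V} (h : ∀ k < r, P k → f (r - 1 - k) z = z) (k : ℕ) (hk : P k) :
    dual r f k z = z := by
  unfold dual
  split_ifs with hkr
  · exact h k hkr hk
  · rfl

/-- Attaching a pendant edge to the end of the path of a graph described by a core. -/
lemma VertexNumbering.tail (hf : IsStringAction f r) {z : V} {m : ℕ} (hr : m = r - 2)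
    (hz : ∀ k, k ≠ m → f k z = z) (hm : f m z ≠ z) {K : Core} (hK : K.WF) (hrm : K.rmin ≤ r)
    {v : ℕ → ({z}ᶜ : Set V)}
    (h : VertexNumbering (sub {z}ᶜ r f) (K.size r) (K.full r) v)
    (hc : Nat.card ({z}ᶜ : Set V) = K.size r) (hva : (v (K.size r - 1) : V) = f m z) :
    VertexNumbering f (K.size r + 1) (K.tail r)
      (fun k => if k < K.size r then (v k : V) else z) := by
  have hle := hK.le
  have hpos := hK.pos
  have hsp : 0 < K.size r := by simp only [Core.size]; omega
  refine ⟨fun p => ?_, fun l x y hE => ?_, fun l x hx hE => ?_⟩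
  · by_cases hp : p = z
    · exact ⟨K.size r, by omega, by simp [hp]⟩
    · obtain ⟨b, hb, e⟩ := h.surj ⟨p, hp⟩
      exact ⟨b, by omega, by simp [e, hb]⟩
  · rcases hE with hE | ⟨hl, rfl, rfl⟩
    · have hb := hK.size hrm hE
      have e := h.adj _ _ _ hE
      have hmem : f l (v x) ∈ ({z}ᶜ : Set V) := by
        by_contra hmem
        rw [sub_of_notMem hmem] at e
        exact hb.2.2.2 (h.inj hc hb.2.1 hb.2.2.1 e)
      simp only [hb.2.1, hb.2.2.1, if_true]
      rw [← sub_of_mem hb.1 hmem, e]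
    · rw [if_pos (by omega), if_neg (by omega), hva, hl, ← hr, hf.invol]
  · by_cases hxs : x < K.size r
    · simp only [hxs, if_true]
      have e := h.fix l x hxs fun y => ⟨fun h' => (hE y).1 (Or.inl h'), fun h' => (hE y).2 (Or.inl h')⟩
      by_cases hmem : f l (v x) ∈ ({z}ᶜ : Set V)
      · by_cases hl : l < r
        · rw [← sub_of_mem hl hmem, e]
        · exact hf.triv l _ (by omega)
      · have e' : f l (v x) = z := by simpa using hmem
        rw [hf.eq_iff] at e'
        by_cases hl : l = m
        · subst hl
          have := h.inj hc hxs (by omega) (Subtype.ext (e'.trans hva.symm))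
          exact absurd (Or.inr ⟨hr, this, rfl⟩) (hE (K.size r)).1
        · rw [hz l hl] at e'
          exact absurd e' (v x).2
    · simp only [hxs, if_false]
      refine hz l fun e => (hE (K.size r - 1)).2 (Or.inr ⟨by omega, rfl, by omega⟩)

/-- A graph which starts with a path, up to a pendant edge, is described by a core after reversing
the order of the labels. -/
lemma LeftEnd.described [Finite V] (hf : IsStringGraph f r) (hr : 2 ≤ r)
    (hc : Nat.card V = r + 1 + w) (hw : w ≤ 3) (h : LeftEnd f) : Described (dual r f) r w := by
  have hs := hf.toIsStringAction
  obtain ⟨s, rfl⟩ : ∃ s, r = s + 1 := ⟨r - 1, by omega⟩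
  have hsplit : ∀ b, Split f 0 b → Split (dual (s + 1) f) s b := fun b hb =>
    hb.dual_of_lt hs (Nat.succ_pos s)
  rcases h with ⟨b, hb⟩ | ⟨z, hz, h1, h2⟩
  · have hb' : RightTrivial (dual (s + 1) f) s b :=
      ⟨dual_fixed fun k _ hks => hb.fixed _ (by omega), hsplit b hb.split⟩
    obtain ⟨K, hK, hrm, v, hv, -⟩ := listed_of_rightTrivial _ rfl hf.dual hb' (by omega) hw
    exact Or.inl ⟨K, hK, hrm, v, hv⟩
  · have e1 : dual (s + 1) f (s - 1) = f 1 := by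
      rw [dual_of_lt (by omega), show s + 1 - 1 - (s - 1) = 1 by omega]
    have hz' : RemovableLeaf (dual (s + 1) f) (s - 1) z :=
      ⟨dual_fixed fun k _ hks => hz.fixed _ (by omega), by rw [e1]; exact hz.moved,
        hz.nonSplit.dual hs (by omega)⟩
    have hx : f 1 z ∈ ({z}ᶜ : Set V) := hz.moved
    have hg := hz'.isStringGraph_sub hf.dual
    have hR := hz'.rightTrivial_sub hf.dual (s := s) (by omega) (by omega) (hsplit _ h2) hx
      fun k hk => by
        by_cases hk' : k = s - 1
        · subst hk'
          exact Or.inr (by rw [e1, hs.invol])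
        · exact Or.inl (dual_fixed (P := fun k => k ≠ s ∧ k ≠ s - 1)
            (fun k _ hks => h1 _ (by omega) (by omega)) k ⟨hk, hk'⟩)
    have hcz := card_compl_singleton z
    have : Nonempty ({z}ᶜ : Set V) := ⟨⟨f 1 z, hx⟩⟩
    have hpos := hg.good_bound ∅ (by simp)
    simp only [Finset.card_empty] at hpos
    obtain ⟨w, rfl⟩ : ∃ w', w = w' + 1 := ⟨w - 1, by omega⟩
    obtain ⟨K, hK, hrm, v, hv, hvb⟩ := listed_of_rightTrivial _ rfl hg hR (w := w) (by omega)
      (by omega)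
    have hsz := Core.size_eq hK hrm
    exact Or.inr ⟨w, rfl, K, hK, hrm, _, hv.tail hf.dual.toIsStringAction (by omega) hz'.fixed
      hz'.moved (Core.wf_listed hK).1 hrm (by omega) (by rw [hvb, e1])⟩

/-- The classification of string graphs with few vertices, up to duality. -/
theorem described_or_dual [Finite V] [Nonempty V] (hf : IsStringGraph f r)
    (hc : Nat.card V = r + 1 + w) (hw : w ≤ 3) (hr : w + 4 ≤ r) :
    Described f r w ∨ Described (dual r f) r w := by
  rcases exists_leftEnd hf hc hw hr with h | h
  · exact Or.inr (h.described hf (by omega) hc hw)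
  · have := h.described hf.dual (by omega) hc hw
    rw [dual_dual hf.toIsStringAction] at this
    exact Or.inl this

end Graphs

/-! ### Three graphs without the intersection property -/

section Intersection

variable {V : Type*} {r : ℕ}

/-- The generators as a family of maps indexed by all natural numbers. -/
def extendPerm (ρ : Fin r → Equiv.Perm V) (k : ℕ) : Equiv.Perm V :=
  if h : k < r then ρ ⟨k, h⟩ else 1

lemma extendPerm_of_lt (ρ : Fin r → Equiv.Perm V) (k : Fin r) : extendPerm ρ k = ρ k := by
  simp [extendPerm]

lemma IsSggi.mul_self {G : Type*} [Group G] {ρ : Fin r → G} (h : IsSggi ρ) (i : Fin r) :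
    ρ i * ρ i = 1 := by
  rw [← pow_two, ← h.involution i, pow_orderOf_eq_one]

/-- By the intersection property, an element of two parabolic subgroups preserves each relation which
is preserved by their common generators. -/
lemma IsStringCGroup.mem_of_mem {ρ : Fin r → Equiv.Perm V} (hC : IsStringCGroup ρ)
    {J K : Set (Fin r)} {g : Equiv.Perm V} (hJ : g ∈ parabolic ρ J) (hK : g ∈ parabolic ρ K)
    {R : Set (V × V)} (hR : ∀ k ∈ J ∩ K, ∀ p ∈ R, (ρ k p.1, ρ k p.2) ∈ R) {p : V × V} (hp : p ∈ R) :
    (g p.1, g p.2) ∈ R := by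
  have hg : g ∈ parabolic ρ (J ∩ K) := by
    rw [← hC.intersection]
    exact ⟨hJ, hK⟩
  have key : ∀ p, p ∈ R ↔ (g p.1, g p.2) ∈ R := by
    refine Subgroup.closure_induction (p := fun g _ => ∀ p, p ∈ R ↔ (g p.1, g p.2) ∈ R)
      ?_ (fun p => Iff.rfl) (fun x y _ _ hx hy p => ?_) (fun x _ hx p => ?_) hg
    · rintro _ ⟨k, hk, rfl⟩ p
      refine ⟨hR k hk p, fun h => ?_⟩
      have := hR k hk _ h
      simp only [← Equiv.Perm.mul_apply, hC.mul_self] at this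
      exact this
    · rw [hy p, hx]; rfl
    · rw [hx (x⁻¹ p.1, x⁻¹ p.2)]
      simp
  exact (key p).mp hp

lemma prod_mem_parabolic (ρ : Fin r → Equiv.Perm V) (J : Set (Fin r)) (l : List ℕ)
    (hl : ∀ k ∈ l, ∃ h : k < r, (⟨k, h⟩ : Fin r) ∈ J) :
    (l.map (extendPerm ρ)).prod ∈ parabolic ρ J := by
  refine Subgroup.list_prod_mem _ fun g hg => ?_
  obtain ⟨k, hk, rfl⟩ := List.mem_map.mp hg
  obtain ⟨h, hJ⟩ := hl k hk
  rw [show extendPerm ρ k = ρ ⟨k, h⟩ by simp [extendPerm, h]]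
  exact Subgroup.subset_closure ⟨_, hJ, rfl⟩

/-- The permutation of `ℕ` with the given transpositions of each label, as a function: the image of
`x` under the label `k`. -/
def tableMap (L : List (ℕ × ℕ × ℕ)) (k x : ℕ) : ℕ :=
  match L.find? fun e => e.1 == k && (e.2.1 == x || e.2.2 == x) with
  | some e => if e.2.1 = x then e.2.2 else e.2.1
  | none => x

/-- The criterion by which the three graphs are excluded. The edges with labels less than `4` are
those of the list `L`. Two words `l₁` and `l₂` in the labels `0, 1, 2` and in the labels from `t` to
`3`, respectively, act in the same way, and this action does not preserve a relation which is
preserved by the labels from `t` to `2`. -/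
lemma not_isStringCGroup [Finite V] {ρ : Fin r → Equiv.Perm V} (hr : 4 ≤ r) {n : ℕ}
    {E : ℕ → ℕ → ℕ → Prop} {v : ℕ → V} (hf : IsStringAction (fun k v => extendPerm ρ k v) r)
    (hv : VertexNumbering (fun k v => extendPerm ρ k v) n E v) (hc : Nat.card V = n) (hn : 8 ≤ n)
    (L : List (ℕ × ℕ × ℕ)) (hL : ∀ e ∈ L, E e.1 e.2.1 e.2.2)
    (hL' : ∀ l < 4, ∀ x y, E l x y → (l, x, y) ∈ L)
    (hL8 : ∀ e ∈ L, e.2.1 < 8 ∧ e.2.2 < 8 ∧ e.1 < 4)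
    (l₁ l₂ : List ℕ) (t : ℕ) (h₁ : ∀ k ∈ l₁, k ≤ 2) (h₂ : ∀ k ∈ l₂, t ≤ k ∧ k ≤ 3)
    (h : ∀ x < 8, l₁.foldr (tableMap L) x = l₂.foldr (tableMap L) x)
    (R : List (ℕ × ℕ)) (hR8 : ∀ p ∈ R, p.1 < 8 ∧ p.2 < 8)
    (hR : ∀ k, t ≤ k → k ≤ 2 → ∀ p ∈ R, (tableMap L k p.1, tableMap L k p.2) ∈ R)
    (p : ℕ × ℕ) (hp : p ∈ R)
    (hp' : (l₁.foldr (tableMap L) p.1, l₁.foldr (tableMap L) p.2) ∉ R) : ¬ IsStringCGroup ρ := by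
  intro hC
  have hmap8 : ∀ k x, 8 ≤ x → tableMap L k x = x := fun k x hx => by
    unfold tableMap
    have : L.find? (fun e => e.1 == k && (e.2.1 == x || e.2.2 == x)) = none := by
      rw [List.find?_eq_none]
      intro e he
      have := hL8 e he
      simp
      omega
    rw [this]
  have hmaplt : ∀ k x, x < 8 → tableMap L k x < 8 := fun k x hx => by
    unfold tableMap
    split
    · rename_i e he
      have := hL8 e (List.mem_of_find?_eq_some he)
      split_ifs <;> omega
    · exact hx
  have hmapn : ∀ k x, x < n → tableMap L k x < n := fun k x hx => by
    by_cases hx8 : x < 8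
    · have := hmaplt k x hx8; omega
    · rwa [hmap8 k x (by omega)]
  have hstep : ∀ k < 4, ∀ x < n, extendPerm ρ k (v x) = v (tableMap L k x) := by
    intro k hk x hx
    unfold tableMap
    split
    · rename_i e he
      have h1 := List.find?_some he
      have h2 := hL e (List.mem_of_find?_eq_some he)
      simp only [Bool.and_eq_true, beq_iff_eq, Bool.or_eq_true] at h1
      obtain ⟨rfl, h1⟩ := h1
      have h3 := hv.adj _ _ _ h2
      split_ifs with h4
      · rw [← h4]; exact h3
      · rw [← h1.resolve_left h4]
        exact (hf.eq_iff.mp h3).symm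
    · rename_i he
      rw [List.find?_eq_none] at he
      refine hv.fix k x hx fun y => ⟨fun hE => ?_, fun hE => ?_⟩
      · exact he _ (hL' k hk _ _ hE) (by simp)
      · exact he _ (hL' k hk _ _ hE) (by simp)
  have hword : ∀ l : List ℕ, (∀ k ∈ l, k < 4) → ∀ x < n,
      l.foldr (tableMap L) x < n ∧
      (l.map (extendPerm ρ)).prod (v x) = v (l.foldr (tableMap L) x) := by
    intro l hl x hx
    induction l with
    | nil => exact ⟨hx, rfl⟩
    | cons k l ih =>
      obtain ⟨h1, h2⟩ := ih fun k hk => hl k (List.mem_cons_of_mem _ hk)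
      refine ⟨hmapn _ _ h1, ?_⟩
      rw [List.map_cons, List.prod_cons, Equiv.Perm.mul_apply, h2]
      exact hstep k (hl k List.mem_cons_self) _ h1
  have hword8 : ∀ (l : List ℕ) x, 8 ≤ x → l.foldr (tableMap L) x = x := by
    intro l x hx
    induction l with
    | nil => rfl
    | cons k l ih => rw [List.foldr_cons, ih, hmap8 k x hx]
  have w1 : ∀ k ∈ l₁, k < 4 := fun k hk => by have := h₁ k hk; omega
  have w2 : ∀ k ∈ l₂, k < 4 := fun k hk => by have := h₂ k hk; omega
  have heq : (l₁.map (extendPerm ρ)).prod = (l₂.map (extendPerm ρ)).prod := by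
    refine Equiv.ext fun q => ?_
    obtain ⟨x, hx, rfl⟩ := hv.surj q
    rw [(hword l₁ w1 x hx).2, (hword l₂ w2 x hx).2]
    by_cases hx8 : x < 8
    · rw [h x hx8]
    · rw [hword8 _ _ (by omega), hword8 _ _ (by omega)]
  have m1 := prod_mem_parabolic ρ {k | (k : ℕ) ≤ 2} l₁ fun k hk =>
    ⟨by have := h₁ k hk; omega, h₁ k hk⟩
  have m2 := prod_mem_parabolic ρ {k | t ≤ (k : ℕ) ∧ (k : ℕ) ≤ 3} l₂ fun k hk =>
    ⟨by have := h₂ k hk; omega, h₂ k hk⟩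
  rw [← heq] at m2
  have hp8 := hR8 p hp
  have := hC.mem_of_mem m1 m2 (R := {q | ∃ p ∈ R, q = (v p.1, v p.2)}) (p := (v p.1, v p.2)) ?_
    ⟨p, hp, rfl⟩
  · obtain ⟨q, hq, e⟩ := this
    have hq8 := hR8 q hq
    obtain ⟨c1, d1⟩ := hword l₁ w1 p.1 (by omega)
    obtain ⟨c2, d2⟩ := hword l₁ w1 p.2 (by omega)
    rw [Prod.mk.injEq] at e
    have e1 := hv.inj hc c1 (by omega) (d1.symm.trans e.1)
    have e2 := hv.inj hc c2 (by omega) (d2.symm.trans e.2)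
    exact hp' (by rw [e1, e2]; exact hq)
  · rintro k ⟨hk1, hk2, -⟩ _ ⟨q, hq, rfl⟩
    have hq8 := hR8 q hq
    replace hk1 : (k : ℕ) ≤ 2 := hk1
    refine ⟨_, hR k hk2 hk1 q hq, ?_⟩
    rw [← extendPerm_of_lt ρ k, hstep _ (by omega) _ (by omega), hstep _ (by omega) _ (by omega)]

variable {ρ : Fin r → Equiv.Perm V} {v : ℕ → V}

lemma not_isStringCGroup_X3 [Finite V] (hr : 4 ≤ r) (hc : Nat.card V = Core.X3.size r)
    (hf : IsStringAction (fun k v => extendPerm ρ k v) r)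
    (hv : VertexNumbering (fun k v => extendPerm ρ k v) (Core.X3.size r) (Core.X3.full r) v) :
    ¬ IsStringCGroup ρ := by
  refine not_isStringCGroup hr hf hv hc (by simp only [Core.size, Core.X3]; omega)
    [(1, 3, 0), (2, 3, 0), (2, 4, 1), (3, 3, 0), (3, 4, 1), (3, 5, 2), (0, 0, 1), (1, 1, 2),
      (0, 3, 4), (1, 4, 5), (2, 5, 6), (3, 6, 7)] ?_ (fun l hl x y hE => ?_) (by decide)
    [0, 1, 2, 1, 0, 1, 0, 2, 1, 2, 1, 0, 1, 2, 1, 0, 1, 2, 1, 2, 1, 0, 1] [3, 2, 1, 2, 1, 3, 2, 3]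
    1 (by decide) (by decide) (by decide +kernel)
    [(6, 5), (5, 6), (5, 1), (1, 5), (1, 2), (2, 1), (2, 4), (4, 2), (4, 6), (6, 4)] (by decide)
    (fun k h1 h2 => ?_) (5, 1) (by decide) (by decide +kernel)
  · simp [Core.full, Core.X3, Core.H2, Core.B]
    omega
  · rw [← Core.full_X3]
    exact hE.imp id fun h => ⟨h.1, hl, h.2.2⟩
  · interval_cases k <;> decide

lemma not_isStringCGroup_leaf_A [Finite V] (hr : 4 ≤ r)
    (hc : Nat.card V = (Core.A.leaf 1 1).size r)
    (hf : IsStringAction (fun k v => extendPerm ρ k v) r)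
    (hv : VertexNumbering (fun k v => extendPerm ρ k v) ((Core.A.leaf 1 1).size r)
      ((Core.A.leaf 1 1).full r) v) : ¬ IsStringCGroup ρ := by
  refine not_isStringCGroup hr hf hv hc (by simp only [Core.size, Core.leaf, Core.A]; omega)
    [(1, 0, 2), (2, 3, 1), (2, 4, 2), (0, 1, 2), (0, 3, 4), (1, 4, 5), (2, 5, 6), (3, 6, 7)]
    ?_ ?_ (by decide)
    [0, 1, 2, 1, 2, 1, 2, 1, 0, 2, 1, 0, 2, 1, 2, 1, 2, 1, 2, 1] [2, 3, 2, 3, 2, 3]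
    2 (by decide) (by decide) (by decide +kernel) [(1, 5), (3, 6)] (by decide)
    (fun k h1 h2 => ?_) (1, 5) (by decide) (by decide +kernel)
  · simp [Core.full, Core.leaf, Core.A]
    omega
  · rintro l hl x y ((⟨rfl, rfl, rfl⟩ | ⟨x, y, rfl, rfl, ⟨rfl, rfl, rfl⟩ | ⟨rfl, rfl, rfl⟩ |
      ⟨rfl, rfl, rfl⟩⟩) | ⟨-, -, h, rfl⟩)
    iterate 4 simp
    obtain rfl : x = l + 3 := by
      simp only [Core.leaf, Core.A] at h; omega
    interval_cases l <;> simp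
  · interval_cases k; decide

lemma not_isStringCGroup_leaf_G [Finite V] (hr : 4 ≤ r)
    (hc : Nat.card V = (Core.G.leaf 1 1).size r)
    (hf : IsStringAction (fun k v => extendPerm ρ k v) r)
    (hv : VertexNumbering (fun k v => extendPerm ρ k v) ((Core.G.leaf 1 1).size r)
      ((Core.G.leaf 1 1).full r) v) : ¬ IsStringCGroup ρ := by
  refine not_isStringCGroup hr hf hv hc (by simp only [Core.size, Core.leaf, Core.G]; omega)
    [(1, 0, 2), (1, 3, 1), (2, 3, 1), (2, 4, 2), (0, 1, 2), (0, 3, 4), (1, 4, 5), (2, 5, 6),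
      (3, 6, 7)]
    ?_ ?_ (by decide)
    [1, 0, 1, 0, 2, 1, 0, 1, 2, 1, 0, 1, 2, 1, 0, 1, 2, 1, 0, 1, 2, 1] [2, 3, 2, 3, 2, 3]
    2 (by decide) (by decide) (by decide +kernel) [(1, 5), (3, 6)] (by decide)
    (fun k h1 h2 => ?_) (1, 5) (by decide) (by decide +kernel)
  · simp [Core.full, Core.leaf, Core.G, Core.A]
    omega
  · rintro l hl x y ((⟨rfl, rfl, rfl⟩ | ⟨x, y, rfl, rfl, ⟨rfl, rfl, rfl⟩ | ⟨rfl, rfl, rfl⟩ |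
      ⟨rfl, rfl, rfl⟩ | ⟨rfl, rfl, rfl⟩⟩) | ⟨-, -, h, rfl⟩)
    iterate 5 simp
    obtain rfl : x = l + 3 := by
      simp only [Core.leaf, Core.G] at h; omega
    interval_cases l <;> simp
  · interval_cases k; decide

end Intersection

/-! ### Isomorphisms with the graphs of the families -/

section PathEdges

variable {r a b l x y : ℕ} {e : List ℕ} {L L' : List (List ℕ)}

lemma mem_pathEdges : (l, x, y) ∈ pathEdges L ↔ y = x + 1 ∧ ∃ e, L[x]? = some e ∧ l ∈ e := by
  simp only [pathEdges, List.mem_flatMap, List.mem_map, Prod.mk.injEq, Prod.exists]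
  constructor
  · rintro ⟨e, k, hk, m, hm, rfl, rfl, rfl⟩
    exact ⟨rfl, e, List.mem_zipIdx_iff_getElem?.mp hk, hm⟩
  · rintro ⟨rfl, e, he, hl⟩
    exact ⟨e, x, List.mem_zipIdx_iff_getElem?.mpr he, l, hl, rfl, rfl, rfl⟩

lemma mem_pathEdges_nil : (l, x, y) ∈ pathEdges [] ↔ False := by
  simp [mem_pathEdges]

lemma mem_pathEdges_cons : (l, x, y) ∈ pathEdges (e :: L) ↔
    (l ∈ e ∧ x = 0 ∧ y = 1) ∨ (1 ≤ x ∧ (l, x - 1, y - 1) ∈ pathEdges L) := by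
  simp only [mem_pathEdges]
  rcases x with _ | x
  · simp; tauto
  · simp

lemma mem_pathEdges_append : (l, x, y) ∈ pathEdges (L ++ L') ↔
    (l, x, y) ∈ pathEdges L ∨
      (L.length ≤ x ∧ (l, x - L.length, y - L.length) ∈ pathEdges L') := by
  simp only [mem_pathEdges]
  by_cases hx : x < L.length
  · rw [List.getElem?_append_left hx]
    simp [Nat.not_le.mpr hx]
  · rw [List.getElem?_append_right (by omega)]
    have : L[x]? = none := by simp; omega
    simp only [this, show L.length ≤ x by omega, true_and]
    simp
    intro e _ _
    omega

lemma length_run : (run a b).length = b - a := by simp [run]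

lemma mem_pathEdges_run :
    (l, x, y) ∈ pathEdges (run a b) ↔ a ≤ l ∧ l < b ∧ x + a = l ∧ y = x + 1 := by
  rw [mem_pathEdges]
  have h : (run a b)[x]? = if x < b - a then some [a + x] else none := by
    split_ifs with hx
    · simp [run, List.Ico, hx]
    · simp [run]; omega
  rw [h]
  split_ifs with hx
  · simp; omega
  · simp; omega

/-- The same path, read from the other end and with the labels in reversed order. -/
def revPath (r : ℕ) (L : List (List ℕ)) : List (List ℕ) :=
  (L.map fun e => e.map fun l => r - 1 - l).reverse

lemma revPath_append : revPath r (L ++ L') = revPath r L' ++ revPath r L := by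
  simp [revPath]

lemma revPath_singleton : revPath r [e] = [e.map fun l => r - 1 - l] := rfl

lemma revPath_run (hb : b ≤ r) : revPath r (run a b) = run (r - b) (r - a) := by
  apply List.ext_getElem
  · simp [revPath, run]; omega
  · intro k h1 h2
    simp only [revPath, run, List.length_reverse, List.length_map, List.Ico.length,
      List.map_map] at h1
    simp [revPath, run, List.Ico, List.getElem_range']
    omega

end PathEdges

section Isomorphic

variable {V : Type*} {f : ℕ → V → V} {r n : ℕ}

/-- Renumbering the vertices and reversing some of the edges. -/
lemma VertexNumbering.renumber {m : ℕ} (hf : IsStringAction f m) {E E' : ℕ → ℕ → ℕ → Prop} {v : ℕ → V}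
    (hv : VertexNumbering f n E v) (π π' : ℕ → ℕ) (hπ : ∀ x < n, π x < n ∧ π' (π x) = x)
    (hπ' : ∀ x < n, π' x < n ∧ π (π' x) = x)
    (h₁ : ∀ l x y, E' l x y → E l (π x) (π y) ∨ E l (π y) (π x))
    (h₂ : ∀ l x y, E l x y → E' l (π' x) (π' y) ∨ E' l (π' y) (π' x)) :
    VertexNumbering f n E' (v ∘ π) where
  surj p := by
    obtain ⟨x, hx, rfl⟩ := hv.surj p
    exact ⟨π' x, (hπ' x hx).1, by simp [(hπ' x hx).2]⟩
  adj l x y h := by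
    rcases h₁ l x y h with h | h
    · exact hv.adj _ _ _ h
    · exact (hf.eq_iff.mp (hv.adj _ _ _ h)).symm
  fix l x hx h := by
    refine hv.fix l (π x) (hπ x hx).1 fun y => ⟨fun hE => ?_, fun hE => ?_⟩
    · have := h₂ _ _ _ hE
      rw [(hπ x hx).2] at this
      exact this.elim (h _).1 (h _).2
    · have := h₂ _ _ _ hE
      rw [(hπ x hx).2] at this
      exact this.elim (h _).2 (h _).1

/-- The dual of a path is the reversed path. -/
lemma VertexNumbering.revPath (hf : IsStringAction f r) {L : List (List ℕ)} {v : ℕ → V}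
    (hL : ∀ e ∈ L, ∀ l ∈ e, l < r)
    (hv : VertexNumbering f (L.length + 1) (fun l x y => (l, x, y) ∈ pathEdges L) v) :
    VertexNumbering (dual r f) ((revPath r L).length + 1)
      (fun l x y => (l, x, y) ∈ pathEdges (_root_.revPath r L)) (fun x => v (L.length - x)) := by
  have hlen : (_root_.revPath r L).length = L.length := by simp [_root_.revPath]
  have hmem : ∀ l x, (l, x, x + 1) ∈ pathEdges (_root_.revPath r L) ↔
      l < r ∧ x < L.length ∧ (r - 1 - l, L.length - 1 - x, L.length - 1 - x + 1) ∈ pathEdges L := by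
    intro l x
    simp only [mem_pathEdges, true_and]
    by_cases hx : x < L.length
    · have h1 : L.length - 1 - x < L.length := by omega
      simp only [_root_.revPath, List.getElem?_reverse, List.length_map, hx, List.getElem?_map,
        List.getElem?_eq_getElem h1, Option.map_some, Option.some.injEq, exists_eq_left',
        List.mem_map, true_and]
      have h2 := hL _ (List.getElem_mem h1)
      constructor
      · rintro ⟨m, hm, rfl⟩
        have := h2 m hm
        exact ⟨by omega, by rwa [show r - 1 - (r - 1 - m) = m by omega]⟩
      · rintro ⟨h3, h4⟩
        exact ⟨_, h4, by omega⟩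
    · have : (_root_.revPath r L)[x]? = none := by simp [hlen]; omega
      simp [this, hx]
  refine ⟨fun p => ?_, fun l x y h => ?_, fun l x hx h => ?_⟩
  · obtain ⟨x, hx, rfl⟩ := hv.surj p
    exact ⟨L.length - x, by omega, by congr 1; omega⟩
  · obtain rfl := (mem_pathEdges.mp h).1
    obtain ⟨h1, h2, h3⟩ := (hmem l x).mp h
    have e := hv.adj _ _ _ h3
    rw [hf.eq_iff] at e
    rw [dual_of_lt h1, ← show L.length - 1 - x + 1 = L.length - x by omega, ← e]
    congr 1; omega
  · by_cases hl : l < r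
    · rw [dual_of_lt hl]
      refine hv.fix _ _ (by omega) fun y => ⟨fun hE => ?_, fun hE => ?_⟩
      · obtain rfl := (mem_pathEdges.mp hE).1
        have : L.length - x < L.length := by
          obtain ⟨-, e, he, -⟩ := mem_pathEdges.mp hE
          exact (List.getElem?_eq_some_iff.mp he).1
        refine (h (x - 1)).2 ?_
        have := (hmem l (x - 1)).mpr ⟨hl, by omega, by
          rwa [show L.length - 1 - (x - 1) = L.length - x by omega]⟩
        rwa [show x - 1 + 1 = x by omega] at this
      · have e1 := (mem_pathEdges.mp hE).1
        refine (h (x + 1)).1 ((hmem l x).mpr ⟨hl, by omega, ?_⟩)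
        rwa [show L.length - 1 - x = y by omega, ← e1]
    · simp [dual, hl]

variable {ρ : Fin r → Equiv.Perm V}

lemma extendPerm_dualGenerators : (fun k v => extendPerm (dualGenerators ρ) k v) =
    dual r (fun k v => extendPerm ρ k v) := by
  funext k v
  by_cases hk : k < r
  · rw [dual_of_lt hk]
    simp only [extendPerm, hk, show r - 1 - k < r by omega, dif_pos, dualGenerators]
    congr 2
    ext
    simp [Fin.val_rev]
    omega
  · simp [extendPerm, dual, hk]

lemma VertexNumbering.isomorphic (hf : IsStringAction (fun k v => extendPerm ρ k v) r)
    (hc : Nat.card V = n) {L : List (ℕ × ℕ × ℕ)} {v : ℕ → V}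
    (hv : VertexNumbering (fun k v => extendPerm ρ k v) n (fun l x y => (l, x, y) ∈ L) v)
    (hL : ∀ l x y, (l, x, y) ∈ L → x < n ∧ y < n) :
    (permutationGraph ρ).Isomorphic (graphOfEdges r n L) := by
  have hinj : Function.Injective fun x : Fin n => v x := fun x y e =>
    Fin.ext (hv.inj hc x.2 y.2 e)
  have hsurj : Function.Surjective fun x : Fin n => v x := fun p => by
    obtain ⟨x, hx, rfl⟩ := hv.surj p
    exact ⟨⟨x, hx⟩, rfl⟩
  let e := Equiv.ofBijective _ ⟨hinj, hsurj⟩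
  have hstep : ∀ (i : Fin r) (x y : Fin n), x ≠ y →
      (ρ i (v x) = v y ↔ ((i : ℕ), (x : ℕ), (y : ℕ)) ∈ L ∨ ((i : ℕ), (y : ℕ), (x : ℕ)) ∈ L) := by
    intro i x y hxy
    rw [← extendPerm_of_lt ρ i]
    constructor
    · intro h
      by_contra hno
      push Not at hno
      have : (extendPerm ρ i) (v x) = v x := hv.fix i x x.2 fun z => by
        constructor
        · intro hz
          have h1 := hv.adj _ _ _ hz
          have h2 := hL _ _ _ hz
          have := hv.inj hc h2.2 y.2 (h1.symm.trans h)
          exact hno.1 (this ▸ hz)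
        · intro hz
          have h1 := hf.eq_iff.mp (hv.adj _ _ _ hz)
          have h2 := hL _ _ _ hz
          have := hv.inj hc h2.1 y.2 (h1.trans h)
          exact hno.2 (this ▸ hz)
      exact hxy (hinj (this.symm.trans h))
    · rintro (h | h)
      · exact hv.adj _ _ _ h
      · exact (hf.eq_iff.mp (hv.adj _ _ _ h)).symm
  refine ⟨e.symm, fun i p q => ?_⟩
  obtain ⟨x, rfl⟩ := e.surjective p
  obtain ⟨y, rfl⟩ := e.surjective q
  rw [Equiv.symm_apply_apply, Equiv.symm_apply_apply]
  simp only [permutationGraph, graphOfEdges, SimpleGraph.fromRel_adj, ne_eq, e.injective.eq_iff]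
  refine and_congr_right fun hxy => ?_
  have h1 := hstep i x y hxy
  have h2 := hstep i y x (Ne.symm hxy)
  change (ρ i (v x) = v y ∨ ρ i (v y) = v x) ↔ _
  rw [h1, h2]
  tauto

end Isomorphic

/-! ### The families -/

section Families

variable {r n : ℕ} {K : Core} {L : List (List ℕ)}

namespace Core

/-- The graph with `r` labels described by a core is a path with the given labels. -/
def IsPath (K : Core) (r : ℕ) (L : List (List ℕ)) : Prop :=
  ∀ l x y, K.full r l x y ↔ (l, x, y) ∈ pathEdges L

lemma isPath_S : S.IsPath r (run 0 r) := by
  intro l x y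
  rw [mem_pathEdges_run]
  simp only [full, S, false_or]
  omega

lemma IsPath.leaf (hK : K.IsPath r L) (hc : 0 < K.c) (m : ℕ) :
    (K.leaf m 0).IsPath r ([m] :: L) := by
  intro l x y
  rw [mem_pathEdges_cons, ← hK]
  simp only [full, Core.leaf, List.mem_singleton]
  constructor
  · rintro ((h | ⟨x', y', rfl, rfl, h⟩) | h)
    · exact Or.inl h
    · exact Or.inr ⟨by omega, Or.inl h⟩
    · exact Or.inr ⟨by omega, Or.inr (by omega)⟩
  · rintro (h | ⟨h1, h | h⟩)
    · exact Or.inl (Or.inl h)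
    · by_cases hy : 1 ≤ y
      · exact Or.inl (Or.inr ⟨x - 1, y - 1, by omega, by omega, h⟩)
      · have := (mem_pathEdges.mp ((hK l (x - 1) (y - 1)).mp (Or.inl h))).1
        omega
    · exact Or.inr (by omega)

lemma isPath_L3 : L3.IsPath r ([0, 2] :: [1] :: run 0 r) := by
  intro l x y
  simp only [mem_pathEdges_cons, mem_pathEdges_run, full, L3, List.mem_cons, List.not_mem_nil,
    or_false]
  omega

lemma isPath_Q3 : Q3.IsPath r ([1, 3] :: [2] :: [1] :: run 0 r) := by
  intro l x y
  simp only [mem_pathEdges_cons, mem_pathEdges_run, full, Q3, List.mem_cons, List.not_mem_nil,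
    or_false]
  omega

lemma isPath_M1 (i : ℕ) : (M1 i).IsPath r (run 0 (i + 2) ++ [[i + 2]] ++ run (i + 1) r) := by
  intro l x y
  simp only [mem_pathEdges_cons, mem_pathEdges_append, mem_pathEdges_nil, mem_pathEdges_run, full,
    M1, List.mem_cons, List.not_mem_nil, or_false, length_run, List.length_append,
    List.length_singleton, and_false]
  omega

lemma isPath_M2 (i : ℕ) : (M2 i).IsPath r (run 0 (i + 2) ++ [[i, i + 2]] ++ run (i + 1) r) := by
  intro l x y
  simp only [mem_pathEdges_cons, mem_pathEdges_append, mem_pathEdges_nil, mem_pathEdges_run, full,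
    M2, List.mem_cons, List.not_mem_nil, or_false, length_run, List.length_append,
    List.length_singleton, and_false]
  omega

lemma tail_iff_of_isPath (hK : K.IsPath r L) (hL : K.size r = L.length + 1) (l x y : ℕ) :
    K.tail r l x y ↔ (l, x, y) ∈ pathEdges (L ++ [[r - 2]]) := by
  rw [mem_pathEdges_append, ← hK, mem_pathEdges_cons, mem_pathEdges_nil, List.mem_singleton]
  rw [tail, hL]
  refine or_congr_right ?_
  simp only [and_false, or_false]
  omega

end Core

variable {V : Type*} {ρ : Fin r → Equiv.Perm V} {E : ℕ → ℕ → ℕ → Prop} {v : ℕ → V}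

lemma isomorphic_of_path (hf : IsStringAction (fun k v => extendPerm ρ k v) r)
    (hc : Nat.card V = n) (hv : VertexNumbering (fun k v => extendPerm ρ k v) n E v)
    (hE : ∀ l x y, E l x y ↔ (l, x, y) ∈ pathEdges L) (hn : n = L.length + 1) :
    (permutationGraph ρ).Isomorphic (graphOfEdges r n (pathEdges L)) := by
  have hE' : E = fun l x y => (l, x, y) ∈ pathEdges L := by
    funext l x y
    exact propext (hE l x y)
  rw [hE'] at hv
  refine hv.isomorphic hf hc fun l x y h => ?_
  obtain ⟨rfl, e, he, -⟩ := mem_pathEdges.mp h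
  have := (List.getElem?_eq_some_iff.mp he).1
  omega

lemma isomorphic_dual_of_path (hf : IsStringAction (fun k v => extendPerm ρ k v) r)
    (hc : Nat.card V = n) (hv : VertexNumbering (fun k v => extendPerm ρ k v) n E v)
    (hE : ∀ l x y, E l x y ↔ (l, x, y) ∈ pathEdges L) (hn : n = L.length + 1) :
    (permutationGraph (dualGenerators ρ)).Isomorphic
      (graphOfEdges r n (pathEdges (revPath r L))) := by
  have hE' : E = fun l x y => (l, x, y) ∈ pathEdges L := by
    funext l x y
    exact propext (hE l x y)
  rw [hE'] at hv
  subst hn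
  have hL : ∀ e ∈ L, ∀ l ∈ e, l < r := by
    intro e he l hl
    obtain ⟨x, hx, rfl⟩ := List.getElem_of_mem he
    by_contra hlr
    have h := hv.adj l x (x + 1) (mem_pathEdges.mpr ⟨rfl, _, List.getElem?_eq_getElem hx, hl⟩)
    rw [hf.triv l _ (by omega)] at h
    have := hv.inj hc (by omega) (by omega) h
    omega
  have hd := hv.revPath hf hL
  rw [← extendPerm_dualGenerators] at hd
  have hlen : (revPath r L).length = L.length := by simp [revPath]
  rw [← hlen] at hc ⊢
  refine isomorphic_of_path ?_ hc hd (fun _ _ _ => Iff.rfl) rfl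
  rw [extendPerm_dualGenerators]
  exact hf.dual

lemma isomorphic_of_renumber (hf : IsStringAction (fun k v => extendPerm ρ k v) r)
    (hc : Nat.card V = n) (hv : VertexNumbering (fun k v => extendPerm ρ k v) n E v)
    {L : List (ℕ × ℕ × ℕ)} (π π' : ℕ → ℕ) (hπ : ∀ x < n, π x < n ∧ π' (π x) = x)
    (hπ' : ∀ x < n, π' x < n ∧ π (π' x) = x)
    (h₁ : ∀ l x y, (l, x, y) ∈ L → x < n ∧ y < n ∧ (E l (π x) (π y) ∨ E l (π y) (π x)))
    (h₂ : ∀ l x y, E l x y → (l, π' x, π' y) ∈ L ∨ (l, π' y, π' x) ∈ L) :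
    (permutationGraph ρ).Isomorphic (graphOfEdges r n L) :=
  (hv.renumber hf π π' hπ hπ' (fun l x y h => (h₁ l x y h).2.2) h₂).isomorphic hf hc
    fun l x y h => ⟨(h₁ l x y h).1, (h₁ l x y h).2.1⟩

end Families

/-! ### The families which are not paths -/

section NonPaths

variable {r n : ℕ} {V : Type*} {ρ : Fin r → Equiv.Perm V} {E : ℕ → ℕ → ℕ → Prop} {v : ℕ → V}

/-- The vertices may be renumbered cyclically. -/
lemma isomorphic_of_rotation (hf : IsStringAction (fun k v => extendPerm ρ k v) r)
    (hc : Nat.card V = n) (hv : VertexNumbering (fun k v => extendPerm ρ k v) n E v)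
    {L : List (ℕ × ℕ × ℕ)} (s : ℕ) (hs : s ≤ n)
    (h₁ : ∀ l x y, (l, x, y) ∈ L → x < n ∧ y < n ∧
      (E l (if x + s < n then x + s else x + s - n) (if y + s < n then y + s else y + s - n) ∨
        E l (if y + s < n then y + s else y + s - n) (if x + s < n then x + s else x + s - n)))
    (h₂ : ∀ l x y, E l x y →
      (l, if x < s then x + n - s else x - s, if y < s then y + n - s else y - s) ∈ L ∨
        (l, if y < s then y + n - s else y - s, if x < s then x + n - s else x - s) ∈ L) :
    (permutationGraph ρ).Isomorphic (graphOfEdges r n L) := by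
  refine isomorphic_of_renumber hf hc hv (fun x => if x + s < n then x + s else x + s - n)
    (fun x => if x < s then x + n - s else x - s) (fun x hx => ?_) (fun x hx => ?_) h₁ h₂
  · split_ifs <;> omega
  · split_ifs <;> omega

lemma isomorphic_A (hr : 4 ≤ r) (hf : IsStringAction (fun k v => extendPerm ρ k v) r)
    (hc : Nat.card V = r + 3)
    (hv : VertexNumbering (fun k v => extendPerm ρ k v) (r + 3) (Core.A.full r) v) :
    (permutationGraph ρ).Isomorphic (Family.A.graph r (r + 3) 0) := by
  refine isomorphic_of_rotation hf hc hv 2 (by omega) (fun l x y h => ?_) (fun l x y h => ?_)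
  · simp only [Family.edges, List.mem_append, mem_pathEdges_run, List.mem_cons,
      Prod.mk.injEq, List.not_mem_nil, or_false] at h
    simp only [Core.full, Core.A]
    rcases h with h | ⟨rfl, rfl, rfl⟩ | ⟨rfl, rfl, rfl⟩ | ⟨rfl, rfl, rfl⟩
    · rw [if_pos (by omega), if_pos (by omega)]
      refine ⟨by omega, by omega, Or.inl (Or.inr ?_)⟩
      omega
    all_goals simp
    all_goals omega
  · simp only [Core.full, Core.A] at h
    simp only [Family.edges, List.mem_append, mem_pathEdges_run, List.mem_cons,
      Prod.mk.injEq, List.not_mem_nil, or_false]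
    rcases h with (⟨rfl, rfl, rfl⟩ | ⟨rfl, rfl, rfl⟩ | ⟨rfl, rfl, rfl⟩) | h
    on_goal 4 =>
      rw [if_neg (by omega), if_neg (by omega)]
      refine Or.inl (Or.inl ?_)
      omega
    all_goals simp
    all_goals omega

lemma isomorphic_G (hr : 4 ≤ r) (hf : IsStringAction (fun k v => extendPerm ρ k v) r)
    (hc : Nat.card V = r + 3)
    (hv : VertexNumbering (fun k v => extendPerm ρ k v) (r + 3) (Core.G.full r) v) :
    (permutationGraph ρ).Isomorphic (Family.G.graph r (r + 3) 0) := by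
  refine isomorphic_of_rotation hf hc hv 2 (by omega) (fun l x y h => ?_) (fun l x y h => ?_)
  · simp only [Family.edges, List.mem_append, mem_pathEdges_run, List.mem_cons,
      Prod.mk.injEq, List.not_mem_nil, or_false] at h
    simp only [Core.full, Core.G, Core.A]
    rcases h with h | ⟨rfl, rfl, rfl⟩ | ⟨rfl, rfl, rfl⟩ | ⟨rfl, rfl, rfl⟩ | ⟨rfl, rfl, rfl⟩
    · rw [if_pos (by omega), if_pos (by omega)]
      refine ⟨by omega, by omega, Or.inl (Or.inr ?_)⟩
      omega
    all_goals simp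
    all_goals omega
  · simp only [Core.full, Core.G, Core.A] at h
    simp only [Family.edges, List.mem_append, mem_pathEdges_run, List.mem_cons,
      Prod.mk.injEq, List.not_mem_nil, or_false]
    rcases h with (⟨rfl, rfl, rfl⟩ | ⟨rfl, rfl, rfl⟩ | ⟨rfl, rfl, rfl⟩ | ⟨rfl, rfl, rfl⟩) | h
    on_goal 5 =>
      rw [if_neg (by omega), if_neg (by omega)]
      refine Or.inl (Or.inl ?_)
      omega
    all_goals simp
    all_goals omega

lemma isomorphic_B (hr : 4 ≤ r) (hf : IsStringAction (fun k v => extendPerm ρ k v) r)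
    (hc : Nat.card V = r + 4)
    (hv : VertexNumbering (fun k v => extendPerm ρ k v) (r + 4) (Core.B.full r) v) :
    (permutationGraph ρ).Isomorphic (Family.B.graph r (r + 4) 0) := by
  refine isomorphic_of_rotation hf hc hv 3 (by omega) (fun l x y h => ?_) (fun l x y h => ?_)
  · simp only [Family.edges, List.mem_append, mem_pathEdges_run, List.mem_cons,
      Prod.mk.injEq, List.not_mem_nil, or_false] at h
    simp only [Core.full, Core.B]
    rcases h with h | ⟨rfl, rfl, rfl⟩ | ⟨rfl, rfl, rfl⟩ | ⟨rfl, rfl, rfl⟩ | ⟨rfl, rfl, rfl⟩ |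
      ⟨rfl, rfl, rfl⟩
    · rw [if_pos (by omega), if_pos (by omega)]
      refine ⟨by omega, by omega, Or.inl (Or.inr ?_)⟩
      omega
    all_goals simp
    all_goals omega
  · simp only [Core.full, Core.B] at h
    simp only [Family.edges, List.mem_append, mem_pathEdges_run, List.mem_cons,
      Prod.mk.injEq, List.not_mem_nil, or_false]
    rcases h with (⟨rfl, rfl, rfl⟩ | ⟨rfl, rfl, rfl⟩ | ⟨rfl, rfl, rfl⟩ | ⟨rfl, rfl, rfl⟩ |
      ⟨rfl, rfl, rfl⟩) | h
    on_goal 6 =>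
      rw [if_neg (by omega), if_neg (by omega)]
      refine Or.inl (Or.inl ?_)
      omega
    all_goals simp
    all_goals omega

lemma isomorphic_H1 (hr : 4 ≤ r) (hf : IsStringAction (fun k v => extendPerm ρ k v) r)
    (hc : Nat.card V = r + 4)
    (hv : VertexNumbering (fun k v => extendPerm ρ k v) (r + 4) (Core.H1.full r) v) :
    (permutationGraph ρ).Isomorphic (Family.H1.graph r (r + 4) 0) := by
  refine isomorphic_of_rotation hf hc hv 3 (by omega) (fun l x y h => ?_) (fun l x y h => ?_)
  · simp only [Family.edges, List.mem_append, mem_pathEdges_run, List.mem_cons,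
      Prod.mk.injEq, List.not_mem_nil, or_false] at h
    simp only [Core.full, Core.H1, Core.B]
    rcases h with h | ⟨rfl, rfl, rfl⟩ | ⟨rfl, rfl, rfl⟩ | ⟨rfl, rfl, rfl⟩ | ⟨rfl, rfl, rfl⟩ |
      ⟨rfl, rfl, rfl⟩ | ⟨rfl, rfl, rfl⟩
    · rw [if_pos (by omega), if_pos (by omega)]
      refine ⟨by omega, by omega, Or.inl (Or.inr ?_)⟩
      omega
    all_goals simp
    all_goals omega
  · simp only [Core.full, Core.H1, Core.B] at h
    simp only [Family.edges, List.mem_append, mem_pathEdges_run, List.mem_cons,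
      Prod.mk.injEq, List.not_mem_nil, or_false]
    rcases h with (⟨rfl, rfl, rfl⟩ | ⟨rfl, rfl, rfl⟩ | ⟨rfl, rfl, rfl⟩ | ⟨rfl, rfl, rfl⟩ |
      ⟨rfl, rfl, rfl⟩ | ⟨rfl, rfl, rfl⟩) | h
    on_goal 7 =>
      rw [if_neg (by omega), if_neg (by omega)]
      refine Or.inl (Or.inl ?_)
      omega
    all_goals simp
    all_goals omega

lemma isomorphic_H2 (hr : 4 ≤ r) (hf : IsStringAction (fun k v => extendPerm ρ k v) r)
    (hc : Nat.card V = r + 4)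
    (hv : VertexNumbering (fun k v => extendPerm ρ k v) (r + 4) (Core.H2.full r) v) :
    (permutationGraph ρ).Isomorphic (Family.H2.graph r (r + 4) 0) := by
  refine isomorphic_of_rotation hf hc hv 3 (by omega) (fun l x y h => ?_) (fun l x y h => ?_)
  · simp only [Family.edges, List.mem_append, mem_pathEdges_run, List.mem_cons,
      Prod.mk.injEq, List.not_mem_nil, or_false] at h
    simp only [Core.full, Core.H2, Core.B]
    rcases h with h | ⟨rfl, rfl, rfl⟩ | ⟨rfl, rfl, rfl⟩ | ⟨rfl, rfl, rfl⟩ | ⟨rfl, rfl, rfl⟩ |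
      ⟨rfl, rfl, rfl⟩ | ⟨rfl, rfl, rfl⟩ | ⟨rfl, rfl, rfl⟩
    · rw [if_pos (by omega), if_pos (by omega)]
      refine ⟨by omega, by omega, Or.inl (Or.inr ?_)⟩
      omega
    all_goals simp
    all_goals omega
  · simp only [Core.full, Core.H2, Core.B] at h
    simp only [Family.edges, List.mem_append, mem_pathEdges_run, List.mem_cons,
      Prod.mk.injEq, List.not_mem_nil, or_false]
    rcases h with (⟨rfl, rfl, rfl⟩ | ⟨rfl, rfl, rfl⟩ | ⟨rfl, rfl, rfl⟩ | ⟨rfl, rfl, rfl⟩ |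
      ⟨rfl, rfl, rfl⟩ | ⟨rfl, rfl, rfl⟩ | ⟨rfl, rfl, rfl⟩) | h
    on_goal 8 =>
      rw [if_neg (by omega), if_neg (by omega)]
      refine Or.inl (Or.inl ?_)
      omega
    all_goals simp
    all_goals omega

lemma isomorphic_E (hr : 4 ≤ r) (hf : IsStringAction (fun k v => extendPerm ρ k v) r)
    (hc : Nat.card V = r + 4)
    (hv : VertexNumbering (fun k v => extendPerm ρ k v) (r + 4) (Core.A.tail r) v) :
    (permutationGraph ρ).Isomorphic (Family.E.graph r (r + 4) 0) := by
  refine isomorphic_of_rotation hf hc hv 2 (by omega) (fun l x y h => ?_) (fun l x y h => ?_)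
  · simp only [Family.edges, List.mem_append, mem_pathEdges_append, mem_pathEdges_cons,
      mem_pathEdges_nil, length_run, mem_pathEdges_run, List.mem_cons,
      Prod.mk.injEq, List.not_mem_nil, or_false, and_false] at h
    simp only [Core.full, Core.A, Core.tail, Core.size]
    rcases h with (h | h) | ⟨rfl, rfl, rfl⟩ | ⟨rfl, rfl, rfl⟩ | ⟨rfl, rfl, rfl⟩
    · rw [if_pos (by omega), if_pos (by omega)]
      refine ⟨by omega, by omega, Or.inl (Or.inl (Or.inr ?_))⟩
      omega
    · rw [if_pos (by omega), if_pos (by omega)]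
      refine ⟨by omega, by omega, Or.inl (Or.inr ?_)⟩
      omega
    all_goals simp
  · simp only [Core.full, Core.A, Core.tail, Core.size] at h
    simp only [Family.edges, List.mem_append, mem_pathEdges_append, mem_pathEdges_cons,
      mem_pathEdges_nil, length_run, mem_pathEdges_run, List.mem_cons,
      Prod.mk.injEq, List.not_mem_nil, or_false, and_false]
    rcases h with ((⟨rfl, rfl, rfl⟩ | ⟨rfl, rfl, rfl⟩ | ⟨rfl, rfl, rfl⟩) | h) | h
    on_goal 4 =>
      rw [if_neg (by omega), if_neg (by omega)]
      refine Or.inl (Or.inl (Or.inl ?_))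
      omega
    on_goal 4 =>
      rw [if_neg (by omega), if_neg (by omega)]
      refine Or.inl (Or.inl (Or.inr ?_))
      omega
    all_goals simp
    all_goals omega

lemma isomorphic_I (hr : 4 ≤ r) (hf : IsStringAction (fun k v => extendPerm ρ k v) r)
    (hc : Nat.card V = r + 4)
    (hv : VertexNumbering (fun k v => extendPerm ρ k v) (r + 4) (Core.G.tail r) v) :
    (permutationGraph ρ).Isomorphic (Family.I.graph r (r + 4) 0) := by
  refine isomorphic_of_rotation hf hc hv 2 (by omega) (fun l x y h => ?_) (fun l x y h => ?_)
  · simp only [Family.edges, List.mem_append, mem_pathEdges_append, mem_pathEdges_cons,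
      mem_pathEdges_nil, length_run, mem_pathEdges_run, List.mem_cons,
      Prod.mk.injEq, List.not_mem_nil, or_false, and_false] at h
    simp only [Core.full, Core.G, Core.A, Core.tail, Core.size]
    rcases h with (h | h) | ⟨rfl, rfl, rfl⟩ | ⟨rfl, rfl, rfl⟩ | ⟨rfl, rfl, rfl⟩ | ⟨rfl, rfl, rfl⟩
    · rw [if_pos (by omega), if_pos (by omega)]
      refine ⟨by omega, by omega, Or.inl (Or.inl (Or.inr ?_))⟩
      omega
    · rw [if_pos (by omega), if_pos (by omega)]
      refine ⟨by omega, by omega, Or.inl (Or.inr ?_)⟩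
      omega
    all_goals simp
  · simp only [Core.full, Core.G, Core.A, Core.tail, Core.size] at h
    simp only [Family.edges, List.mem_append, mem_pathEdges_append, mem_pathEdges_cons,
      mem_pathEdges_nil, length_run, mem_pathEdges_run, List.mem_cons,
      Prod.mk.injEq, List.not_mem_nil, or_false, and_false]
    rcases h with ((⟨rfl, rfl, rfl⟩ | ⟨rfl, rfl, rfl⟩ | ⟨rfl, rfl, rfl⟩ | ⟨rfl, rfl, rfl⟩) | h) | h
    on_goal 5 =>
      rw [if_neg (by omega), if_neg (by omega)]
      refine Or.inl (Or.inl (Or.inl ?_))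
      omega
    on_goal 5 =>
      rw [if_neg (by omega), if_neg (by omega)]
      refine Or.inl (Or.inl (Or.inr ?_))
      omega
    all_goals simp
    all_goals omega

lemma isomorphic_C (hr : 4 ≤ r) (hf : IsStringAction (fun k v => extendPerm ρ k v) r)
    (hc : Nat.card V = r + 4)
    (hv : VertexNumbering (fun k v => extendPerm ρ k v) (r + 4) ((Core.A.leaf 1 0).full r) v) :
    (permutationGraph ρ).Isomorphic (Family.C.graph r (r + 4) 0) := by
  refine isomorphic_of_renumber hf hc hv
    (fun x => if x ≤ r then x + 3 else if x = r + 3 then 0 else x - r)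
    (fun x => if 3 ≤ x then x - 3 else if x = 0 then r + 3 else x + r)
    (fun x hx => ?_) (fun x hx => ?_) (fun l x y h => ?_) (fun l x y h => ?_)
  · split_ifs <;> omega
  · split_ifs <;> omega
  · simp only [Family.edges, List.mem_append, mem_pathEdges_run, List.mem_cons, Prod.mk.injEq,
      List.not_mem_nil, or_false] at h
    rcases h with h | ⟨rfl, rfl, rfl⟩ | ⟨rfl, rfl, rfl⟩ | ⟨rfl, rfl, rfl⟩ | ⟨rfl, rfl, rfl⟩
    · rw [if_pos (by omega), if_pos (by omega)]
      refine ⟨by omega, by omega, Or.inl (Or.inr ?_)⟩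
      simp only [Core.leaf, Core.A]
      omega
    all_goals simp [Core.full, Core.leaf, Core.A]
    all_goals omega
  · simp only [Family.edges, List.mem_append, mem_pathEdges_run, List.mem_cons, Prod.mk.injEq,
      List.not_mem_nil, or_false]
    rcases h with (⟨rfl, rfl, rfl⟩ | ⟨x, y, rfl, rfl, ⟨rfl, rfl, rfl⟩ | ⟨rfl, rfl, rfl⟩ |
      ⟨rfl, rfl, rfl⟩⟩) | h
    on_goal 5 =>
      simp only [Core.leaf, Core.A] at h
      rw [if_pos (by omega), if_pos (by omega)]
      refine Or.inl (Or.inl ?_)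
      omega
    all_goals simp
    all_goals omega

lemma isomorphic_D (hr : 4 ≤ r) (hf : IsStringAction (fun k v => extendPerm ρ k v) r)
    (hc : Nat.card V = r + 4)
    (hv : VertexNumbering (fun k v => extendPerm ρ k v) (r + 4) ((Core.A.leaf 1 2).full r) v) :
    (permutationGraph ρ).Isomorphic (Family.D.graph r (r + 4) 0) := by
  refine isomorphic_of_renumber hf hc hv
    (fun x => if x = 0 then 0 else if x ≤ r + 1 then x + 2 else x - (r + 1))
    (fun x => if x = 0 then 0 else if 3 ≤ x then x - 2 else x + (r + 1))
    (fun x hx => ?_) (fun x hx => ?_) (fun l x y h => ?_) (fun l x y h => ?_)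
  · grind
  · grind
  · simp only [Family.edges, List.mem_append, List.singleton_append, mem_pathEdges_cons,
      mem_pathEdges_run, List.mem_cons, Prod.mk.injEq, List.not_mem_nil, or_false] at h
    rcases h with (⟨rfl, rfl, rfl⟩ | h) | ⟨rfl, rfl, rfl⟩ | ⟨rfl, rfl, rfl⟩ | ⟨rfl, rfl, rfl⟩
    on_goal 2 =>
      refine ⟨by omega, by omega, Or.inl (Or.inr ?_)⟩
      simp only [Core.leaf, Core.A]
      split_ifs <;> omega
    all_goals simp [Core.full, Core.leaf, Core.A]
    all_goals omega
  · simp only [Family.edges, List.mem_append, List.singleton_append, mem_pathEdges_cons,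
      mem_pathEdges_run, List.mem_cons, Prod.mk.injEq, List.not_mem_nil, or_false]
    rcases h with (⟨rfl, rfl, rfl⟩ | ⟨x, y, rfl, rfl, ⟨rfl, rfl, rfl⟩ | ⟨rfl, rfl, rfl⟩ |
      ⟨rfl, rfl, rfl⟩⟩) | h
    on_goal 5 =>
      simp only [Core.leaf, Core.A] at h
      refine Or.inl (Or.inl (Or.inr ?_))
      split_ifs <;> omega
    all_goals simp
    all_goals omega

end NonPaths

/-! ### The families as descriptions of the graphs -/

section Classified

variable {r n i : ℕ} {V : Type*} {ρ : Fin r → Equiv.Perm V} {K : Core} {L : List (List ℕ)}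
  {v : ℕ → V}

/-- The permutation graph of the generators, or of the dual ones, belongs to one of the families. -/
def Classified (ρ : Fin r → Equiv.Perm V) (n : ℕ) : Prop :=
  ∃ (F : Family) (i : ℕ), n = r + F.corank ∧ i + 4 ≤ r ∧
    ((permutationGraph ρ).Isomorphic (F.graph r n i) ∨
      (permutationGraph (dualGenerators ρ)).Isomorphic (F.graph r n i))

lemma Core.IsPath.swap {L₁ L₂ : List (List ℕ)} {a b : ℕ}
    (hK : K.IsPath r (L₁ ++ [[a, b]] ++ L₂)) : K.IsPath r (L₁ ++ [[b, a]] ++ L₂) := by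
  intro l x y
  rw [hK l x y]
  simp only [mem_pathEdges_append, mem_pathEdges_cons, List.mem_cons, List.length_append,
    List.length_singleton, or_comm, or_left_comm]

lemma classified_full (hf : IsStringAction (fun k v => extendPerm ρ k v) r)
    (hc : Nat.card V = n) (F : Family) (i : ℕ) (hv : VertexNumbering
    (fun k v => extendPerm ρ k v) n (K.full r) v) (hK : K.IsPath r L)
    (hn : n = r + F.corank) (hi : i + 4 ≤ r) (hL : n = L.length + 1)
    (hF : F.edges r i = pathEdges L) : Classified ρ n := by
  refine ⟨F, i, hn, hi, Or.inl ?_⟩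
  rw [Family.graph, hF]
  exact isomorphic_of_path hf hc hv hK hL

lemma classified_tail (hf : IsStringAction (fun k v => extendPerm ρ k v) r)
    (hc : Nat.card V = n) (F : Family) (i : ℕ) (hv : VertexNumbering
    (fun k v => extendPerm ρ k v) n (K.tail r) v) (hK : K.IsPath r L)
    (hn : n = r + F.corank) (hi : i + 4 ≤ r) (hs : K.size r + 1 = n) (hL : n = L.length + 2)
    (hF : F.edges r i = pathEdges (L ++ [[r - 2]])) : Classified ρ n := by
  refine ⟨F, i, hn, hi, Or.inl ?_⟩
  rw [Family.graph, hF]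
  exact isomorphic_of_path hf hc hv (Core.tail_iff_of_isPath hK (by omega)) (by simp; omega)

lemma classified_full_dual (hf : IsStringAction (fun k v => extendPerm ρ k v) r)
    (hc : Nat.card V = n) (F : Family) (i : ℕ) (hv : VertexNumbering
    (fun k v => extendPerm ρ k v) n (K.full r) v) (hK : K.IsPath r L)
    (hn : n = r + F.corank) (hi : i + 4 ≤ r) (hL : n = L.length + 1)
    (hF : F.edges r i = pathEdges (revPath r L)) : Classified ρ n := by
  refine ⟨F, i, hn, hi, Or.inr ?_⟩
  rw [Family.graph, hF]
  exact isomorphic_dual_of_path hf hc hv hK hL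

lemma classified_tail_dual (hf : IsStringAction (fun k v => extendPerm ρ k v) r)
    (hc : Nat.card V = n) (F : Family) (i : ℕ) (hv : VertexNumbering
    (fun k v => extendPerm ρ k v) n (K.tail r) v) (hK : K.IsPath r L)
    (hn : n = r + F.corank) (hi : i + 4 ≤ r) (hs : K.size r + 1 = n) (hL : n = L.length + 2)
    (hF : F.edges r i = pathEdges (revPath r (L ++ [[r - 2]]))) : Classified ρ n := by
  refine ⟨F, i, hn, hi, Or.inr ?_⟩
  rw [Family.graph, hF]
  exact isomorphic_dual_of_path hf hc hv (Core.tail_iff_of_isPath hK (by omega)) (by simp; omega)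

lemma Core.isPath_T : Core.T.IsPath r ([1] :: run 0 r) := Core.isPath_S.leaf (by decide) 1

lemma Core.isPath_L1 : Core.L1.IsPath r ([0] :: [1] :: run 0 r) :=
  Core.isPath_T.leaf (by decide) 0

lemma Core.isPath_L2 : Core.L2.IsPath r ([2] :: [1] :: run 0 r) :=
  Core.isPath_T.leaf (by decide) 2

/-- With `i + 3` labels, the path `M2` is dual to the path `M2` with parameter `0`. -/
lemma revPath_M2 (i : ℕ) :
    revPath (i + 3) (run 0 (i + 2) ++ [[i + 2, i]] ++ run (i + 1) (i + 3)) =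
      run 0 2 ++ [[0, 2]] ++ run 1 (i + 3) := by
  rw [revPath_append, revPath_append, revPath_singleton, revPath_run le_rfl,
    revPath_run (by omega), List.append_assoc]
  simp only [List.map_cons, List.map_nil, Nat.sub_self, Nat.sub_zero,
    show i + 3 - (i + 1) = 2 by omega, show i + 3 - (i + 2) = 1 by omega,
    show i + 3 - 1 - (i + 2) = 0 by omega, show i + 3 - 1 - i = 2 by omega]

lemma classified_0 (hf : IsStringAction (fun k v => extendPerm ρ k v) r)
    (hc : Nat.card V = r + 1 + 0) (hr : 0 + 4 ≤ r)
    (hd : Described (fun k v => extendPerm ρ k v) r 0) : Classified ρ (r + 1 + 0) := by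
  rcases hd with ⟨K, hK, hm, v, hv⟩ | ⟨w, hw, K, hK, hm, v, hv⟩
  · have hs := Core.size_eq hK hm
    rw [hs] at hv
    obtain rfl := hK
    exact classified_full hf hc .simplex 0 hv Core.isPath_S rfl (by omega) (by simp [length_run])
      rfl
  · omega

lemma classified_1 (hf : IsStringAction (fun k v => extendPerm ρ k v) r)
    (hc : Nat.card V = r + 1 + 1) (hr : 1 + 4 ≤ r)
    (hd : Described (fun k v => extendPerm ρ k v) r 1) : Classified ρ (r + 1 + 1) := by
  rcases hd with ⟨K, hK, hm, v, hv⟩ | ⟨w, hw, K, hK, hm, v, hv⟩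
  · have hs := Core.size_eq hK hm
    rw [hs] at hv
    obtain rfl := hK
    exact classified_full hf hc .truncated 0 hv Core.isPath_T rfl (by omega) (by simp [length_run])
      rfl
  · obtain rfl : w = 0 := by omega
    have hs : K.size r + 1 = r + 1 + 1 := congrArg (· + 1) (Core.size_eq hK hm)
    rw [hs] at hv
    obtain rfl := hK
    refine classified_tail_dual hf hc .truncated 0 hv Core.isPath_S rfl (by omega) hs
      (by simp [length_run]) ?_
    rw [revPath_append, revPath_singleton, revPath_run le_rfl]
    simp only [List.map_cons, List.map_nil, Nat.sub_self, Nat.sub_zero,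
      show r - 1 - (r - 2) = 1 by omega]
    rfl

lemma classified_2 (hf : IsStringAction (fun k v => extendPerm ρ k v) r)
    (hc : Nat.card V = r + 1 + 2) (hr : 2 + 4 ≤ r)
    (hd : Described (fun k v => extendPerm ρ k v) r 2) : Classified ρ (r + 1 + 2) := by
  rcases hd with ⟨K, hK, hm, v, hv⟩ | ⟨w, hw, K, hK, hm, v, hv⟩
  · have hs := Core.size_eq hK hm
    rw [hs] at hv
    rcases hK with (rfl | rfl | rfl | rfl | rfl) | ⟨i, rfl | rfl⟩
    · exact classified_full hf hc .L1 0 hv Core.isPath_L1 rfl (by omega) (by simp [length_run]) rfl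
    · exact classified_full hf hc .L2 0 hv Core.isPath_L2 rfl (by omega) (by simp [length_run]) rfl
    · exact classified_full hf hc .L3 0 hv Core.isPath_L3 rfl (by omega) (by simp [length_run]) rfl
    · exact ⟨.A, 0, rfl, by omega, Or.inl (isomorphic_A (by omega) hf hc hv)⟩
    · exact ⟨.G, 0, rfl, by omega, Or.inl (isomorphic_G (by omega) hf hc hv)⟩
    · have hi : i + 4 ≤ r := hm
      exact classified_full hf hc .M1 i hv (Core.isPath_M1 i) rfl hi
        (by simp [length_run]; omega) rfl
    · rcases Nat.lt_or_ge r (i + 4) with hi | hi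
      -- With the least possible number of labels, the roles of the two ends are exchanged.
      · obtain rfl : r = i + 3 := by simp only [Core.M2] at hm; omega
        refine classified_full_dual hf hc .M2 0 hv (Core.isPath_M2 i).swap rfl (by omega)
          (by simp [length_run]) ?_
        rw [revPath_M2]
        rfl
      · exact classified_full hf hc .M2 i hv (Core.isPath_M2 i) rfl hi
          (by simp [length_run]; omega) rfl
  · obtain rfl : w = 1 := by omega
    have hs : K.size r + 1 = r + 1 + 2 := congrArg (· + 1) (Core.size_eq hK hm)
    rw [hs] at hv
    obtain rfl := hK
    exact classified_tail hf hc .K 0 hv Core.isPath_T rfl (by omega) hs (by simp [length_run]) rfl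

lemma classified_3 [Finite V] (hf : IsStringAction (fun k v => extendPerm ρ k v) r)
    (hc : Nat.card V = r + 1 + 3) (hC : IsStringCGroup ρ) (hr : 3 + 4 ≤ r)
    (hd : Described (fun k v => extendPerm ρ k v) r 3) : Classified ρ (r + 1 + 3) := by
  rcases hd with ⟨K, hK, hm, v, hv⟩ | ⟨w, hw, K, hK, hm, v, hv⟩
  · have hs := Core.size_eq hK hm
    rw [hs] at hv
    rcases hK with (rfl | rfl | rfl | rfl | rfl | rfl | rfl | rfl | rfl | rfl | rfl | rfl | rfl) |
      ⟨i, rfl | rfl⟩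
    · exact ⟨.B, 0, rfl, by omega, Or.inl (isomorphic_B (by omega) hf hc hv)⟩
    · exact ⟨.H1, 0, rfl, by omega, Or.inl (isomorphic_H1 (by omega) hf hc hv)⟩
    · exact ⟨.H2, 0, rfl, by omega, Or.inl (isomorphic_H2 (by omega) hf hc hv)⟩
    · rw [← hs] at hc hv
      exact (not_isStringCGroup_X3 (by omega) hc hf hv hC).elim
    · exact classified_full hf hc .Q3 0 hv Core.isPath_Q3 rfl (by omega) (by simp [length_run]) rfl
    · exact classified_full hf hc .P1 0 hv (Core.isPath_L1.leaf (by decide) 1) rfl (by omega)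
        (by simp [length_run]) rfl
    · exact classified_full hf hc .P2 0 hv (Core.isPath_L2.leaf (by decide) 1) rfl (by omega)
        (by simp [length_run]) rfl
    · exact classified_full hf hc .Q2 0 hv (Core.isPath_L2.leaf (by decide) 3) rfl (by omega)
        (by simp [length_run]) rfl
    · exact classified_full hf hc .P3 0 hv (Core.isPath_L3.leaf (by decide) 1) rfl (by omega)
        (by simp [length_run]) rfl
    · exact ⟨.C, 0, rfl, by omega, Or.inl (isomorphic_C (by omega) hf hc hv)⟩
    · rw [← hs] at hc hv
      exact (not_isStringCGroup_leaf_A (by omega) hc hf hv hC).elim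
    · exact ⟨.D, 0, rfl, by omega, Or.inl (isomorphic_D (by omega) hf hc hv)⟩
    · rw [← hs] at hc hv
      exact (not_isStringCGroup_leaf_G (by omega) hc hf hv hC).elim
    · have hi : i + 4 ≤ r := le_trans (le_max_left _ _) hm
      exact classified_full hf hc .V1 i hv ((Core.isPath_M1 i).leaf (by simp [Core.M1]) 1) rfl hi
        (by simp [length_run]; omega) rfl
    · rcases Nat.lt_or_ge r (i + 4) with hi | hi
      -- With the least possible number of labels, the roles of the two ends are exchanged.
      · obtain rfl : r = i + 3 := by simp only [Core.M2, Core.leaf, sup_le_iff] at hm; omega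
        refine classified_full_dual hf hc .O2 0 hv
          ((Core.isPath_M2 i).swap.leaf (by simp [Core.M2]) 1) rfl (by omega)
          (by simp [length_run]) ?_
        rw [← List.singleton_append, revPath_append, revPath_M2]
        rfl
      · exact classified_full hf hc .V2 i hv ((Core.isPath_M2 i).leaf (by simp [Core.M2]) 1) rfl hi
          (by simp [length_run]; omega) rfl
  · obtain rfl : w = 2 := by omega
    have hs : K.size r + 1 = r + 1 + 3 := congrArg (· + 1) (Core.size_eq hK hm)
    rw [hs] at hv
    rcases hK with (rfl | rfl | rfl | rfl | rfl) | ⟨i, rfl | rfl⟩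
    · exact classified_tail hf hc .N1 0 hv Core.isPath_L1 rfl (by omega) hs (by simp [length_run])
        rfl
    · exact classified_tail hf hc .N2 0 hv Core.isPath_L2 rfl (by omega) hs (by simp [length_run])
        rfl
    · exact classified_tail hf hc .N3 0 hv Core.isPath_L3 rfl (by omega) hs (by simp [length_run])
        rfl
    · exact ⟨.E, 0, rfl, by omega, Or.inl (isomorphic_E (by omega) hf hc hv)⟩
    · exact ⟨.I, 0, rfl, by omega, Or.inl (isomorphic_I (by omega) hf hc hv)⟩
    · have hi : i + 4 ≤ r := hm
      exact classified_tail hf hc .O1 i hv (Core.isPath_M1 i) rfl hi hs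
        (by simp [length_run]; omega) rfl
    · rcases Nat.lt_or_ge r (i + 4) with hi | hi
      -- With the least possible number of labels, the roles of the two ends are exchanged.
      · obtain rfl : r = i + 3 := by simp only [Core.M2] at hm; omega
        refine classified_tail_dual hf hc .V2 0 hv (Core.isPath_M2 i).swap rfl (by omega) hs
          (by simp [length_run]) ?_
        rw [revPath_append, revPath_M2, revPath_singleton]
        simp only [List.map_cons, List.map_nil, show i + 3 - 1 - (i + 3 - 2) = 1 by omega]
        rfl
      · exact classified_tail hf hc .O2 i hv (Core.isPath_M2 i) rfl hi hs
          (by simp [length_run]; omega) rfl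

end Classified

/-! ### String C-groups as string graphs -/

section StringGroups

variable {r n : ℕ} {V : Type*} {ρ : Fin r → Equiv.Perm V}

lemma dualGenerators_dualGenerators {G : Type*} (ρ : Fin r → G) :
    dualGenerators (dualGenerators ρ) = ρ := by
  funext i
  simp [dualGenerators]

lemma parabolic_dualGenerators {G : Type*} [Group G] (ρ : Fin r → G) (J : Set (Fin r)) :
    parabolic (dualGenerators ρ) J = parabolic ρ (Fin.rev '' J) := by
  rw [parabolic, parabolic, Set.image_image]
  rfl

lemma IsStringCGroup.dual {G : Type*} [Group G] {ρ : Fin r → G} (h : IsStringCGroup ρ) :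
    IsStringCGroup (dualGenerators ρ) where
  injective := h.injective.comp Fin.rev_injective
  involution i := h.involution _
  commuting i j hij := by
    refine h.commuting _ _ ?_
    rw [abs_sub_comm] at hij
    convert hij using 2
    simp only [Fin.val_rev]
    omega
  intersection J K := by
    simp only [parabolic_dualGenerators]
    rw [h.intersection, Set.image_inter Fin.rev_injective]

lemma IsSggi.isStringAction (h : IsSggi ρ) :
    IsStringAction (fun k v => extendPerm ρ k v) r where
  invol k v := by
    by_cases hk : k < r
    · simp only [extendPerm, hk, dif_pos, ← Equiv.Perm.mul_apply, h.mul_self]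
      rfl
    · simp [extendPerm, hk]
  triv k v hk := by simp [extendPerm, Nat.not_lt.mpr hk]
  comm j k v hjk := by
    by_cases hk : k < r
    · have hj : j < r := by omega
      have h1 := h.commuting ⟨j, hj⟩ ⟨k, hk⟩ (by
        rw [abs_sub_comm, abs_of_pos] <;> simp only [] <;> omega)
      have h2 : ρ ⟨j, hj⟩ * ρ ⟨k, hk⟩ = ρ ⟨k, hk⟩ * ρ ⟨j, hj⟩ := by
        rw [pow_two] at h1
        rw [← inv_eq_of_mul_eq_one_right h1, mul_inv_rev,
          inv_eq_of_mul_eq_one_right (h.mul_self _), inv_eq_of_mul_eq_one_right (h.mul_self _)]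
      simp only [extendPerm, hj, hk, dif_pos, ← Equiv.Perm.mul_apply, h2]
    · simp [extendPerm, hk]

lemma link_of_mem_closure (hf : IsStringAction (fun k v => extendPerm ρ k v) r)
    {g : Equiv.Perm V} (hg : g ∈ Subgroup.closure (Set.range ρ)) (u : V) :
    Link (fun k v => extendPerm ρ k v) Set.univ u (g u) := by
  refine Subgroup.closure_induction
    (p := fun g _ => ∀ u, Link (fun k v => extendPerm ρ k v) Set.univ u (g u))
    ?_ (fun u => Link.refl) (fun x y _ _ hx hy u => (hy u).trans (hx (y u)))
    (fun x _ hx u => ?_) hg u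
  · rintro _ ⟨k, rfl⟩ u
    rw [← extendPerm_of_lt ρ k]
    exact Link.step (Set.mem_univ (k : ℕ))
  · have := hx (x⁻¹ u)
    rw [show x (x⁻¹ u) = u by simp] at this
    exact hf.symm this

lemma exists_mem_maximalParabolic {j : Fin r} {u v : V}
    (h : Link (fun k v => extendPerm ρ k v) {(j : ℕ)}ᶜ u v) :
    ∃ g ∈ maximalParabolic ρ j, g u = v := by
  refine h.closed (P := fun v => ∃ g ∈ maximalParabolic ρ j, g u = v) ?_
    ⟨1, Subgroup.one_mem _, rfl⟩
  rintro _ ⟨g, hg, rfl⟩ k hk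
  by_cases hkr : k < r
  · refine ⟨ρ ⟨k, hkr⟩ * g, Subgroup.mul_mem _ (Subgroup.subset_closure ⟨⟨k, hkr⟩, ?_, rfl⟩) hg, ?_⟩
    · rintro rfl
      exact hk rfl
    · simp [extendPerm, hkr]
  · exact ⟨g, hg, by simp [extendPerm, hkr]⟩

/-- If a label had no fracture edge, then the other labels would still connect all vertices. -/
lemma IsSggi.isStringGraph (h : IsSggi ρ)
    (htrans : MulAction.IsPretransitive (Subgroup.closure (Set.range ρ)) V)
    (hintrans : ∀ j : Fin r, ¬ MulAction.IsPretransitive (maximalParabolic ρ j) V) :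
    IsStringGraph (fun k v => extendPerm ρ k v) r where
  toIsStringAction := h.isStringAction
  conn u v := by
    obtain ⟨⟨g, hg⟩, rfl⟩ := htrans.exists_smul_eq u v
    exact link_of_mem_closure h.isStringAction hg u
  fract k hk := by
    by_contra! hno
    refine hintrans ⟨k, hk⟩ ⟨fun u v => ?_⟩
    obtain ⟨⟨g, hg⟩, rfl⟩ := htrans.exists_smul_eq u v
    have hl : Link (fun k v => extendPerm ρ k v) {k}ᶜ u (g u) := by
      refine (link_of_mem_closure h.isStringAction hg u).closed
        (P := fun v => Link (fun k v => extendPerm ρ k v) {k}ᶜ u v) (fun p hp m _ => ?_) Link.refl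
      by_cases hm : m = k
      · subst hm
        exact hp.trans (not_not.mp (hno p))
      · exact hp.trans (Link.step hm)
    obtain ⟨g', hg', e⟩ := exists_mem_maximalParabolic (j := ⟨k, hk⟩) hl
    exact ⟨⟨g', hg'⟩, e⟩

lemma Described.classified [Finite V] {w : ℕ} (h : IsStringCGroup ρ) (hc : Nat.card V = r + 1 + w)
    (hw : w ≤ 3) (hr : w + 4 ≤ r) (hd : Described (fun k v => extendPerm ρ k v) r w) :
    Classified ρ (r + 1 + w) := by
  have hf := h.toIsSggi.isStringAction
  match w, hw with
  | 0, _ => exact classified_0 hf hc hr hd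
  | 1, _ => exact classified_1 hf hc hr hd
  | 2, _ => exact classified_2 hf hc hr hd
  | 3, _ => exact classified_3 hf hc h hr hd

lemma Classified.of_dual (h : Classified (dualGenerators ρ) n) : Classified ρ n := by
  obtain ⟨F, i, hn, hi, h⟩ := h
  rw [dualGenerators_dualGenerators] at h
  exact ⟨F, i, hn, hi, h.symm⟩

end StringGroups

theorem mainTheorem3 (n r : ℕ) (hn : 0 < n) (ρ : Fin r → Equiv.Perm (Fin n))
    (hC : IsStringCGroup ρ)
    (htrans : MulAction.IsPretransitive (Subgroup.closure (Set.range ρ)) (Fin n))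
    (hintrans : ∀ j : Fin r, ¬ MulAction.IsPretransitive (maximalParabolic ρ j) (Fin n))
    (hr : n ≤ r + 4)
    (hbound : ∀ l : ℕ, 1 ≤ l → l ≤ 4 → n = r + l → 3 + 2 * l ≤ n) :
    ∃ (F : Family) (i : ℕ), n = r + F.corank ∧ i + 4 ≤ r ∧
      ((permutationGraph ρ).Isomorphic (F.graph r n i) ∨
        (permutationGraph (dualGenerators ρ)).Isomorphic (F.graph r n i)) := by
  have : Nonempty (Fin n) := ⟨⟨0, hn⟩⟩
  have hf := hC.toIsSggi.isStringGraph htrans hintrans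
  have hcard : Nat.card (Fin n) = n := Nat.card_eq_fintype_card.trans (Fintype.card_fin n)
  have hpos := hf.good_bound ∅ (by simp)
  rw [hcard, Finset.card_empty] at hpos
  obtain ⟨w, rfl⟩ : ∃ w, n = r + 1 + w := ⟨n - (r + 1), by omega⟩
  have hb := hbound (w + 1) (by omega) (by omega) (by omega)
  rcases described_or_dual hf hcard (by omega) (by omega) with hd | hd
  · exact hd.classified hC hcard (by omega) (by omega)
  · rw [← extendPerm_dualGenerators] at hd
    exact (hd.classified hC.dual hcard (by omega) (by omega)).of_dual
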